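/- Let $d\ge 1$ be an integer. For $0<\tau<1$ and $n\in\mathbb N$ define the kernel on $\mathbb C^d\times\mathbb C^d$ $$\mathcal K_n(Z,Z')=\frac{1}{\pi^d(1-\tau^2)^{d/2}}\sum_{j_1+\dots+j_d<n}\frac{(\tau/2)^{j_1+\dots+j_d}}{j_1!\cdots j_d!}\prod_{k=1}^d\sqrt{\omega(Z_k)\omega(Z_k')}\;H_{j_k}\!\Big(\frac{Z_k}{\sqrt{2\tau}}\Big)\overline{H_{j_k}\!\Big(\frac{Z'_k}{\sqrt{2\tau}}\Big)},$$ where the sum is over multi-indices $j\in\mathbb Z_{\ge0}^d$, $\omega(z)=\exp\!\big(-\frac{(\operatorname{Re}z)^2}{1+\tau}-\frac{(\operatorname{Im}z)^2}{1-\tau}\big)$ and $H_j$ is the Hermite polynomial of degree $j$ with leading coefficient $2^j$. Put $\mathbb K_n(Z,Z')=n^d\,\mathcal K_n(\sqrt n Z,\sqrt n Z')$. For $\zeta\in\mathbb C^d$ write $\zeta^2=\sum_k\zeta_k^2$ and $|\zeta|^2=\sum_k|\zeta_k|^2$. Let $\widehat J_\nu$ be the entire function with $\widehat J_\nu(z^2)=(2/z)^\nu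 J_\nu(z)$, where $J_\nu$ is the Bessel function of the first kind. A cocycle is a function of the form $c(U,V)=g(U)/g(V)$ with $g$ nowhere zero. Let $X\in\mathbb R^d$ with $|X|<2$, let $\kappa>0$ be constant, and set $$\nu(X)=\frac{(4-|X|^2)^{d/2}}{(2\pi)^d},\qquad \tau=1-\frac{\kappa}{\nu(X)^{2/d}\,n}.$$ (1) For all $U,V\in\mathbb C^d$, as $n\to\infty$, $$\frac{1}{\nu(X)^2n^{2d}}\,\mathbb K_n\Big(X+\frac{U}{\nu(X)^{1/d}n},\,X+\frac{V}{\nu(X)^{1/d}n}\Big)=C_X(U,V)\,\mathcal S_\kappa(U,V)+\mathcal O\Big(\frac1n\Big),$$ where $$\mathcal S_\kappa(U,V)=\frac{e^{-\frac{|\operatorname{Im}U|^2+|\operatorname{Im}V|^2}{2\kappa}}}{(4\kappa)^{d/2}}\;2\int_0^1e^{-\kappa\pi^2t^2}\,t^{d-1}\,\widehat J_{\frac d2-1}\big((U-\overline V)^2\pi^2t^2\big)\,dt$$ and $C_X(U,V)=\exp\!\big(\tfrac i2\,\nu(X)^{-1/d}\langle X,\operatorname{Im}(U-V)\rangle\big)$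 is a cocycle. (2) The kernel $\mathcal S_\kappa$ interpolates between the real and the complex bulk statistics. For all $x,y\in\mathbb R^d$, $$\lim_{\kappa\downarrow0}(\pi\kappa)^{d/2}\,\mathcal S_\kappa(x,y)=\Big(\frac\pi4\Big)^{d/2}\widehat J_{\frac d2}\big(\pi^2|x-y|^2\big)\quad\Big(=\frac{J_{d/2}(\pi|x-y|)}{(2|x-y|)^{d/2}}\text{ for }x\ne y\Big),$$ and for all $u,v\in\mathbb C^d$, $$\lim_{\kappa\to\infty}\kappa^d\,\mathcal S_\kappa(\sqrt\kappa\,u,\sqrt\kappa\,v)=c(u,v)\prod_{k=1}^d\frac1{2\pi}\exp\!\Big(-\frac{|u_k|^2+|v_k|^2-2u_k\overline{v_k}}{4}\Big),$$ where $c(u,v)=\prod_{k=1}^d\exp\!\big(-\tfrac i4\operatorname{Im}(u_k^2-v_k^2)\big)$ is a cocycle. -/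

import Mathlib

open Filter Topology Asymptotics ComplexConjugate
open scoped Nat

noncomputable section

namespace WeakNonHermitian

/-- The physicists' Hermite polynomial `H_j` (leading coefficient `2 ^ j`), obtained from the
probabilists' polynomial `He_j` of Mathlib by `H_j(z) = 2^{j/2} He_j(√2 z)`. -/
def hermiteH (j : ℕ) (z : ℂ) : ℂ :=
  (Real.sqrt 2 : ℂ) ^ j * Polynomial.aeval ((Real.sqrt 2 : ℂ) * z) (Polynomial.hermite j)

/-- The one-variable weight `ω(z) = exp(-(Re z)² / (1 + τ) - (Im z)² / (1 - τ))`. -/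
def weight (τ : ℝ) (z : ℂ) : ℝ :=
  Real.exp (-(z.re ^ 2 / (1 + τ)) - z.im ^ 2 / (1 - τ))

/-- The multi-indices `j = (j_1, …, j_d)` with `j_1 + ⋯ + j_d < n`. -/
def multiIndices (d n : ℕ) : Finset (Fin d → ℕ) :=
  (Fintype.piFinset fun _ : Fin d => Finset.range n).filter fun j => ∑ k, j k < n

/-- The kernel of planar Hermite polynomials on `ℂ^d`. -/
def planarKernel (d : ℕ) (τ : ℝ) (n : ℕ) (Z Z' : Fin d → ℂ) : ℂ :=
  (1 / (Real.pi ^ d * (1 - τ ^ 2) ^ ((d : ℝ) / 2)) : ℝ) *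
    ∑ j ∈ multiIndices d n,
      (((τ / 2) ^ (∑ k, j k) / (∏ k, ((j k)! : ℝ)) : ℝ) : ℂ) *
        ∏ k, ((Real.sqrt (weight τ (Z k) * weight τ (Z' k)) : ℝ) : ℂ) *
          hermiteH (j k) (Z k / (Real.sqrt (2 * τ) : ℂ)) *
          conj (hermiteH (j k) (Z' k / (Real.sqrt (2 * τ) : ℂ)))

/-- The kernel in global scaling, `n^d K_n(√n Z, √n Z')`. -/
def scaledKernel (d : ℕ) (τ : ℝ) (n : ℕ) (Z Z' : Fin d → ℂ) : ℂ :=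
  (n : ℂ) ^ d *
    planarKernel d τ n (fun k => (Real.sqrt n : ℂ) * Z k) (fun k => (Real.sqrt n : ℂ) * Z' k)

/-- `ν(X) = (2π)^{-d} (4 - |X|²)^{d/2}`. -/
def nu {d : ℕ} (X : EuclideanSpace ℝ (Fin d)) : ℝ :=
  1 / (2 * Real.pi) ^ d * (4 - ‖X‖ ^ 2) ^ ((d : ℝ) / 2)

/-- The non-Hermiticity parameter `τ = 1 - κ / (ν(X)^{2/d} n)`. -/
def weakTau {d : ℕ} (X : EuclideanSpace ℝ (Fin d)) (κ : ℝ) (n : ℕ) : ℝ :=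
  1 - κ / (nu X ^ (2 / (d : ℝ)) * n)

/-- The point `X + U / (ν(X)^{1/d} n)` of `ℂ^d`. -/
def zoom {d : ℕ} (X : EuclideanSpace ℝ (Fin d)) (n : ℕ) (U : Fin d → ℂ) : Fin d → ℂ :=
  fun k => (X k : ℂ) + U k / ((nu X ^ (1 / (d : ℝ)) * n : ℝ) : ℂ)

/-- The factor `C_X(U, V) = exp(i ν(X)^{-1/d} ⟨X, Im (U - V)⟩ / 2)`. -/
def bulkCocycle {d : ℕ} (X : EuclideanSpace ℝ (Fin d)) (U V : Fin d → ℂ) : ℂ :=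
  Complex.exp (Complex.I *
    ((nu X ^ (-1 / (d : ℝ)) * (1 / 2) * ∑ k, X k * (U k - V k).im : ℝ) : ℂ))

/-- A cocycle is a function `c(U, V) = g(U) / g(V)` with nowhere vanishing `g`; multiplying a
kernel by it does not change the determinants `det (K(Z_i, Z_j))`. -/
def IsCocycle {α : Type*} (c : α → α → ℂ) : Prop :=
  ∃ g : α → ℂ, (∀ U, g U ≠ 0) ∧ ∀ U V, c U V = g U / g V

/-- The Bessel function of the first kind,
`J_ν(z) = (z/2)^ν ∑_k (-1)^k (z/2)^{2k} / (k! Γ(k + ν + 1))`. -/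
def besselJ (ν : ℝ) (z : ℂ) : ℂ :=
  (z / 2) ^ (ν : ℂ) *
    ∑' k : ℕ, (-1) ^ k * (z / 2) ^ (2 * k) / ((k ! : ℂ) * (Real.Gamma (k + ν + 1) : ℂ))

/-- The entire function `w ↦ Ĵ_ν(w)` with `Ĵ_ν(z²) = (2/z)^ν J_ν(z)`. -/
def besselHat (ν : ℝ) (w : ℂ) : ℂ :=
  ∑' k : ℕ, (-1) ^ k * (w / 4) ^ k / ((k ! : ℂ) * (Real.Gamma (k + ν + 1) : ℂ))

theorem besselHat_sq (ν : ℝ) {z : ℂ} (hz : z ∈ Complex.slitPlane) :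
    besselHat ν (z ^ 2) = (2 / z) ^ (ν : ℂ) * besselJ ν z := by
  have hz0 : z ≠ 0 := Complex.slitPlane_ne_zero hz
  have harg : (z / 2).arg ≠ Real.pi := by
    have h : z / 2 = ((1 / 2 : ℝ) : ℂ) * z := by push_cast; ring
    rw [h, Complex.arg_real_mul _ (by norm_num)]
    exact Complex.slitPlane_arg_ne_pi hz
  have h1 : (2 / z) ^ (ν : ℂ) * (z / 2) ^ (ν : ℂ) = 1 := by
    rw [← inv_div z 2, Complex.inv_cpow _ _ harg]
    refine inv_mul_cancel₀ ?_
    simp [Complex.cpow_eq_zero_iff, hz0]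
  rw [besselJ, ← mul_assoc, h1, one_mul, besselHat]
  refine tsum_congr fun k => ?_
  rw [pow_mul (z / 2) 2 k, div_pow z 2 2]
  norm_num

/-- The deformed sine kernel
`e^{-(|Im U|² + |Im V|²)/(2κ)} (4κ)^{-d/2} · 2 ∫_0^1 e^{-κπ²t²} t^{d-1} Ĵ_{d/2-1}((U - V̄)² π² t²) dt`,
where `(U - V̄)² = ∑_k (U_k - V̄_k)²`. -/
def deformedSineKernel (d : ℕ) (κ : ℝ) (U V : Fin d → ℂ) : ℂ :=
  ((Real.exp (-((∑ k, (U k).im ^ 2 + ∑ k, (V k).im ^ 2) / (2 * κ))) /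
      (4 * κ) ^ ((d : ℝ) / 2) : ℝ) : ℂ) *
    (2 * ∫ t in (0 : ℝ)..1,
      ((Real.exp (-(κ * Real.pi ^ 2 * t ^ 2)) * t ^ (d - 1) : ℝ) : ℂ) *
        besselHat ((d : ℝ) / 2 - 1)
          ((∑ k, (U k - conj (V k)) ^ 2) * ((Real.pi ^ 2 * t ^ 2 : ℝ) : ℂ)))

/-- The sine kernel on `ℝ^d`, `(π/4)^{d/2} Ĵ_{d/2}(π² |x - y|²)`, which for `x ≠ y` is
`J_{d/2}(π |x - y|) / (2 |x - y|)^{d/2}`. -/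
def realSineKernel (d : ℕ) (x y : Fin d → ℝ) : ℂ :=
  (((Real.pi / 4) ^ ((d : ℝ) / 2) : ℝ) : ℂ) *
    besselHat ((d : ℝ) / 2) ((Real.pi ^ 2 * ∑ k, (x k - y k) ^ 2 : ℝ) : ℂ)

/-- The product of one-dimensional Ginibre kernels
`∏_k (2π)^{-1} exp(-(|u_k|² + |v_k|² - 2 u_k v̄_k) / 4)`. -/
def ginibreKernel (d : ℕ) (u v : Fin d → ℂ) : ℂ :=
  ∏ k, (1 / (2 * Real.pi) : ℂ) *
    Complex.exp (-(((‖u k‖ ^ 2 + ‖v k‖ ^ 2 : ℝ) : ℂ) - 2 * u k * conj (v k)) / 4)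

/-- The factor `∏_k exp(-(i/4) Im (u_k² - v_k²))`. -/
def ginibreCocycle (d : ℕ) (u v : Fin d → ℂ) : ℂ :=
  ∏ k, Complex.exp (-(Complex.I / 4) * ((((u k) ^ 2 - (v k) ^ 2).im : ℝ) : ℂ))

end WeakNonHermitian

end

/-! The kernel is a truncated sum ∑_{m<n} a_m τ^m, where ∑ a_m σ^m is a product of d Mehler series
and so has the closed form (1-σ²)^{-d/2} exp(...) (`hasPS_mehlerSeries`, `sum_multiIndices`). Such a
truncation equals the integral of the generating function against (τ/σ)^n dσ / (2πi(τ-σ)) over a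
circle of radius less than τ. This is `planarKernel_eq`, written in the variable ζ = log σ on the
line Re ζ = -c/n.

With x = |X|, the large factor is exp(n(x² tanh(ζ/2)/2 - ζ)). It has modulus one on the unit circle
|σ| = 1, and its saddle points are σ = e^{±iθ₀} with 2(1 + cos θ₀) = x². As 1 - τ = k/n, the pole τ
and the branch point 1 merge at scale 1/n, and the main term, of order n^{d/2}, comes from there.
Elsewhere the contour is pushed outside the unit circle between 1 and the saddle, taken across it at
the saddle, and kept inside beyond it. For x > 0 this part costs O(n^{-1/2}), which is within
n^{d/2-1}. For x = 0 the saddles collapse into the singularity -1, which the contour passes at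
distance of order 1/n, and the cost is O(n^{d/2-1}) (`farBound_pos`, `farBound_zero`).

Near σ = 1 the integrand is replaced by a model, singular at 1 and τ only, with linear exponent -Nζ,
N close to n(1 - x²/4) (`near_bound`, `integral_comparison`). The model integral is explicit:
expanding in (1-σ)^{-1}/n gives binomial coefficients, that is, quotients of Gamma values, whose
limit with rate 1/n is uniform enough to sum (`modelIntegral_asymptotics`). The double series in the
limit resums to incomplete Gamma functions (`tsum_modelSeries`).

The deformed sine kernel has that same series, obtained by integrating the Bessel series term by
term (`deformedSineKernel_eq_tsum`). Both limits in κ are then termwise. As A → 0, `incGamma h A`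
tends to 1/Γ(h/2+1), which produces a Bessel series. As A → ∞, A^{h/2} `incGamma h A` tends to 1,
which produces an exponential series. -/

noncomputable section

namespace WeakNonHermitian

/-! ### Gamma estimates and the normalised incomplete Gamma function -/

theorem factorial_mul_Gamma_le {s : ℝ} (hs : 0 ≤ s) (j : ℕ) :
    (j ! : ℝ) * Real.Gamma (s + 1) ≤ Real.Gamma (s + j + 1) := by
  induction j with
  | zero => simp
  | succ j ih =>
    have h1 : Real.Gamma (s + (j + 1 : ℕ) + 1) = (s + j + 1) * Real.Gamma (s + j + 1) := by
      rw [← Real.Gamma_add_one (by positivity)]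
      push_cast; ring_nf
    have h2 : 0 < Real.Gamma (s + j + 1) := Real.Gamma_pos_of_pos (by positivity)
    rw [h1, Nat.factorial_succ]
    push_cast
    calc ((j : ℝ) + 1) * j ! * Real.Gamma (s + 1) = (j + 1) * (j ! * Real.Gamma (s + 1)) := by ring
      _ ≤ (s + j + 1) * Real.Gamma (s + j + 1) := by
        gcongr; linarith

/-- Each unit step multiplies Γ by k + s ≥ s. This geometric bound is crude but sufficient, since a
factor 1/k! accompanies it in the dominating series. -/
theorem one_div_Gamma_add_nat_le {s : ℝ} (hs : 0 < s) (k : ℕ) :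
    1 / Real.Gamma (k + s) ≤ (1 / s) ^ k / Real.Gamma s := by
  induction k with
  | zero => simp
  | succ k ih =>
    have h1 : Real.Gamma ((k + 1 : ℕ) + s) = (k + s) * Real.Gamma (k + s) := by
      rw [← Real.Gamma_add_one (by positivity)]
      push_cast; ring_nf
    have h2 : 0 < Real.Gamma (k + s) := Real.Gamma_pos_of_pos (by positivity)
    have h3 : 0 < Real.Gamma s := Real.Gamma_pos_of_pos hs
    rw [h1, pow_succ]
    calc 1 / ((k + s) * Real.Gamma (k + s)) = 1 / (k + s) * (1 / Real.Gamma (k + s)) := by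
          field_simp
      _ ≤ 1 / s * ((1 / s) ^ k / Real.Gamma s) := by
        gcongr
        linarith [(Nat.cast_nonneg k : (0:ℝ) ≤ k)]
      _ = _ := by ring

/-- The incomplete Gamma function `Γ(h/2)⁻¹ ∫_0^1 e^{-A r} r^{h/2-1} dr` at half-integers. -/
def incGamma (h : ℕ) (A : ℝ) : ℝ :=
  (2 * ∫ t in (0 : ℝ)..1, Real.exp (-(A * t ^ 2)) * t ^ (h - 1)) / Real.Gamma (h / 2)

theorem integrableOn_exp_neg_sq_mul_pow (m : ℕ) :
    MeasureTheory.IntegrableOn (fun t : ℝ => Real.exp (-t ^ 2) * t ^ m) (Set.Ioi 0) := by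
  have := integrableOn_rpow_mul_exp_neg_rpow (p := 2) (s := (m : ℝ))
    (by linarith [(Nat.cast_nonneg m : (0:ℝ) ≤ m)]) (by norm_num)
  refine this.congr_fun (fun t _ => ?_) measurableSet_Ioi
  simp [mul_comm]

theorem integral_Ioi_exp_neg_sq_mul_pow {h : ℕ} (hh : 0 < h) :
    2 * ∫ t in Set.Ioi (0 : ℝ), Real.exp (-t ^ 2) * t ^ (h - 1) = Real.Gamma (h / 2) := by
  have := integral_rpow_mul_exp_neg_rpow (p := 2) (q := ((h - 1 : ℕ) : ℝ)) (by norm_num)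
    (by linarith [(Nat.cast_nonneg (h - 1) : (0:ℝ) ≤ (h - 1 : ℕ))])
  have h2 : (((h - 1 : ℕ) : ℝ) + 1) / 2 = h / 2 := by
    rw [Nat.cast_sub hh]; simp
  rw [h2] at this
  have h3 : ∫ t in Set.Ioi (0 : ℝ), Real.exp (-t ^ 2) * t ^ (h - 1) =
      ∫ x in Set.Ioi (0 : ℝ), x ^ ((h - 1 : ℕ) : ℝ) * Real.exp (-x ^ (2 : ℝ)) :=
    MeasureTheory.setIntegral_congr_fun measurableSet_Ioi fun t _ => by simp [mul_comm]
  rw [h3, this]; ring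

theorem incGamma_nonneg (h : ℕ) (A : ℝ) : 0 ≤ incGamma h A := by
  refine div_nonneg (mul_nonneg zero_le_two ?_) (Real.Gamma_nonneg_of_nonneg (by positivity))
  exact intervalIntegral.integral_nonneg zero_le_one fun t ht => mul_nonneg (Real.exp_pos _).le
    (pow_nonneg ht.1 _)

theorem incGamma_zero {h : ℕ} (hh : 0 < h) : incGamma h 0 = 1 / Real.Gamma (h / 2 + 1) := by
  have h1 : ((h - 1 : ℕ) : ℝ) + 1 = h := by rw [Nat.cast_sub hh]; simp
  have h2 : 0 < (h : ℝ) := by exact_mod_cast hh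
  have h3 : 0 < Real.Gamma (h / 2) := Real.Gamma_pos_of_pos (by positivity)
  rw [incGamma, Real.Gamma_add_one (by positivity)]
  simp [integral_pow, h1, Nat.sub_add_cancel hh, hh.ne']
  field_simp

theorem incGamma_le {h : ℕ} (hh : 0 < h) {A : ℝ} (hA : 0 ≤ A) :
    incGamma h A ≤ 1 / Real.Gamma (h / 2 + 1) := by
  rw [← incGamma_zero hh, incGamma, incGamma]
  have h3 : 0 < Real.Gamma (h / 2) := Real.Gamma_pos_of_pos (by positivity)
  gcongr
  refine intervalIntegral.integral_mono_on zero_le_one ?_ ?_ fun t ht => ?_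
  · exact Continuous.intervalIntegrable (by fun_prop) _ _
  · exact Continuous.intervalIntegrable (by fun_prop) _ _
  · have := ht.1
    have h4 : 0 ≤ A * t ^ 2 := by positivity
    have h5 : Real.exp (-(A * t ^ 2)) ≤ Real.exp (-(0 * t ^ 2)) := Real.exp_le_exp.2 (by linarith)
    gcongr

/-- Integration by parts, from the derivative of e^{-At²} t^h over [0, 1]. The parameter is twice
the Gamma index, so raising the index by one is h ↦ h + 2. -/
theorem incGamma_eq_add {h : ℕ} (hh : 0 < h) (A : ℝ) :
    incGamma h A = Real.exp (-A) / Real.Gamma (h / 2 + 1) + A * incGamma (h + 2) A := by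
  have h2 : 0 < (h : ℝ) := by exact_mod_cast hh
  have h3 : 0 < Real.Gamma (h / 2) := Real.Gamma_pos_of_pos (by positivity)
  have key : ∫ t in (0 : ℝ)..1, (Real.exp (-(A * t ^ 2)) * (-(2 * A * t)) * t ^ h +
      Real.exp (-(A * t ^ 2)) * (h * t ^ (h - 1))) = Real.exp (-A) := by
    have hd : ∀ t ∈ Set.uIcc (0 : ℝ) 1, HasDerivAt (fun t => Real.exp (-(A * t ^ 2)) * t ^ h)
        (Real.exp (-(A * t ^ 2)) * (-(2 * A * t)) * t ^ h +
          Real.exp (-(A * t ^ 2)) * (h * t ^ (h - 1))) t := by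
      intro t _
      have e1 : HasDerivAt (fun t : ℝ => -(A * t ^ 2)) (-(2 * A * t)) t := by
        have := (((hasDerivAt_id t).pow 2).const_mul A).neg
        exact this.congr_deriv (by simp; ring)
      exact e1.exp.mul (hasDerivAt_pow h t)
    rw [intervalIntegral.integral_eq_sub_of_hasDerivAt hd
      (Continuous.intervalIntegrable (by fun_prop) _ _)]
    simp [hh.ne']
  rw [intervalIntegral.integral_add (Continuous.intervalIntegrable (by fun_prop) _ _)
    (Continuous.intervalIntegrable (by fun_prop) _ _)] at key
  have e1 : ∫ t in (0 : ℝ)..1, Real.exp (-(A * t ^ 2)) * (-(2 * A * t)) * t ^ h =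
      -(2 * A) * ∫ t in (0 : ℝ)..1, Real.exp (-(A * t ^ 2)) * t ^ (h + 2 - 1) := by
    rw [← intervalIntegral.integral_const_mul]
    congr 1; ext t
    rw [show h + 2 - 1 = h + 1 by omega, pow_succ]; ring
  have e2 : ∫ t in (0 : ℝ)..1, Real.exp (-(A * t ^ 2)) * (h * t ^ (h - 1)) =
      h * ∫ t in (0 : ℝ)..1, Real.exp (-(A * t ^ 2)) * t ^ (h - 1) := by
    rw [← intervalIntegral.integral_const_mul]
    congr 1; ext t; ring
  rw [e1, e2] at key
  have e3 : (((h + 2 : ℕ) : ℝ) / 2) = h / 2 + 1 := by push_cast; ring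
  rw [incGamma, incGamma, e3, Real.Gamma_add_one (by positivity), ← key]
  field_simp
  ring

theorem incGamma_eq_sum {h : ℕ} (hh : 0 < h) (A : ℝ) (J : ℕ) :
    incGamma h A = Real.exp (-A) * ∑ j ∈ Finset.range J, A ^ j / Real.Gamma (h / 2 + j + 1) +
      A ^ J * incGamma (h + 2 * J) A := by
  induction J with
  | zero => simp
  | succ J ih =>
    rw [ih, incGamma_eq_add (by omega), Finset.sum_range_succ]
    have : ((h + 2 * J : ℕ) : ℝ) / 2 + 1 = h / 2 + J + 1 := by push_cast; ring
    rw [this, show h + 2 * (J + 1) = h + 2 * J + 2 by ring]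
    ring

/-- Iterated integration by parts; the remainder A^J `incGamma (h + 2 * J) A` is at most a constant
times A^J / J!. -/
theorem hasSum_incGamma {h : ℕ} (hh : 0 < h) {A : ℝ} (hA : 0 ≤ A) :
    HasSum (fun j : ℕ => Real.exp (-A) * (A ^ j / Real.Gamma (h / 2 + j + 1)))
      (incGamma h A) := by
  have hG : 0 < Real.Gamma ((h : ℝ) / 2 + 1) := Real.Gamma_pos_of_pos (by positivity)
  rw [hasSum_iff_tendsto_nat_of_nonneg]
  · have h0 : Tendsto (fun J : ℕ => A ^ J * incGamma (h + 2 * J) A) atTop (𝓝 0) := by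
      have h1 : Tendsto (fun J : ℕ => A ^ J / J ! * (1 / Real.Gamma ((h : ℝ) / 2 + 1)))
          atTop (𝓝 0) := by
        simpa using (FloorSemiring.tendsto_pow_div_factorial_atTop A).mul_const
          (1 / Real.Gamma ((h : ℝ) / 2 + 1))
      refine squeeze_zero (fun J => mul_nonneg (pow_nonneg hA _) (incGamma_nonneg _ _))
        (fun J => ?_) h1
      have h2 := incGamma_le (h := h + 2 * J) (by omega) hA
      have h3 := factorial_mul_Gamma_le (s := (h : ℝ) / 2) (by positivity) J
      have h4 : ((h + 2 * J : ℕ) : ℝ) / 2 + 1 = h / 2 + J + 1 := by push_cast; ring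
      rw [h4] at h2
      have h5 : 1 / Real.Gamma ((h : ℝ) / 2 + J + 1) ≤
          1 / ((J ! : ℝ) * Real.Gamma ((h : ℝ) / 2 + 1)) := by gcongr
      calc A ^ J * incGamma (h + 2 * J) A
          ≤ A ^ J * (1 / ((J ! : ℝ) * Real.Gamma ((h : ℝ) / 2 + 1))) := by gcongr; linarith
        _ = _ := by field_simp
    have h1 : ∀ J : ℕ, ∑ i ∈ Finset.range J, Real.exp (-A) * (A ^ i / Real.Gamma (h / 2 + i + 1))
        = incGamma h A - A ^ J * incGamma (h + 2 * J) A := by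
      intro J
      rw [incGamma_eq_sum hh A J, Finset.mul_sum]; ring
    simp only [h1]
    simpa using tendsto_const_nhds.sub h0
  · intro j
    have : 0 < Real.Gamma ((h : ℝ) / 2 + j + 1) := Real.Gamma_pos_of_pos (by positivity)
    positivity

theorem continuous_incGamma (h : ℕ) : Continuous (incGamma h) := by
  unfold incGamma
  refine (continuous_const.mul ?_).div_const _
  refine intervalIntegral.continuous_parametric_intervalIntegral_of_continuous' ?_ _ _
  fun_prop

/-- The substitution t ↦ at turns the left side into the share of the integral for Γ(h/2) carried by
[0, a]; hence the bound by 1 and the limit 1 below. -/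
theorem pow_mul_incGamma {h : ℕ} (hh : 0 < h) {a : ℝ} (ha : 0 < a) :
    a ^ h * incGamma h (a ^ 2) =
      (2 * ∫ t in (0 : ℝ)..a, Real.exp (-t ^ 2) * t ^ (h - 1)) / Real.Gamma (h / 2) := by
  have h1 := intervalIntegral.integral_comp_mul_left
    (f := fun t : ℝ => Real.exp (-t ^ 2) * t ^ (h - 1)) (a := 0) (b := 1) ha.ne'
  simp only [mul_zero, mul_one, smul_eq_mul] at h1
  have h2 : ∫ t in (0 : ℝ)..1, Real.exp (-(a * t) ^ 2) * (a * t) ^ (h - 1) =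
      a ^ (h - 1) * ∫ t in (0 : ℝ)..1, Real.exp (-(a ^ 2 * t ^ 2)) * t ^ (h - 1) := by
    rw [← intervalIntegral.integral_const_mul]
    congr 1; ext t
    rw [mul_pow, mul_pow]; ring
  rw [h2] at h1
  have h3 : a ^ h = a * a ^ (h - 1) := by rw [← pow_succ', Nat.sub_add_cancel hh]
  rw [incGamma, h3]
  calc _ = 2 * (a * (a ^ (h - 1) * ∫ t in (0 : ℝ)..1, Real.exp (-(a ^ 2 * t ^ 2)) * t ^ (h - 1))) /
      Real.Gamma (h / 2) := by ring
    _ = _ := by rw [h1]; field_simp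

theorem pow_mul_incGamma_le_one {h : ℕ} (hh : 0 < h) {a : ℝ} (ha : 0 < a) :
    a ^ h * incGamma h (a ^ 2) ≤ 1 := by
  have h3 : 0 < Real.Gamma ((h : ℝ) / 2) :=
    Real.Gamma_pos_of_pos (by have : 0 < (h : ℝ) := by exact_mod_cast hh
                              positivity)
  rw [pow_mul_incGamma hh ha, div_le_one h3, ← integral_Ioi_exp_neg_sq_mul_pow hh,
    intervalIntegral.integral_of_le ha.le]
  refine mul_le_mul_of_nonneg_left ?_ zero_le_two
  refine MeasureTheory.setIntegral_mono_set (integrableOn_exp_neg_sq_mul_pow _) ?_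
    (Set.Ioc_subset_Ioi_self.eventuallyLE)
  refine (MeasureTheory.ae_restrict_iff' measurableSet_Ioi).2 (Filter.Eventually.of_forall ?_)
  intro t ht
  exact mul_nonneg (Real.exp_pos _).le (pow_nonneg (le_of_lt ht) _)

theorem tendsto_pow_mul_incGamma {h : ℕ} (hh : 0 < h) :
    Tendsto (fun a : ℝ => a ^ h * incGamma h (a ^ 2)) atTop (𝓝 1) := by
  have h3 : 0 < Real.Gamma ((h : ℝ) / 2) :=
    Real.Gamma_pos_of_pos (by have : 0 < (h : ℝ) := by exact_mod_cast hh
                              positivity)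
  have h1 := MeasureTheory.intervalIntegral_tendsto_integral_Ioi 0
    (integrableOn_exp_neg_sq_mul_pow (h - 1)) tendsto_id
  have h2 := (h1.const_mul 2).div_const (Real.Gamma ((h : ℝ) / 2))
  rw [integral_Ioi_exp_neg_sq_mul_pow hh, div_self h3.ne'] at h2
  refine h2.congr' ?_
  filter_upwards [eventually_gt_atTop 0] with a ha
  rw [pow_mul_incGamma hh ha]; rfl

/-! ### Series for the deformed sine kernel and its limits in κ -/

theorem summable_besselHat_bound (s r : ℝ) :
    Summable fun k : ℕ => r ^ k / k ! * ((1 / s) ^ k / Real.Gamma s) := by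
  have := (Real.summable_pow_div_factorial (r * (1 / s))).mul_right (1 / Real.Gamma s)
  refine this.congr fun k => ?_
  rw [mul_pow]; ring

/-- Termwise integration of the Bessel series. The factor t^{2k} raises the power to t^{2k+d-1}, and
the order d/2 - 1 makes the denominator Γ(k + d/2) exactly the normalisation of `incGamma (2 * k +
d)`. -/
theorem hasSum_integral_besselHat {d : ℕ} (hd : 0 < d) {A : ℝ} (hA : 0 ≤ A) (w : ℂ) :
    HasSum (fun k : ℕ => (-(w * (Real.pi : ℂ) ^ 2 / 4)) ^ k / (k ! : ℂ) * (incGamma (2 * k + d) A : ℂ))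
      (2 * ∫ t in (0 : ℝ)..1, ((Real.exp (-(A * t ^ 2)) * t ^ (d - 1) : ℝ) : ℂ) *
        besselHat ((d : ℝ) / 2 - 1) (w * ((Real.pi ^ 2 * t ^ 2 : ℝ) : ℂ))) := by
  have hd' : 0 < (d : ℝ) := by exact_mod_cast hd
  set s : ℝ := (d : ℝ) / 2 with hs
  have hs0 : 0 < s := by positivity
  have hG : 0 < Real.Gamma s := Real.Gamma_pos_of_pos hs0
  set r : ℝ := ‖w * (Real.pi : ℂ) ^ 2 / 4‖ with hr
  let F : ℕ → ℝ → ℂ := fun k t => ((Real.exp (-(A * t ^ 2)) * t ^ (d - 1) : ℝ) : ℂ) *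
    ((-1) ^ k * (w * ((Real.pi ^ 2 * t ^ 2 : ℝ) : ℂ) / 4) ^ k /
      ((k ! : ℂ) * (Real.Gamma (k + (s - 1) + 1) : ℂ)))
  have hFn : ∀ k t, t ∈ Set.Icc (0:ℝ) 1 → ‖(-1) ^ k * (w * ((Real.pi ^ 2 * t ^ 2 : ℝ) : ℂ) / 4) ^ k /
      ((k ! : ℂ) * (Real.Gamma (k + (s - 1) + 1) : ℂ))‖ ≤
        r ^ k / k ! * ((1 / s) ^ k / Real.Gamma s) := by
    intro k t ht
    have e0 : (k : ℝ) + (s - 1) + 1 = k + s := by ring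
    have h2 : 0 < Real.Gamma (k + s) := Real.Gamma_pos_of_pos (by positivity)
    rw [e0]
    have e1 : ‖w * ((Real.pi ^ 2 * t ^ 2 : ℝ) : ℂ) / 4‖ ≤ r := by
      have : w * ((Real.pi ^ 2 * t ^ 2 : ℝ) : ℂ) / 4 =
        (w * (Real.pi : ℂ) ^ 2 / 4) * ((t ^ 2 : ℝ) : ℂ) := by push_cast; ring
      rw [this, norm_mul, Complex.norm_real, Real.norm_of_nonneg (by positivity)]
      have := ht.1
      exact mul_le_of_le_one_right (norm_nonneg _) (pow_le_one₀ ht.1 ht.2)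
    rw [norm_div, norm_mul, norm_mul, norm_pow, norm_pow, norm_neg, norm_one, one_pow, one_mul,
      Complex.norm_natCast, Complex.norm_real, Real.norm_of_nonneg h2.le]
    have := one_div_Gamma_add_nat_le hs0 k
    calc ‖w * ((Real.pi ^ 2 * t ^ 2 : ℝ) : ℂ) / 4‖ ^ k / (k ! * Real.Gamma (k + s))
        = ‖w * ((Real.pi ^ 2 * t ^ 2 : ℝ) : ℂ) / 4‖ ^ k / k ! * (1 / Real.Gamma (k + s)) := by
          field_simp
      _ ≤ _ := by gcongr
  have key := intervalIntegral.hasSum_integral_of_dominated_convergence (μ := MeasureTheory.volume)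
    (a := 0) (b := 1) (F := F)
    (f := fun t => ((Real.exp (-(A * t ^ 2)) * t ^ (d - 1) : ℝ) : ℂ) *
        besselHat (s - 1) (w * ((Real.pi ^ 2 * t ^ 2 : ℝ) : ℂ)))
    (fun k _ => r ^ k / k ! * ((1 / s) ^ k / Real.Gamma s)) ?_ ?_ ?_ ?_ ?_
  · have := key.mul_left 2
    refine this.congr_fun fun k => ?_
    have e0 : ((2 * k + d : ℕ) : ℝ) / 2 = k + (s - 1) + 1 := by rw [hs]; push_cast; ring
    rw [incGamma, e0]
    have e1 : ∀ t : ℝ, F k t = ((-(w * (Real.pi : ℂ) ^ 2 / 4)) ^ k / (k ! : ℂ) *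
        (1 / (Real.Gamma (k + (s - 1) + 1) : ℂ))) *
        ((Real.exp (-(A * t ^ 2)) * t ^ (2 * k + d - 1) : ℝ) : ℂ) := by
      intro t
      simp only [F]
      have e2 : (-(w * (Real.pi : ℂ) ^ 2 / 4)) ^ k * (t : ℂ) ^ (2 * k) =
          (-1) ^ k * (w * (Real.pi ^ 2 * t ^ 2) / 4) ^ k := by
        rw [pow_mul, ← mul_pow, ← mul_pow]; ring
      rw [show 2 * k + d - 1 = 2 * k + (d - 1) by omega, pow_add]
      push_cast
      rw [← e2]
      ring
    simp only [e1]
    rw [intervalIntegral.integral_const_mul, intervalIntegral.integral_ofReal]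
    push_cast
    ring
  · intro k
    exact Continuous.aestronglyMeasurable (by fun_prop)
  · intro k
    refine Filter.Eventually.of_forall fun t ht => ?_
    rw [Set.uIoc_of_le zero_le_one] at ht
    have ht' : t ∈ Set.Icc (0:ℝ) 1 := ⟨ht.1.le, ht.2⟩
    simp only [F]
    rw [norm_mul, Complex.norm_real, Real.norm_of_nonneg (mul_nonneg (Real.exp_pos _).le
      (pow_nonneg ht'.1 _))]
    refine (mul_le_of_le_one_left (norm_nonneg _) ?_).trans (hFn k t ht')
    refine mul_le_one₀ (Real.exp_le_one_iff.2 ?_) (pow_nonneg ht'.1 _) (pow_le_one₀ ht'.1 ht'.2)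
    have : 0 ≤ A * t ^ 2 := by positivity
    linarith
  · exact Filter.Eventually.of_forall fun t _ => summable_besselHat_bound s r
  · exact intervalIntegrable_const
  · refine Filter.Eventually.of_forall fun t ht => ?_
    rw [Set.uIoc_of_le zero_le_one] at ht
    have ht' : t ∈ Set.Icc (0:ℝ) 1 := ⟨ht.1.le, ht.2⟩
    refine HasSum.mul_left _ ?_
    rw [besselHat]
    exact (Summable.of_norm_bounded (summable_besselHat_bound s r)
      fun k => hFn k t ht').hasSum

theorem deformedSineKernel_eq_tsum {d : ℕ} (hd : 0 < d) {κ : ℝ} (hκ : 0 ≤ κ) (U V : Fin d → ℂ) :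
    deformedSineKernel d κ U V =
      ((Real.exp (-((∑ k, (U k).im ^ 2 + ∑ k, (V k).im ^ 2) / (2 * κ))) /
        (4 * κ) ^ ((d : ℝ) / 2) : ℝ) : ℂ) *
      ∑' k : ℕ, (-((∑ k, (U k - conj (V k)) ^ 2) * (Real.pi : ℂ) ^ 2 / 4)) ^ k / (k ! : ℂ) *
        (incGamma (2 * k + d) (κ * Real.pi ^ 2) : ℂ) := by
  rw [deformedSineKernel, (hasSum_integral_besselHat hd (by positivity) _).tsum_eq]

/-- On real points the Gaussian factor is 1, and each coefficient tends to 1/Γ(k + d/2 + 1). This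
shifts the Bessel order from d/2 - 1 to d/2. -/
theorem tendsto_deformedSineKernel_zero {d : ℕ} (hd : 0 < d) (x y : Fin d → ℝ) :
    Tendsto
      (fun κ : ℝ => (((Real.pi * κ) ^ ((d : ℝ) / 2) : ℝ) : ℂ) *
        deformedSineKernel d κ (fun k => (x k : ℂ)) (fun k => (y k : ℂ)))
      (𝓝[>] 0) (𝓝 (realSineKernel d x y)) := by
  have hd' : 0 < (d : ℝ) := by exact_mod_cast hd
  set z : ℂ := ∑ k, ((x k : ℂ) - conj (y k : ℂ)) ^ 2 with hz
  have hz' : ((Real.pi ^ 2 * ∑ k, (x k - y k) ^ 2 : ℝ) : ℂ) = z * (Real.pi : ℂ) ^ 2 := by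
    rw [hz]; push_cast; simp only [Complex.conj_ofReal]; ring
  have hlim : Tendsto (fun κ : ℝ => ∑' k : ℕ, (-(z * (Real.pi : ℂ) ^ 2 / 4)) ^ k / (k ! : ℂ) *
      (incGamma (2 * k + d) (κ * Real.pi ^ 2) : ℂ)) (𝓝[>] 0)
      (𝓝 (∑' k : ℕ, (-(z * (Real.pi : ℂ) ^ 2 / 4)) ^ k / (k ! : ℂ) *
        (incGamma (2 * k + d) 0 : ℂ))) := by
    refine tendsto_tsum_of_dominated_convergence
      (summable_besselHat_bound ((d : ℝ) / 2 + 1) ‖-(z * (Real.pi : ℂ) ^ 2 / 4)‖) ?_ ?_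
    · intro k
      refine Tendsto.const_mul _ ?_
      have h1 : Continuous fun κ : ℝ => (incGamma (2 * k + d) (κ * Real.pi ^ 2) : ℂ) :=
        Complex.continuous_ofReal.comp ((continuous_incGamma _).comp (by fun_prop))
      have := h1.tendsto 0
      simp only [zero_mul] at this
      exact this.mono_left nhdsWithin_le_nhds
    · filter_upwards [self_mem_nhdsWithin] with κ hκ k
      have hκ' : (0 : ℝ) < κ := hκ
      have h1 := incGamma_le (h := 2 * k + d) (by omega) (A := κ * Real.pi ^ 2) (by positivity)
      have h2 : ((2 * k + d : ℕ) : ℝ) / 2 + 1 = k + ((d : ℝ) / 2 + 1) := by push_cast; ring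
      rw [h2] at h1
      rw [norm_mul, norm_div, norm_pow, Complex.norm_natCast, Complex.norm_real,
        Real.norm_of_nonneg (incGamma_nonneg _ _)]
      gcongr
      exact h1.trans (one_div_Gamma_add_nat_le (by positivity) k)
  have hval : realSineKernel d x y = (((Real.pi / 4) ^ ((d : ℝ) / 2) : ℝ) : ℂ) *
      ∑' k : ℕ, (-(z * (Real.pi : ℂ) ^ 2 / 4)) ^ k / (k ! : ℂ) *
        (incGamma (2 * k + d) 0 : ℂ) := by
    rw [realSineKernel, besselHat, hz']
    congr 1
    refine tsum_congr fun k => ?_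
    have h2 : ((2 * k + d : ℕ) : ℝ) / 2 + 1 = k + (d : ℝ) / 2 + 1 := by push_cast; ring
    rw [incGamma_zero (by omega), h2, neg_pow (z * (Real.pi : ℂ) ^ 2 / 4)]
    push_cast
    ring
  rw [hval]
  refine (hlim.const_mul _).congr' ?_
  filter_upwards [self_mem_nhdsWithin] with κ hκ
  have hκ' : (0 : ℝ) < κ := hκ
  rw [deformedSineKernel_eq_tsum hd hκ'.le, ← hz, ← mul_assoc]
  congr 1
  have h1 : (Real.pi / 4) ^ ((d : ℝ) / 2) = (Real.pi * κ) ^ ((d : ℝ) / 2) / (4 * κ) ^ ((d : ℝ) / 2) := by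
    rw [← Real.div_rpow (by positivity) (by positivity)]
    congr 1; field_simp
  rw [h1]
  simp
  ring

/-- The cocycle is exactly what converts the Ginibre exponent into -(Im u)²/2 - (Im v)²/2 - (u -
v̄)²/4, the shape in which the limit κ → ∞ appears. -/
theorem ginibreCocycle_mul_ginibreKernel (d : ℕ) (u v : Fin d → ℂ) :
    ginibreCocycle d u v * ginibreKernel d u v =
      (1 / (2 * Real.pi : ℂ)) ^ d *
        ((Real.exp (-((∑ k, (u k).im ^ 2 + ∑ k, (v k).im ^ 2) / 2)) : ℝ) : ℂ) *
        Complex.exp (-((∑ k, (u k - conj (v k)) ^ 2) / 4)) := by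
  rw [ginibreCocycle, ginibreKernel, Finset.prod_mul_distrib, Finset.prod_const, Finset.card_univ,
    Fintype.card_fin, ← Complex.exp_sum, ← Complex.exp_sum, mul_left_comm, ← Complex.exp_add,
    mul_assoc, Complex.ofReal_exp, ← Complex.exp_add, ← Finset.sum_add_distrib]
  congr 2
  push_cast
  rw [← Finset.sum_add_distrib, Finset.sum_div, Finset.sum_div, ← Finset.sum_neg_distrib,
    ← Finset.sum_neg_distrib, ← Finset.sum_add_distrib]
  refine Finset.sum_congr rfl fun k _ => ?_
  have h1 : ∀ z : ℂ, ((‖z‖ : ℂ)) ^ 2 = z.re ^ 2 + z.im ^ 2 := fun z => by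
    have := Complex.sq_norm z
    rw [Complex.normSq_apply] at this
    rw [← Complex.ofReal_pow, this]; push_cast; ring
  have h2 : ∀ z : ℂ, z = z.re + z.im * Complex.I := fun z => (Complex.re_add_im z).symm
  have h3 : (((u k) ^ 2 - (v k) ^ 2).im : ℂ) =
      2 * (u k).re * (u k).im - 2 * (v k).re * (v k).im := by
    rw [Complex.sub_im, pow_two, pow_two, Complex.mul_im, Complex.mul_im]; push_cast; ring
  have h4 : conj (v k) = (v k).re - (v k).im * Complex.I := by
    apply Complex.ext <;> simp
  rw [h1, h1, h3, h4]
  conv_lhs => rw [h2 (u k)]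
  conv_rhs => rw [h2 (u k)]
  simp only [Complex.add_re, Complex.add_im, Complex.ofReal_re, Complex.ofReal_im, Complex.mul_re,
    Complex.mul_im, Complex.I_re, Complex.I_im]
  simp only [mul_zero, mul_one, zero_add, add_zero, sub_zero]
  ring_nf
  rw [Complex.I_sq]
  ring

/-- With a = √κ π, the k-th coefficient becomes a^{2k+d} `incGamma (2 * k + d) (a ^ 2)`, which is at
most 1 and tends to 1. The exponential series dominates and is also the limit. -/
theorem tendsto_deformedSineKernel_atTop {d : ℕ} (hd : 0 < d) (u v : Fin d → ℂ) :
    Tendsto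
      (fun κ : ℝ => ((κ ^ d : ℝ) : ℂ) *
        deformedSineKernel d κ
          (fun k => (Real.sqrt κ : ℂ) * u k) (fun k => (Real.sqrt κ : ℂ) * v k))
      atTop (𝓝 (ginibreCocycle d u v * ginibreKernel d u v)) := by
  set z : ℂ := ∑ k, (u k - conj (v k)) ^ 2 with hz
  have hsq : Tendsto (fun κ : ℝ => Real.sqrt κ * Real.pi) atTop atTop :=
    Real.tendsto_sqrt_atTop.atTop_mul_const Real.pi_pos
  have hlim : Tendsto (fun κ : ℝ => ∑' k : ℕ, (-(z / 4)) ^ k / (k ! : ℂ) *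
      (((Real.sqrt κ * Real.pi) ^ (2 * k + d) *
        incGamma (2 * k + d) ((Real.sqrt κ * Real.pi) ^ 2) : ℝ) : ℂ)) atTop
      (𝓝 (∑' k : ℕ, (-(z / 4)) ^ k / (k ! : ℂ) * ((1 : ℝ) : ℂ))) := by
    refine tendsto_tsum_of_dominated_convergence
      (Real.summable_pow_div_factorial ‖-(z / 4)‖) ?_ ?_
    · intro k
      refine Tendsto.const_mul _ ?_
      exact (Complex.continuous_ofReal.tendsto _).comp
        ((tendsto_pow_mul_incGamma (h := 2 * k + d) (by omega)).comp hsq)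
    · filter_upwards [eventually_gt_atTop 0] with κ hκ k
      have ha : 0 < Real.sqrt κ * Real.pi := mul_pos (Real.sqrt_pos.2 hκ) Real.pi_pos
      have h1 := pow_mul_incGamma_le_one (h := 2 * k + d) (by omega) ha
      rw [norm_mul, norm_div, norm_pow, Complex.norm_natCast, Complex.norm_real,
        Real.norm_of_nonneg (mul_nonneg (pow_nonneg ha.le _) (incGamma_nonneg _ _))]
      exact mul_le_of_le_one_right (by positivity) h1
  have hexp : ∑' k : ℕ, (-(z / 4)) ^ k / (k ! : ℂ) * ((1 : ℝ) : ℂ) = Complex.exp (-(z / 4)) := by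
    rw [Complex.exp_eq_exp_ℂ, NormedSpace.exp_eq_tsum_div]
    simp
  rw [hexp] at hlim
  rw [ginibreCocycle_mul_ginibreKernel, ← hz]
  refine (hlim.const_mul _).congr' ?_
  filter_upwards [eventually_gt_atTop 0] with κ hκ
  have hs : 0 < Real.sqrt κ := Real.sqrt_pos.2 hκ
  have hs2 : (Real.sqrt κ : ℂ) ^ 2 = (κ : ℂ) := by
    rw [← Complex.ofReal_pow, Real.sq_sqrt hκ.le]
  have hpi : (Real.pi : ℂ) ≠ 0 := by exact_mod_cast Real.pi_ne_zero
  rw [deformedSineKernel_eq_tsum hd hκ.le]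
  have h1 : ∑ k, ((Real.sqrt κ : ℂ) * u k - conj ((Real.sqrt κ : ℂ) * v k)) ^ 2 = κ * z := by
    rw [hz, Finset.mul_sum]
    refine Finset.sum_congr rfl fun k _ => ?_
    rw [map_mul, Complex.conj_ofReal, ← hs2]; ring
  have h2 : -((∑ k, ((Real.sqrt κ : ℂ) * u k).im ^ 2 + ∑ k, ((Real.sqrt κ : ℂ) * v k).im ^ 2) /
      (2 * κ)) = -((∑ k, (u k).im ^ 2 + ∑ k, (v k).im ^ 2) / 2) := by
    have : ∀ w : Fin d → ℂ, ∑ k, ((Real.sqrt κ : ℂ) * w k).im ^ 2 = κ * ∑ k, (w k).im ^ 2 := by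
      intro w
      rw [Finset.mul_sum]
      refine Finset.sum_congr rfl fun k _ => ?_
      rw [Complex.im_ofReal_mul, mul_pow, Real.sq_sqrt hκ.le]
    rw [this, this]
    field_simp
  have h3 : (4 * κ) ^ ((d : ℝ) / 2) = (2 * Real.sqrt κ) ^ d := by
    have : (4 * κ) = (2 * Real.sqrt κ) ^ 2 := by rw [mul_pow, Real.sq_sqrt hκ.le]; norm_num
    rw [this, ← Real.rpow_natCast, ← Real.rpow_mul (by positivity), ← Real.rpow_natCast]
    congr 1; push_cast; ring
  have h4 : κ * Real.pi ^ 2 = (Real.sqrt κ * Real.pi) ^ 2 := by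
    rw [mul_pow, Real.sq_sqrt hκ.le]
  -- The rescaled argument supplies a^{2k}; the missing a^d is inserted here and later cancelled
  -- against κ^d and (4κ)^{-d/2}.
  have h5 : ∀ k : ℕ, (-(κ * z * (Real.pi : ℂ) ^ 2 / 4)) ^ k / (k ! : ℂ) *
      (incGamma (2 * k + d) ((Real.sqrt κ * Real.pi) ^ 2) : ℂ) =
      ((1 / (Real.sqrt κ * Real.pi) ^ d : ℝ) : ℂ) * ((-(z / 4)) ^ k / (k ! : ℂ) *
      (((Real.sqrt κ * Real.pi) ^ (2 * k + d) *
        incGamma (2 * k + d) ((Real.sqrt κ * Real.pi) ^ 2) : ℝ) : ℂ)) := by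
    intro k
    have e1 : (-(κ * z * (Real.pi : ℂ) ^ 2 / 4)) ^ k =
        (-(z / 4)) ^ k * ((Real.sqrt κ : ℂ) * Real.pi) ^ (2 * k) := by
      rw [pow_mul, ← mul_pow, mul_pow _ _ 2, hs2]; ring
    have e2 : ((Real.sqrt κ : ℂ) * Real.pi) ^ d ≠ 0 :=
      pow_ne_zero _ (mul_ne_zero (by exact_mod_cast hs.ne') hpi)
    rw [e1]
    push_cast
    rw [pow_add]
    field_simp
  rw [h1, h2, h3, h4]
  simp only [h5]
  rw [tsum_mul_left, ← mul_assoc, ← mul_assoc]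
  congr 1
  have hs' : (Real.sqrt κ : ℂ) ≠ 0 := by exact_mod_cast hs.ne'
  have e3 : (κ : ℂ) ^ d = (Real.sqrt κ : ℂ) ^ d * (Real.sqrt κ : ℂ) ^ d := by
    rw [← hs2, ← pow_mul, two_mul, pow_add]
  push_cast
  rw [e3, div_pow, mul_pow, mul_pow, mul_pow]
  field_simp
  try simp

/-! ### The cocycles -/

theorem isCocycle_bulkCocycle {d : ℕ} (X : EuclideanSpace ℝ (Fin d)) :
    IsCocycle (bulkCocycle X) := by
  refine ⟨fun U => Complex.exp (Complex.I *
    ((nu X ^ (-1 / (d : ℝ)) * (1 / 2) * ∑ k, X k * (U k).im : ℝ) : ℂ)),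
    fun U => Complex.exp_ne_zero _, fun U V => ?_⟩
  rw [bulkCocycle, ← Complex.exp_sub, ← mul_sub, ← Complex.ofReal_sub, ← mul_sub,
    ← Finset.sum_sub_distrib]
  simp only [Complex.sub_im, mul_sub]

theorem isCocycle_ginibreCocycle (d : ℕ) : IsCocycle (ginibreCocycle d) := by
  refine ⟨fun u => ∏ k, Complex.exp (-(Complex.I / 4) * ((((u k) ^ 2).im : ℝ) : ℂ)),
    fun u => Finset.prod_ne_zero_iff.2 fun k _ => Complex.exp_ne_zero _, fun u v => ?_⟩
  rw [ginibreCocycle, ← Finset.prod_div_distrib]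
  refine Finset.prod_congr rfl fun k _ => ?_
  rw [← Complex.exp_sub, ← mul_sub, Complex.sub_im, Complex.ofReal_sub]

/-! ### Convergent power series and contour integrals for their coefficients -/

open PowerSeries in
/-- The power series `f` converges to `E` on the disc of radius `ρ`. -/
def HasPS (ρ : ℝ) (f : PowerSeries ℂ) (E : ℂ → ℂ) : Prop :=
  ∀ z : ℂ, ‖z‖ < ρ → HasSum (fun m => coeff m f * z ^ m) (E z)

namespace HasPS

variable {ρ : ℝ} {f g : PowerSeries ℂ} {E G : ℂ → ℂ}

theorem mono {ρ' : ℝ} (h : HasPS ρ f E) (hρ : ρ' ≤ ρ) : HasPS ρ' f E :=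
  fun z hz => h z (hz.trans_le hρ)

theorem congr (h : HasPS ρ f E) (hE : ∀ z, ‖z‖ < ρ → E z = G z) : HasPS ρ f G :=
  fun z hz => hE z hz ▸ h z hz

theorem one : HasPS ρ 1 (fun _ => 1) := by
  intro z _
  have := hasSum_ite_eq (α := ℂ) (0 : ℕ) 1
  refine this.congr_fun fun m => ?_
  rcases eq_or_ne m 0 with rfl | hm <;> simp [PowerSeries.coeff_one, *]

theorem C (c : ℂ) : HasPS ρ (PowerSeries.C c) (fun _ => c) := by
  intro z _
  have := hasSum_ite_eq (α := ℂ) (0 : ℕ) c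
  refine this.congr_fun fun m => ?_
  rcases eq_or_ne m 0 with rfl | hm <;> simp [PowerSeries.coeff_C, *]

theorem X : HasPS ρ PowerSeries.X (fun z => z) := by
  intro z _
  have := hasSum_ite_eq (α := ℂ) (1 : ℕ) z
  refine this.congr_fun fun m => ?_
  rcases eq_or_ne m 1 with rfl | hm <;> simp [PowerSeries.coeff_X, *]

theorem add (hf : HasPS ρ f E) (hg : HasPS ρ g G) : HasPS ρ (f + g) (fun z => E z + G z) := by
  intro z hz
  refine ((hf z hz).add (hg z hz)).congr_fun fun m => ?_
  rw [map_add, add_mul]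

theorem sub (hf : HasPS ρ f E) (hg : HasPS ρ g G) : HasPS ρ (f - g) (fun z => E z - G z) := by
  intro z hz
  refine ((hf z hz).sub (hg z hz)).congr_fun fun m => ?_
  rw [map_sub, sub_mul]

theorem mul (hf : HasPS ρ f E) (hg : HasPS ρ g G) : HasPS ρ (f * g) (fun z => E z * G z) := by
  intro z hz
  have h1 := (hf z hz).summable.norm
  have h2 := (hg z hz).summable.norm
  have h3 := summable_norm_sum_mul_antidiagonal_of_summable_norm h1 h2
  have h4 := tsum_mul_tsum_eq_tsum_sum_antidiagonal_of_summable_norm h1 h2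
  rw [(hf z hz).tsum_eq, (hg z hz).tsum_eq] at h4
  change HasSum _ (E z * G z)
  rw [h4]
  refine h3.of_norm.hasSum.congr_fun fun m => ?_
  rw [PowerSeries.coeff_mul, Finset.sum_mul]
  refine Finset.sum_congr rfl fun p hp => ?_
  rw [← Finset.HasAntidiagonal.mem_antidiagonal.1 hp, pow_add]
  ring

theorem prod {ι : Type*} (s : Finset ι) {f : ι → PowerSeries ℂ} {E : ι → ℂ → ℂ}
    (h : ∀ i, HasPS ρ (f i) (E i)) : HasPS ρ (∏ i ∈ s, f i) (fun z => ∏ i ∈ s, E i z) := by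
  classical
  induction s using Finset.induction_on with
  | empty => simpa using one
  | insert i s hi ih =>
    simp only [Finset.prod_insert hi]
    exact (h i).mul ih

theorem of_differentiableOn (h : DifferentiableOn ℂ E (Metric.ball 0 ρ)) :
    HasPS ρ (PowerSeries.mk fun m => iteratedDeriv m E 0 / m !) E := by
  intro z hz
  have := Complex.hasSum_taylorSeries_on_ball (c := 0) (r := ρ.toNNReal) (f := E) (z := z)
    (by
      rcases le_or_gt ρ 0 with h0 | h0
      · linarith [norm_nonneg z]
      · simpa [h0.le] using h) (by simpa [Real.coe_toNNReal ρ (by linarith [norm_nonneg z])] using hz)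
  refine this.congr_fun fun m => ?_
  simp
  ring

theorem deriv_of_differentiableOn (h : DifferentiableOn ℂ E (Metric.ball 0 ρ)) :
    HasPS ρ (PowerSeries.derivative ℂ (PowerSeries.mk fun m => iteratedDeriv m E 0 / m !))
      (deriv E) := by
  have h1 := of_differentiableOn (h.deriv Metric.isOpen_ball)
  convert h1 using 1
  ext m
  rw [PowerSeries.coeff_derivative, PowerSeries.coeff_mk, PowerSeries.coeff_mk,
    iteratedDeriv_succ', Nat.factorial_succ]
  push_cast
  field_simp

/-- Cauchy's coefficient formula on the circle |σ| = e^u, by orthogonality of the exponentials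
e^{i(k-m)θ}. The logarithmic parametrisation is the one used for all later contours. -/
theorem integral_eq (hf : HasPS ρ f E) {u : ℝ} (hu : Real.exp u < ρ) (m : ℕ) :
    ∫ θ in (-Real.pi)..Real.pi, E (Complex.exp (u + θ * Complex.I)) *
      Complex.exp (-(m * (u + θ * Complex.I))) = 2 * Real.pi * PowerSeries.coeff m f := by
  have hnorm : ∀ θ : ℝ, ‖Complex.exp (u + θ * Complex.I)‖ = Real.exp u := by
    intro θ; rw [Complex.norm_exp]; simp
  let F : ℕ → ℝ → ℂ := fun k θ => PowerSeries.coeff k f * Complex.exp (u + θ * Complex.I) ^ k *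
      Complex.exp (-(m * (u + θ * Complex.I)))
  have hsum : Summable fun k => ‖PowerSeries.coeff k f‖ * Real.exp u ^ k := by
    have := (hf (Real.exp u : ℂ) (by simpa [abs_of_pos (Real.exp_pos u)] using hu)).summable.norm
    simpa [Real.abs_exp] using this
  have key := intervalIntegral.hasSum_integral_of_dominated_convergence (μ := MeasureTheory.volume)
    (a := -Real.pi) (b := Real.pi) (F := F)
    (f := fun θ => E (Complex.exp (u + θ * Complex.I)) * Complex.exp (-(m * (u + θ * Complex.I))))
    (fun k _ => ‖PowerSeries.coeff k f‖ * Real.exp u ^ k * Real.exp (-(m * u))) ?_ ?_ ?_ ?_ ?_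
  · rw [← key.tsum_eq, tsum_eq_single m]
    · have : ∀ θ : ℝ, F m θ = PowerSeries.coeff m f := by
        intro θ
        simp only [F]
        rw [← Complex.exp_nat_mul, mul_assoc, ← Complex.exp_add]
        simp
      simp only [this, intervalIntegral.integral_const, Complex.real_smul]
      push_cast; ring
    · intro k hk
      have hkm : ((k : ℂ) - m) * Complex.I ≠ 0 := by
        refine mul_ne_zero (sub_ne_zero.2 (by exact_mod_cast hk)) Complex.I_ne_zero
      have : ∀ θ : ℝ, F k θ = PowerSeries.coeff k f * Complex.exp ((k - m) * u) *
          Complex.exp (((k : ℂ) - m) * Complex.I * θ) := by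
        intro θ
        simp only [F]
        rw [← Complex.exp_nat_mul, mul_assoc, mul_assoc, ← Complex.exp_add, ← Complex.exp_add]
        congr 2; ring
      simp only [this]
      rw [intervalIntegral.integral_const_mul, integral_exp_mul_complex hkm]
      have h2 : Complex.exp (((k : ℂ) - m) * Complex.I * (Real.pi : ℝ)) =
          Complex.exp (((k : ℂ) - m) * Complex.I * ((-Real.pi : ℝ) : ℂ)) := by
        rw [Complex.exp_eq_exp_iff_exists_int]
        refine ⟨(k : ℤ) - m, ?_⟩
        push_cast; ring
      rw [h2]; simp
  · intro k
    exact Continuous.aestronglyMeasurable (by fun_prop)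
  · intro k
    refine Filter.Eventually.of_forall fun θ _ => ?_
    simp only [F]
    rw [norm_mul, norm_mul, norm_pow, hnorm, Complex.norm_exp]
    apply le_of_eq
    simp
  · exact Filter.Eventually.of_forall fun θ _ => hsum.mul_right _
  · exact intervalIntegrable_const
  · refine Filter.Eventually.of_forall fun θ _ => ?_
    exact (hf _ (by rw [hnorm]; exact hu)).mul_right _

/-- Both families of coefficients are given by the same integral. This transfers differential
equations from functions to formal power series. -/
theorem unique (hρ : 0 < ρ) (hf : HasPS ρ f E) (hg : HasPS ρ g G)
    (hE : ∀ z, ‖z‖ < ρ → E z = G z) : f = g := by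
  ext m
  obtain ⟨r, hr0, hr⟩ := exists_between hρ
  have h1 := (hf.congr hE).integral_eq (u := Real.log r) (by rwa [Real.exp_log hr0]) m
  have h2 := hg.integral_eq (u := Real.log r) (by rwa [Real.exp_log hr0]) m
  rw [h1] at h2
  have hpi : (2 * Real.pi : ℂ) ≠ 0 := by
    simp [Real.pi_ne_zero]
  exact mul_left_cancel₀ hpi h2

theorem inv_const_sub {τ : ℝ} (hτ : 0 < τ) :
    HasPS τ (PowerSeries.mk fun m => ((τ : ℂ) ^ (m + 1))⁻¹) (fun z => ((τ : ℂ) - z)⁻¹) := by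
  intro z hz
  have hτ' : (τ : ℂ) ≠ 0 := by exact_mod_cast hτ.ne'
  have h1 : ‖z / τ‖ < 1 := by
    rw [norm_div, Complex.norm_real, Real.norm_of_nonneg hτ.le, div_lt_one hτ]; exact hz
  have h2 := (hasSum_geometric_of_norm_lt_one h1).mul_left (τ : ℂ)⁻¹
  have h3 : ((τ : ℂ) - z)⁻¹ = (τ : ℂ)⁻¹ * (1 - z / τ)⁻¹ := by
    rw [← mul_inv]; congr 1; field_simp
  change HasSum _ (((τ : ℂ) - z)⁻¹)
  rw [h3]
  refine h2.congr_fun fun m => ?_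
  rw [PowerSeries.coeff_mk, div_pow, pow_succ]
  field_simp

/-- Truncated sums of Taylor coefficients as contour integrals. -/
theorem sum_range_eq_integral (hf : HasPS 1 f E) {τ : ℝ} (hτ0 : 0 < τ) (hτ1 : τ ≤ 1)
    {u : ℝ} (hu : Real.exp u < τ) {n : ℕ} (hn : 0 < n) :
    ∑ m ∈ Finset.range n, PowerSeries.coeff m f * (τ : ℂ) ^ m =
      τ ^ n * ((2 * Real.pi : ℂ)⁻¹ * ∫ θ in (-Real.pi)..Real.pi,
        E (Complex.exp (u + θ * Complex.I)) * (τ - Complex.exp (u + θ * Complex.I))⁻¹ *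
          Complex.exp (u + θ * Complex.I) * Complex.exp (-(n * (u + θ * Complex.I)))) := by
  have hτ' : (τ : ℂ) ≠ 0 := by exact_mod_cast hτ0.ne'
  obtain ⟨k, rfl⟩ := Nat.exists_eq_succ_of_ne_zero hn.ne'
  -- The factor σ from dσ = iσ dθ lowers the power by one, so the integral reads off the coefficient
  -- of index n - 1 in E(σ)/(τ - σ). This gives ∑_{m<n} a_m τ^{m-n}.
  have h1 := ((hf.mono hτ1).mul (inv_const_sub hτ0)).integral_eq hu k
  have h2 : ∀ θ : ℝ, E (Complex.exp (u + θ * Complex.I)) *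
      (τ - Complex.exp (u + θ * Complex.I))⁻¹ * Complex.exp (u + θ * Complex.I) *
        Complex.exp (-((k.succ : ℕ) * (u + θ * Complex.I))) =
      E (Complex.exp (u + θ * Complex.I)) * (τ - Complex.exp (u + θ * Complex.I))⁻¹ *
        Complex.exp (-(k * (u + θ * Complex.I))) := by
    intro θ
    rw [mul_assoc _ (Complex.exp _) (Complex.exp _), ← Complex.exp_add]
    congr 2; push_cast; ring
  simp only [h2]
  rw [h1, PowerSeries.coeff_mul, Finset.Nat.sum_antidiagonal_eq_sum_range_succ_mk]
  have hpi : (Real.pi : ℂ) ≠ 0 := by exact_mod_cast Real.pi_ne_zero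
  rw [inv_mul_cancel_left₀ (by simp [Real.pi_ne_zero]), Finset.mul_sum]
  refine Finset.sum_congr rfl fun m hm => ?_
  have hm' : m ≤ k := Nat.lt_succ_iff.1 (Finset.mem_range.1 hm)
  have h3 : (τ : ℂ) ^ (k.succ) = τ ^ m * τ ^ (k - m + 1) := by
    rw [← pow_add]; congr 1; omega
  rw [PowerSeries.coeff_mk, h3]
  field_simp

end HasPS

/-! ### Hermite recurrences and Mehler's formula -/

theorem eq_of_derivative_ode {f g P Q : PowerSeries ℂ} (hQ : PowerSeries.constantCoeff Q ≠ 0)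
    (hf : Q * PowerSeries.derivative ℂ f = P * f) (hg : Q * PowerSeries.derivative ℂ g = P * g)
    (h0 : PowerSeries.coeff 0 f = PowerSeries.coeff 0 g) : f = g := by
  have key : ∀ f : PowerSeries ℂ, Q * PowerSeries.derivative ℂ f = P * f →
      PowerSeries.derivative ℂ f = Q⁻¹ * P * f := by
    intro f hf
    rw [mul_assoc, ← hf, ← mul_assoc, PowerSeries.inv_mul_cancel _ hQ, one_mul]
  ext m
  induction m using Nat.strong_induction_on with
  | _ m ih =>
    cases m with
    | zero => exact h0
    | succ m =>
      have h1 := congrArg (PowerSeries.coeff m) (key f hf)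
      have h2 := congrArg (PowerSeries.coeff m) (key g hg)
      rw [PowerSeries.coeff_derivative, PowerSeries.coeff_mul] at h1 h2
      have h3 : (m + 1 : ℂ) ≠ 0 := by exact_mod_cast Nat.succ_ne_zero m
      refine mul_right_cancel₀ h3 ?_
      rw [h1, h2]
      refine Finset.sum_congr rfl fun p hp => ?_
      have := Finset.HasAntidiagonal.mem_antidiagonal.1 hp
      rw [ih p.2 (by omega)]

/-- Needed to turn the derivative form of the recursion for Hermite polynomials into the three-term
recurrence. -/
theorem derivative_hermite_succ (n : ℕ) :
    Polynomial.derivative (Polynomial.hermite (n + 1)) =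
      ((n + 1 : ℕ) : Polynomial ℤ) * Polynomial.hermite n := by
  induction n with
  | zero => simp
  | succ n ih =>
    rw [Polynomial.hermite_succ (n + 1), Polynomial.derivative_sub, Polynomial.derivative_mul, ih]
    simp only [Polynomial.derivative_X, one_mul, Polynomial.derivative_mul,
      Polynomial.derivative_natCast, zero_mul, zero_add]
    rw [Polynomial.hermite_succ n]
    push_cast
    ring

theorem hermite_succ_succ (n : ℕ) :
    Polynomial.hermite (n + 2) = Polynomial.X * Polynomial.hermite (n + 1) -
      ((n + 1 : ℕ) : Polynomial ℤ) * Polynomial.hermite n := by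
  rw [Polynomial.hermite_succ (n + 1), derivative_hermite_succ]

theorem hermiteH_zero (z : ℂ) : hermiteH 0 z = 1 := by
  simp [hermiteH]

theorem sqrt_two_sq : (Real.sqrt 2 : ℂ) ^ 2 = 2 := by
  rw [← Complex.ofReal_pow, Real.sq_sqrt zero_le_two]; norm_num

theorem hermiteH_one (z : ℂ) : hermiteH 1 z = 2 * z := by
  simp only [hermiteH, Polynomial.hermite_one, Polynomial.aeval_X, pow_one]
  linear_combination z * sqrt_two_sq

theorem hermiteH_succ_succ (n : ℕ) (z : ℂ) :
    hermiteH (n + 2) z = 2 * z * hermiteH (n + 1) z - 2 * (n + 1) * hermiteH n z := by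
  simp only [hermiteH, hermite_succ_succ, map_sub, map_mul, Polynomial.aeval_X, map_natCast]
  push_cast
  have e1 : (Real.sqrt 2 : ℂ) ^ (n + 2) = (Real.sqrt 2 : ℂ) ^ n * 2 := by
    rw [pow_add, sqrt_two_sq]
  have e2 : (Real.sqrt 2 : ℂ) ^ (n + 2) * (Real.sqrt 2 : ℂ) = (Real.sqrt 2 : ℂ) ^ (n + 1) * 2 := by
    rw [pow_succ, mul_assoc, ← pow_two, sqrt_two_sq]
  rw [mul_sub, ← mul_assoc, ← mul_assoc, e2, e1]
  ring

theorem conj_hermiteH (n : ℕ) (z : ℂ) : conj (hermiteH n z) = hermiteH n (conj z) := by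
  simp only [hermiteH, map_mul, map_pow, Complex.conj_ofReal]
  congr 1
  rw [Polynomial.aeval_def, Polynomial.aeval_def, Polynomial.hom_eval₂]
  simp only [map_mul, Complex.conj_ofReal]
  congr 1
  exact RingHom.ext_int _ _

/-- The power series `∑_j H_j(x) H_j(y) σ^j / (2^j j!)`. -/
def mehlerSeries (x y : ℂ) : PowerSeries ℂ :=
  PowerSeries.mk fun j => hermiteH j x * hermiteH j y / (2 ^ j * (j ! : ℂ))

open PowerSeries in
-- The three-term recurrences, applied to either Hermite factor, give linear relations among the
-- series with shifted indices. Eliminating the shifted ones leaves a first order equation.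
theorem mehlerSeries_ode (x y : ℂ) :
    (1 - X * X) * (1 - X * X) * derivative ℂ (mehlerSeries x y) =
      ((C x - C y * X) * (C (2 * y) - C (2 * x) * X) + X * (1 - X * X)) * mehlerSeries x y := by
  set A := mehlerSeries x y with hA
  -- B and D shift one index by one, F shifts the second by two. B and D determine each other
  -- through A, and F enters only through the derivative of A.
  let B : PowerSeries ℂ := mk fun j => hermiteH (j + 1) x * hermiteH j y / (2 ^ j * (j ! : ℂ))
  let D : PowerSeries ℂ := mk fun j => hermiteH j x * hermiteH (j + 1) y / (2 ^ j * (j ! : ℂ))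
  let F : PowerSeries ℂ := mk fun j => hermiteH j x * hermiteH (j + 2) y / (2 ^ j * (j ! : ℂ))
  have hB : B = C (2 * x) * A - X * D := by
    ext j
    cases j with
    | zero => simp [B, A, mehlerSeries, hermiteH_one, hermiteH_zero]
    | succ j =>
      rw [map_sub, coeff_succ_X_mul, coeff_C_mul, coeff_mk, hA, mehlerSeries, coeff_mk, coeff_mk,
        hermiteH_succ_succ, Nat.factorial_succ]
      have : (j + 1 : ℂ) ≠ 0 := by exact_mod_cast Nat.succ_ne_zero j
      have h2 : (j ! : ℂ) ≠ 0 := by exact_mod_cast Nat.factorial_ne_zero j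
      push_cast
      field_simp
      ring
  have hD : D = C (2 * y) * A - X * B := by
    ext j
    cases j with
    | zero => simp [D, A, mehlerSeries, hermiteH_one, hermiteH_zero]
    | succ j =>
      rw [map_sub, coeff_succ_X_mul, coeff_C_mul, coeff_mk, hA, mehlerSeries, coeff_mk, coeff_mk,
        hermiteH_succ_succ, Nat.factorial_succ]
      have : (j + 1 : ℂ) ≠ 0 := by exact_mod_cast Nat.succ_ne_zero j
      have h2 : (j ! : ℂ) ≠ 0 := by exact_mod_cast Nat.factorial_ne_zero j
      push_cast
      field_simp
      ring
  have hF : F = C (2 * y) * D - C 2 * (A + X * derivative ℂ A) := by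
    ext j
    have : (j + 1 : ℂ) ≠ 0 := by exact_mod_cast Nat.succ_ne_zero j
    have h2 : (j ! : ℂ) ≠ 0 := by exact_mod_cast Nat.factorial_ne_zero j
    rw [map_sub, coeff_C_mul, coeff_C_mul, map_add, coeff_mk, coeff_mk, hermiteH_succ_succ]
    cases j with
    | zero => simp [A, mehlerSeries, hermiteH_zero]
    | succ j =>
      rw [coeff_succ_X_mul, coeff_derivative, hA, mehlerSeries, coeff_mk]
      push_cast
      field_simp
      ring
  have hA' : C 2 * derivative ℂ A = C (2 * x) * D - X * F := by
    ext j
    rw [coeff_C_mul, coeff_derivative, map_sub, coeff_C_mul, hA, mehlerSeries, coeff_mk]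
    cases j with
    | zero => simp [D, hermiteH_zero, hermiteH_one]; ring
    | succ j =>
      have : (j + 1 : ℂ) ≠ 0 := by exact_mod_cast Nat.succ_ne_zero j
      have h2 : (j ! : ℂ) ≠ 0 := by exact_mod_cast Nat.factorial_ne_zero j
      have h3 : (j + 1 + 1 : ℂ) ≠ 0 := by exact_mod_cast Nat.succ_ne_zero (j + 1)
      rw [coeff_succ_X_mul, coeff_mk, coeff_mk, hermiteH_succ_succ j x, Nat.factorial_succ,
        Nat.factorial_succ]
      push_cast
      field_simp
      ring
  have h2 : (C (2 : ℂ) : PowerSeries ℂ) ≠ 0 := by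
    rw [Ne, map_eq_zero_iff _ (PowerSeries.C_injective)]
    exact two_ne_zero
  refine mul_left_cancel₀ h2 ?_
  have e1 : (C (2 * x) : PowerSeries ℂ) = C 2 * C x := map_mul _ _ _
  have e2 : (C (2 * y) : PowerSeries ℂ) = C 2 * C y := map_mul _ _ _
  have e3 : (C (2 : ℂ) : PowerSeries ℂ) = 2 := map_ofNat C 2
  rw [e1, e3] at hB
  rw [e2, e3] at hD hF
  rw [e1, e3] at hA'
  rw [e1, e2, e3]
  have h4 : (2 : PowerSeries ℂ) ≠ 0 := by rw [← e3]; exact h2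
  have hA2 : derivative ℂ A * (1 - X * X) = (C x - C y * X) * D + X * A := by
    refine mul_left_cancel₀ h4 ?_
    linear_combination hA' - X * hF
  have hD2 : D * (1 - X * X) = (2 * C y - 2 * C x * X) * A := by
    linear_combination hD - X * hB
  linear_combination 2 * (1 - X * X) * hA2 + 2 * (C x - C y * X) * hD2

/-- The closed form of the sum of the Mehler series. -/
def mehlerFun (x y σ : ℂ) : ℂ :=
  (1 - σ) ^ (-1 / 2 : ℂ) * (1 + σ) ^ (-1 / 2 : ℂ) *
    Complex.exp ((2 * (x * y) * σ - (x ^ 2 + y ^ 2) * σ ^ 2) / (1 - σ ^ 2))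

theorem one_sub_mem_slitPlane {σ : ℂ} (h : ‖σ‖ < 1) : 1 - σ ∈ Complex.slitPlane := by
  left
  have := (Complex.abs_re_le_norm σ).trans_lt h
  simp; linarith [(abs_lt.1 this).2]

theorem one_add_mem_slitPlane {σ : ℂ} (h : ‖σ‖ < 1) : 1 + σ ∈ Complex.slitPlane := by
  left
  have := (Complex.abs_re_le_norm σ).trans_lt h
  simp; linarith [(abs_lt.1 this).1]

theorem one_sub_sq_ne_zero {σ : ℂ} (h : ‖σ‖ < 1) : 1 - σ ^ 2 ≠ 0 := by
  have h1 := Complex.slitPlane_ne_zero (one_sub_mem_slitPlane h)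
  have h2 := Complex.slitPlane_ne_zero (one_add_mem_slitPlane h)
  have : 1 - σ ^ 2 = (1 - σ) * (1 + σ) := by ring
  rw [this]; exact mul_ne_zero h1 h2

/-- The derivative is written with the rational logarithmic derivative of `mehlerSeries_ode`, so
that closed form and series satisfy the same equation. -/
theorem hasDerivAt_mehlerFun (x y : ℂ) {σ : ℂ} (h : ‖σ‖ < 1) :
    HasDerivAt (mehlerFun x y)
      (((x - y * σ) * (2 * y - 2 * x * σ) + σ * (1 - σ * σ)) / ((1 - σ * σ) * (1 - σ * σ)) *
        mehlerFun x y σ) σ := by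
  have h1 := one_sub_mem_slitPlane h
  have h2 := one_add_mem_slitPlane h
  have h1' := Complex.slitPlane_ne_zero h1
  have h2' := Complex.slitPlane_ne_zero h2
  have h3 := one_sub_sq_ne_zero h
  have d1 : HasDerivAt (fun σ : ℂ => (1 - σ) ^ (-1 / 2 : ℂ))
      ((-1 / 2) * (1 - σ) ^ (-1 / 2 - 1 : ℂ) * (-1)) σ :=
    ((hasDerivAt_id σ).const_sub 1).cpow_const h1
  have d2 : HasDerivAt (fun σ : ℂ => (1 + σ) ^ (-1 / 2 : ℂ))
      ((-1 / 2) * (1 + σ) ^ (-1 / 2 - 1 : ℂ) * 1) σ :=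
    ((hasDerivAt_id σ).const_add 1).cpow_const h2
  have d3 : HasDerivAt (fun σ : ℂ => (2 * (x * y) * σ - (x ^ 2 + y ^ 2) * σ ^ 2) / (1 - σ ^ 2))
      (((2 * (x * y) - (x ^ 2 + y ^ 2) * (2 * σ)) * (1 - σ ^ 2) -
        (2 * (x * y) * σ - (x ^ 2 + y ^ 2) * σ ^ 2) * (-(2 * σ))) / (1 - σ ^ 2) ^ 2) σ := by
    have e1 : HasDerivAt (fun σ : ℂ => σ ^ 2) (2 * σ) σ := by simpa using hasDerivAt_pow 2 σ
    have e2 : HasDerivAt (fun σ : ℂ => 2 * (x * y) * σ) (2 * (x * y)) σ := by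
      simpa using (hasDerivAt_id σ).const_mul (2 * (x * y))
    exact (e2.sub (e1.const_mul _)).div (e1.const_sub 1) h3
  refine ((d1.mul d2).mul d3.cexp).congr_deriv ?_
  rw [Complex.cpow_sub _ _ h1', Complex.cpow_sub _ _ h2', Complex.cpow_one, Complex.cpow_one,
    mehlerFun]
  have h3' : 1 - σ * σ = (1 - σ) * (1 + σ) := by ring
  have h3'' : 1 - σ ^ 2 = (1 - σ) * (1 + σ) := by ring
  simp only [Pi.mul_apply, h3', h3'']
  field_simp
  ring

theorem differentiableOn_mehlerFun (x y : ℂ) :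
    DifferentiableOn ℂ (mehlerFun x y) (Metric.ball 0 1) := fun σ hσ =>
  (hasDerivAt_mehlerFun x y (by simpa using hσ)).differentiableAt.differentiableWithinAt

/-- **Mehler's formula** for complex arguments. -/
theorem hasPS_mehlerSeries (x y : ℂ) : HasPS 1 (mehlerSeries x y) (mehlerFun x y) := by
  have hd := differentiableOn_mehlerFun x y
  have h1 := HasPS.of_differentiableOn hd
  have h2 := HasPS.deriv_of_differentiableOn hd
  set f := PowerSeries.mk fun m => iteratedDeriv m (mehlerFun x y) 0 / (m ! : ℂ) with hf
  have hX : HasPS 1 (1 - PowerSeries.X * PowerSeries.X) (fun z => 1 - z * z) :=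
    HasPS.one.sub (HasPS.X.mul HasPS.X)
  -- The equation holds pointwise on the disc, hence for the Taylor series; with the initial value
  -- at 0 it identifies that series.
  have hode := ((hX.mul hX).mul h2).unique one_pos
    (((((HasPS.C x).sub ((HasPS.C y).mul HasPS.X)).mul
      ((HasPS.C (2 * y)).sub ((HasPS.C (2 * x)).mul HasPS.X))).add (HasPS.X.mul hX)).mul h1)
    (fun z hz => by
      rw [(hasDerivAt_mehlerFun x y hz).deriv]
      have := one_sub_sq_ne_zero hz
      rw [pow_two] at this
      rw [← mul_assoc, mul_div_cancel₀ _ (mul_ne_zero this this)])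
  have : f = mehlerSeries x y := by
    refine eq_of_derivative_ode ?_ hode (mehlerSeries_ode x y) ?_
    · simp
    · simp [hf, mehlerSeries, mehlerFun, hermiteH_zero]
  exact this ▸ h1

/-! ### From multi-indices to one generating function -/

theorem hasPS_prod_mehlerSeries {d : ℕ} (x y : Fin d → ℂ) :
    HasPS 1 (∏ k, mehlerSeries (x k) (y k)) (fun σ =>
      ((1 - σ) ^ (-1 / 2 : ℂ)) ^ d * ((1 + σ) ^ (-1 / 2 : ℂ)) ^ d *
        Complex.exp ((2 * (∑ k, x k * y k) * σ - (∑ k, (x k ^ 2 + y k ^ 2)) * σ ^ 2) /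
          (1 - σ ^ 2))) := by
  refine (HasPS.prod Finset.univ fun k => hasPS_mehlerSeries (x k) (y k)).congr fun σ _ => ?_
  simp only [mehlerFun]
  rw [Finset.prod_mul_distrib, Finset.prod_const, Finset.card_univ, Fintype.card_fin, mul_pow,
    ← Complex.exp_sum, ← Finset.sum_div, Finset.sum_sub_distrib, Finset.mul_sum, Finset.sum_mul,
    Finset.sum_mul]

/-- Grouping by total degree m: each fibre is the sum over the antidiagonal that defines the m-th
coefficient of the product. -/
theorem sum_multiIndices (d n : ℕ) (a : Fin d → ℕ → ℂ) (t : ℂ) :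
    ∑ j ∈ multiIndices d n, t ^ (∑ k, j k) * ∏ k, a k (j k) =
      ∑ m ∈ Finset.range n, PowerSeries.coeff m (∏ k, PowerSeries.mk (a k)) * t ^ m := by
  have h1 : ∀ j ∈ multiIndices d n, ∑ k, j k ∈ Finset.range n := fun j hj => by
    simpa using (Finset.mem_filter.1 hj).2
  rw [← Finset.sum_fiberwise_of_maps_to h1]
  refine Finset.sum_congr rfl fun m hm => ?_
  have hm' : m < n := Finset.mem_range.1 hm
  rw [PowerSeries.coeff_prod, Finset.sum_mul]
  refine Finset.sum_bij' (fun j _ => Finsupp.equivFunOnFinite.symm j)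
    (fun l _ => Finsupp.equivFunOnFinite l) ?_ ?_ ?_ ?_ ?_
  · intro j hj
    rw [Finset.mem_filter] at hj
    rw [Finset.mem_finsuppAntidiag]
    exact ⟨by simpa using hj.2, Finset.subset_univ _⟩
  · intro l hl
    rw [Finset.mem_finsuppAntidiag] at hl
    have hs : ∑ k, l k = m := hl.1
    rw [Finset.mem_filter, multiIndices, Finset.mem_filter, Fintype.mem_piFinset]
    refine ⟨⟨fun k => ?_, by simpa [hs] using hm'⟩, by simpa using hs⟩
    have := Finset.single_le_sum (f := fun k => l k) (fun i _ => Nat.zero_le _) (Finset.mem_univ k)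
    rw [Finset.mem_range]
    simp only [Finsupp.equivFunOnFinite_apply]
    omega
  · intro j _; simp
  · intro l _; simp
  · intro j hj
    rw [Finset.mem_filter] at hj
    rw [hj.2, mul_comm]
    simp

/-! ### Deformation of contours -/

/-- The integral of `f` along the line `θ ↦ p + θ v`. -/
def lineInt (f : ℂ → ℂ) (p v : ℂ) (s t : ℝ) : ℂ :=
  ∫ θ in s..t, f (p + θ * v) * v

theorem line_mem_of_convex {S : Set ℂ} (hS : Convex ℝ S) {p v : ℂ} {s t : ℝ}
    (hs : p + s * v ∈ S) (ht : p + t * v ∈ S) {θ : ℝ} (hθ : θ ∈ Set.uIcc s t) :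
    p + θ * v ∈ S := by
  have h : Convex ℝ {θ : ℝ | p + θ * v ∈ S} := by
    intro x hx y hy a b ha hb hab
    have h1 := hS hx hy ha hb hab
    have h2 : p + ((a • x + b • y : ℝ) : ℂ) * v = a • (p + x * v) + b • (p + y * v) := by
      have : (a : ℂ) + b = 1 := by exact_mod_cast hab
      simp only [smul_eq_mul, Complex.real_smul]
      push_cast
      linear_combination (-p) * this
    change p + ((a • x + b • y : ℝ) : ℂ) * v ∈ S
    rw [h2]; exact h1
  exact h.ordConnected.uIcc_subset hs ht hθ

theorem continuousOn_line {S : Set ℂ} (hS : Convex ℝ S) {f : ℂ → ℂ} (hf : ContinuousOn f S)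
    {p v : ℂ} {s t : ℝ} (hs : p + s * v ∈ S) (ht : p + t * v ∈ S) :
    ContinuousOn (fun θ : ℝ => f (p + θ * v)) (Set.uIcc s t) :=
  hf.comp (Continuous.continuousOn (by fun_prop)) fun _ hθ => line_mem_of_convex hS hs ht hθ

/-- Derivatives are taken within S because the segments used end on the edges Im ζ = 0 and Im ζ = π
of the domain, where the integrand need not extend holomorphically. -/
theorem lineInt_eq_sub {S : Set ℂ} (hS : Convex ℝ S) {f F : ℂ → ℂ} (hf : ContinuousOn f S)
    (hF : ∀ z ∈ S, HasDerivWithinAt F (f z) S z) {p v : ℂ} {s t : ℝ}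
    (hs : p + s * v ∈ S) (ht : p + t * v ∈ S) :
    lineInt f p v s t = F (p + t * v) - F (p + s * v) := by
  wlog hst : s ≤ t generalizing s t with H
  · have := H ht hs (le_of_not_ge hst)
    rw [lineInt] at this ⊢
    rw [intervalIntegral.integral_symm, this]; ring
  have hmem : ∀ θ ∈ Set.Icc s t, p + (θ : ℂ) * v ∈ S := fun θ hθ =>
    line_mem_of_convex hS hs ht (by rwa [Set.uIcc_of_le hst])
  have hd : ∀ θ ∈ Set.Icc s t, HasDerivWithinAt (fun θ : ℝ => F (p + θ * v)) (f (p + θ * v) * v)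
      (Set.Icc s t) θ := by
    intro θ hθ
    have e1 : HasDerivWithinAt (fun θ : ℝ => p + (θ : ℂ) * v) v (Set.Icc s t) θ := by
      have := ((Complex.ofRealCLM.hasDerivAt (x := θ)).mul_const v).const_add p
      simpa using this.hasDerivWithinAt
    have e2 := (hF _ (hmem θ hθ)).scomp θ e1 hmem
    rw [smul_eq_mul, mul_comm] at e2
    exact e2
  refine intervalIntegral.integral_eq_sub_of_hasDerivAt_of_le hst
    (fun θ hθ => (hd θ hθ).continuousWithinAt)
    (fun θ hθ => (hd θ (Set.Ioo_subset_Icc_self hθ)).hasDerivAt (Icc_mem_nhds hθ.1 hθ.2)) ?_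
  exact ((continuousOn_line hS hf hs ht).mul continuousOn_const).intervalIntegrable

/-- Moving a vertical segment to a broken line over the same range of imaginary parts. -/
theorem lineInt_vertical_eq {S : Set ℂ} (hS : Convex ℝ S) {f : ℂ → ℂ} (hf : DifferentiableOn ℂ f S)
    {p q v w : ℂ} {c e m b : ℝ} (h0 : p = -c) (hm : p + m * v = q + m * w)
    (hb : q + b * w = e + b * Complex.I)
    (m1 : p ∈ S) (m2 : p + b * Complex.I ∈ S) (m3 : p + m * v ∈ S) (m4 : q + b * w ∈ S) :
    lineInt f p Complex.I 0 b = lineInt f p v 0 m + lineInt f q w m b +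
      ∫ t in e..(-c), f (t + b * Complex.I) := by
  obtain ⟨F, hF⟩ := hS.exists_forall_hasDerivWithinAt hf
  have hc := hf.continuousOn
  have m1' : p + ((0 : ℝ) : ℂ) * Complex.I ∈ S := by simpa using m1
  have m1'' : p + ((0 : ℝ) : ℂ) * v ∈ S := by simpa using m1
  have m3' : q + m * w ∈ S := hm ▸ m3
  have e1 : ∫ t in e..(-c), f (t + b * Complex.I) = lineInt f (b * Complex.I) 1 e (-c) := by
    simp only [lineInt, mul_one, add_comm]
  have m5 : (b * Complex.I) + (e : ℝ) * 1 ∈ S := by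
    rw [mul_one, add_comm, ← hb]; exact m4
  have m6 : (b * Complex.I) + ((-c : ℝ) : ℂ) * 1 ∈ S := by
    rw [mul_one, add_comm]; push_cast; rw [← h0]; exact m2
  rw [e1, lineInt_eq_sub hS hc hF m1' m2, lineInt_eq_sub hS hc hF m1'' m3,
    lineInt_eq_sub hS hc hF m3' m4, lineInt_eq_sub hS hc hF m5 m6]
  have e2 : (b * Complex.I) + (e : ℝ) * 1 = q + b * w := by rw [hb]; ring
  have e3 : (b * Complex.I) + ((-c : ℝ) : ℂ) * 1 = p + b * Complex.I := by
    rw [h0]; push_cast; ring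
  rw [e2, e3, hm]
  simp

theorem conj_intervalIntegral (f : ℝ → ℂ) (s t : ℝ) :
    conj (∫ θ in s..t, f θ) = ∫ θ in s..t, conj (f θ) := by
  rw [intervalIntegral.intervalIntegral_eq_integral_uIoc,
    intervalIntegral.intervalIntegral_eq_integral_uIoc, integral_conj]
  split_ifs <;> simp

/-- A period of `f` along a vertical line, after moving both halves; the horizontal pieces cancel
by periodicity. -/
theorem I_mul_integral_eq_sub_conj {f g : ℂ → ℂ} {c e : ℝ} {Q R : ℂ} {T : Set ℂ}
    (hg : ∀ ζ ∈ T, g ζ = conj (f (conj ζ)))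
    (hT1 : ∀ θ : ℝ, -c + θ * Complex.I ∈ T)
    (hT2 : ∀ t ∈ Set.uIcc e (-c), (t : ℂ) + Real.pi * Complex.I ∈ T)
    (hper : ∀ t : ℝ, f (t + Real.pi * Complex.I) = f (t - Real.pi * Complex.I))
    (hfi : IntervalIntegrable (fun θ : ℝ => f (-c + θ * Complex.I)) MeasureTheory.volume 0 Real.pi)
    (hgi : IntervalIntegrable (fun θ : ℝ => g (-c + θ * Complex.I)) MeasureTheory.volume 0 Real.pi)
    (hQ : lineInt f (-c) Complex.I 0 Real.pi = Q + ∫ t in e..(-c), f (t + Real.pi * Complex.I))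
    (hR : lineInt g (-c) Complex.I 0 Real.pi = R + ∫ t in e..(-c), g (t + Real.pi * Complex.I)) :
    Complex.I * ∫ θ in (-Real.pi)..Real.pi, f (-c + θ * Complex.I) = Q - conj R := by
  have hconj : ∀ θ : ℝ, conj (g (-c + θ * Complex.I)) = f (-c + (-θ : ℝ) * Complex.I) := by
    intro θ
    rw [hg _ (hT1 θ), Complex.conj_conj]
    congr 1
    simp
  -- The lower half of the line is the conjugate of the upper half for g, so only the upper half
  -- ever needs to be deformed.
  have hlow : IntervalIntegrable (fun θ : ℝ => f (-c + θ * Complex.I)) MeasureTheory.volume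
      (-Real.pi) 0 := by
    have h1 : IntervalIntegrable (fun θ : ℝ => conj (g (-c + θ * Complex.I)))
        MeasureTheory.volume 0 Real.pi := by
      refine ⟨?_, ?_⟩
      · exact (Complex.conjCLE : ℂ →L[ℝ] ℂ).integrable_comp hgi.1
      · exact (Complex.conjCLE : ℂ →L[ℝ] ℂ).integrable_comp hgi.2
    simp only [hconj] at h1
    have h2 := (IntervalIntegrable.iff_comp_neg (by simp)).1 h1
    simp only [neg_neg, neg_zero] at h2
    exact h2.symm
  rw [← intervalIntegral.integral_add_adjacent_intervals hlow hfi]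
  have e1 : ∫ θ in (-Real.pi)..0, f (-c + θ * Complex.I) =
      conj (∫ θ in (0 : ℝ)..Real.pi, g (-c + θ * Complex.I)) := by
    rw [conj_intervalIntegral]
    simp only [hconj]
    rw [intervalIntegral.integral_comp_neg (fun θ : ℝ => f (-c + θ * Complex.I))]
    simp
  have e2 : conj (∫ t in e..(-c), g (t + Real.pi * Complex.I)) =
      ∫ t in e..(-c), f (t + Real.pi * Complex.I) := by
    rw [conj_intervalIntegral]
    refine intervalIntegral.integral_congr fun t ht => ?_
    rw [hg _ (hT2 t ht), Complex.conj_conj, hper]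
    congr 1
    simp [sub_eq_add_neg]
  have e3 : ∀ h : ℂ → ℂ, lineInt h (-c) Complex.I 0 Real.pi =
      (∫ θ in (0 : ℝ)..Real.pi, h (-c + θ * Complex.I)) * Complex.I := fun h => by
    rw [lineInt, intervalIntegral.integral_mul_const]
  rw [e3] at hQ hR
  have e4 := congrArg conj hR
  rw [map_mul, map_add, e2, Complex.conj_I, ← e1] at e4
  linear_combination hQ - e4

theorem norm_lineInt_le {f : ℂ → ℂ} {p v : ℂ} {s t : ℝ} (hst : s ≤ t) {M : ℝ → ℝ}
    (hM : Continuous M) (h : ∀ θ ∈ Set.Icc s t, ‖f (p + θ * v)‖ ≤ M θ) :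
    ‖lineInt f p v s t‖ ≤ ‖v‖ * ∫ θ in s..t, M θ := by
  rw [lineInt, intervalIntegral.integral_mul_const, norm_mul, mul_comm]
  refine mul_le_mul_of_nonneg_left ?_ (norm_nonneg _)
  refine intervalIntegral.norm_integral_le_of_norm_le hst ?_ (hM.intervalIntegrable _ _)
  exact Filter.Eventually.of_forall fun θ hθ => h θ ⟨hθ.1.le, hθ.2⟩

/-! ### Domains in the logarithmic variable -/

/-- Upper half of the domain of holomorphy that contains the moved contours. -/
def wedge (a c ε : ℝ) : Set ℂ :=
  {ζ | 0 ≤ ζ.im ∧ ζ.im ≤ Real.pi ∧ ζ.re ≤ a * ζ.im - c ∧ ζ.re ≤ a * (Real.pi - ζ.im) - ε}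

/-- Domain for the model integrand, singular on the positive half line only. -/
def halfWedge (a c : ℝ) : Set ℂ :=
  {ζ | 0 ≤ ζ.im ∧ ζ.im ≤ Real.pi ∧ ζ.re ≤ a * ζ.im - c}

theorem convex_halfWedge (a c : ℝ) : Convex ℝ (halfWedge a c) := by
  rintro z ⟨h1, h2, h3⟩ w ⟨k1, k2, k3⟩ s t hs ht hst
  simp only [halfWedge, Set.mem_ofPred_eq, Complex.add_re, Complex.add_im, Complex.real_smul,
    Complex.re_ofReal_mul, Complex.im_ofReal_mul]
  have e : t = 1 - s := by linarith
  subst e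
  refine ⟨?_, ?_, ?_⟩ <;> nlinarith

theorem convex_wedge (a c ε : ℝ) : Convex ℝ (wedge a c ε) := by
  rintro z ⟨h1, h2, h3, h4⟩ w ⟨k1, k2, k3, k4⟩ s t hs ht hst
  simp only [wedge, Set.mem_ofPred_eq, Complex.add_re, Complex.add_im, Complex.real_smul,
    Complex.re_ofReal_mul, Complex.im_ofReal_mul]
  have e : t = 1 - s := by linarith
  subst e
  refine ⟨?_, ?_, ?_, ?_⟩ <;> nlinarith

theorem exp_im_pos {ζ : ℂ} (h0 : 0 < ζ.im) (h1 : ζ.im < Real.pi) : 0 < (Complex.exp ζ).im := by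
  rw [Complex.exp_im]
  exact mul_pos (Real.exp_pos _) (Real.sin_pos_of_pos_of_lt_pi h0 h1)

theorem exp_of_im_zero {ζ : ℂ} (h : ζ.im = 0) : Complex.exp ζ = (Real.exp ζ.re : ℂ) := by
  conv_lhs => rw [← Complex.re_add_im ζ, h]
  simp

theorem exp_of_im_pi {ζ : ℂ} (h : ζ.im = Real.pi) : Complex.exp ζ = -(Real.exp ζ.re : ℂ) := by
  conv_lhs => rw [← Complex.re_add_im ζ, h, Complex.exp_add, Complex.exp_pi_mul_I]
  simp

/-- The exponential maps the open strip 0 < Im ζ < π into the upper half plane, away from every real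
cut and pole. Only the two edges need a check, and there the slanted constraint bounds |σ|. -/
theorem one_sub_exp_mem_slitPlane {a c : ℝ} (hc : 0 < c) {ζ : ℂ} (hζ : ζ ∈ halfWedge a c) :
    1 - Complex.exp ζ ∈ Complex.slitPlane := by
  obtain ⟨h1, h2, h3⟩ := hζ
  rcases h1.eq_or_lt with h | h
  · rw [exp_of_im_zero h.symm]
    left
    rw [← h] at h3
    have : Real.exp ζ.re < 1 := Real.exp_lt_one_iff.2 (by linarith)
    simpa [← Complex.ofReal_exp] using this
  · rcases h2.eq_or_lt with h' | h'
    · rw [exp_of_im_pi h']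
      left
      simp only [sub_neg_eq_add, Complex.add_re, Complex.one_re, Complex.ofReal_re]
      have := Real.exp_pos ζ.re
      linarith
    · right
      have := exp_im_pos h h'
      simp only [Complex.sub_im, Complex.one_im]
      linarith

theorem one_add_exp_mem_slitPlane {a c ε : ℝ} (hε : 0 < ε) {ζ : ℂ} (hζ : ζ ∈ wedge a c ε) :
    1 + Complex.exp ζ ∈ Complex.slitPlane := by
  obtain ⟨h1, h2, h3, h4⟩ := hζ
  rcases h1.eq_or_lt with h | h
  · rw [exp_of_im_zero h.symm]
    left
    simp only [Complex.add_re, Complex.one_re, Complex.ofReal_re]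
    have := Real.exp_pos ζ.re
    linarith
  · rcases h2.eq_or_lt with h' | h'
    · rw [exp_of_im_pi h']
      left
      rw [h'] at h4
      have : Real.exp ζ.re < 1 := Real.exp_lt_one_iff.2 (by linarith)
      simp only [Complex.add_re, Complex.one_re, Complex.neg_re, Complex.ofReal_re]
      linarith
    · right
      have := exp_im_pos h h'
      simp only [Complex.add_im, Complex.one_im]
      linarith

theorem sub_exp_ne_zero {a c τ : ℝ} (hτ : Real.exp (-c) < τ) {ζ : ℂ}
    (hζ : ζ ∈ halfWedge a c) : (τ : ℂ) - Complex.exp ζ ≠ 0 := by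
  obtain ⟨h1, h2, h3⟩ := hζ
  have hτ0 : 0 < τ := (Real.exp_pos _).trans hτ
  rw [sub_ne_zero]
  intro heq
  rcases h1.eq_or_lt with h | h
  · rw [exp_of_im_zero h.symm] at heq
    have e : τ = Real.exp ζ.re := by exact_mod_cast heq
    rw [← h] at h3
    have : Real.exp ζ.re ≤ Real.exp (-c) := Real.exp_le_exp.2 (by linarith)
    linarith
  · rcases h2.eq_or_lt with h' | h'
    · rw [exp_of_im_pi h'] at heq
      have e : τ = -Real.exp ζ.re := by exact_mod_cast heq
      have := Real.exp_pos ζ.re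
      linarith
    · have := exp_im_pos h h'
      rw [← heq] at this
      simp at this

theorem wedge_subset_halfWedge (a c ε : ℝ) : wedge a c ε ⊆ halfWedge a c :=
  fun _ h => ⟨h.1, h.2.1, h.2.2.1⟩

/-! ### Pointwise size of the kernel integrand -/

/-- The contour integrand of the kernel in the variable `ζ = log σ`. -/
def kernelIntegrand (d : ℕ) (x τ : ℝ) (n : ℕ) (β δ ζ : ℂ) : ℂ :=
  ((1 - Complex.exp ζ) ^ (-1 / 2 : ℂ)) ^ d * ((1 + Complex.exp ζ) ^ (-1 / 2 : ℂ)) ^ d *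
    Complex.exp (β * ((Complex.exp ζ - 1) / (2 * (1 + Complex.exp ζ))) +
      δ * (Complex.exp ζ / (1 - Complex.exp ζ ^ 2))) *
    (τ - Complex.exp ζ)⁻¹ * Complex.exp ζ *
    Complex.exp (n * ((x : ℂ) ^ 2 * ((Complex.exp ζ - 1) / (2 * (1 + Complex.exp ζ))) - ζ))

theorem norm_exp_line (u θ : ℝ) : ‖Complex.exp (u + θ * Complex.I)‖ = Real.exp u := by
  rw [Complex.norm_exp]; simp

theorem sq_norm_one_sub_exp (u θ : ℝ) : ‖1 - Complex.exp (u + θ * Complex.I)‖ ^ 2 =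
    (1 - Real.exp u) ^ 2 + 2 * Real.exp u * (1 - Real.cos θ) := by
  rw [Complex.sq_norm, Complex.normSq_apply, Complex.sub_re, Complex.sub_im, Complex.exp_re,
    Complex.exp_im]
  simp
  linear_combination (Real.exp u) ^ 2 * Real.sin_sq_add_cos_sq θ

theorem sq_norm_one_add_exp (u θ : ℝ) : ‖1 + Complex.exp (u + θ * Complex.I)‖ ^ 2 =
    (1 - Real.exp u) ^ 2 + 2 * Real.exp u * (1 + Real.cos θ) := by
  rw [Complex.sq_norm, Complex.normSq_apply, Complex.add_re, Complex.add_im, Complex.exp_re,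
    Complex.exp_im]
  simp
  linear_combination (Real.exp u) ^ 2 * Real.sin_sq_add_cos_sq θ

/-- Gives |1 - e^ζ| ≥ |ζ|/3 in the region used. The constant comes from e^u ≥ 1/3 on |u| ≤ 1 and 1 -
cos θ ≥ (2/π²)θ² ≥ θ²/6. -/
theorem sq_div_nine_le {u θ : ℝ} (hu : |u| ≤ 1) (hθ : |θ| ≤ Real.pi) :
    (u ^ 2 + θ ^ 2) / 9 ≤ (1 - Real.exp u) ^ 2 + 2 * Real.exp u * (1 - Real.cos θ) := by
  have h1 := Real.cos_le_one_sub_mul_cos_sq hθ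
  obtain ⟨hu1, hu2⟩ := abs_le.1 hu
  have h2 : (1 / 3 : ℝ) ≤ Real.exp u := by
    have e1 : Real.exp (-1) ≤ Real.exp u := Real.exp_le_exp.2 hu1
    have e2 : (1 / 3 : ℝ) ≤ Real.exp (-1) := by
      rw [Real.exp_neg, one_div]
      exact inv_anti₀ (Real.exp_pos _) (by linarith [Real.exp_one_lt_d9])
    linarith
  have h3 : u ^ 2 / 9 ≤ (1 - Real.exp u) ^ 2 := by
    rcases le_total 0 u with h | h
    · have := Real.add_one_le_exp u
      nlinarith
    · have e1 := Real.add_one_le_exp (-u)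
      have e2 : Real.exp u * Real.exp (-u) = 1 := by rw [← Real.exp_add]; simp
      have e3 : Real.exp u ≤ 1 := Real.exp_le_one_iff.2 h
      have e4 : Real.exp u * (1 - u) ≤ 1 := by
        nlinarith [Real.exp_pos u]
      have e5 : -u / 3 ≤ 1 - Real.exp u := by nlinarith
      nlinarith
  have h4 : θ ^ 2 / 9 ≤ 2 * Real.exp u * (1 - Real.cos θ) := by
    have e1 : (1 / 6 : ℝ) ≤ 2 / Real.pi ^ 2 := by
      rw [div_le_div_iff₀ (by norm_num) (by positivity)]
      nlinarith [Real.pi_lt_d2, Real.pi_pos]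
    have e2 : θ ^ 2 / 6 ≤ 1 - Real.cos θ := by nlinarith [sq_nonneg θ]
    have e3 : 0 ≤ 1 - Real.cos θ := by linarith [Real.cos_le_one θ]
    nlinarith [sq_nonneg θ]
  linarith

theorem norm_one_sub_exp_ge {u θ : ℝ} (hu : |u| ≤ 1) (h0 : 0 ≤ θ) (hθ : θ ≤ Real.pi) :
    |u| / 3 ≤ ‖1 - Complex.exp (u + θ * Complex.I)‖ ∧
      θ / 3 ≤ ‖1 - Complex.exp (u + θ * Complex.I)‖ := by
  have h1 := sq_div_nine_le hu (abs_le.2 ⟨by linarith, hθ⟩)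
  rw [← sq_norm_one_sub_exp] at h1
  refine ⟨abs_le_of_sq_le_sq' ?_ (norm_nonneg _) |>.2, abs_le_of_sq_le_sq' ?_ (norm_nonneg _) |>.2⟩
  · rw [div_pow, sq_abs]; nlinarith [sq_nonneg θ]
  · nlinarith [sq_nonneg u]

theorem norm_one_add_exp_ge {u θ : ℝ} (hu : |u| ≤ 1) (h0 : 0 ≤ θ) (hθ : θ ≤ Real.pi) :
    |u| / 3 ≤ ‖1 + Complex.exp (u + θ * Complex.I)‖ ∧
      (Real.pi - θ) / 3 ≤ ‖1 + Complex.exp (u + θ * Complex.I)‖ := by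
  have h1 := sq_div_nine_le (θ := Real.pi - θ) hu (abs_le.2 ⟨by linarith, by linarith⟩)
  rw [Real.cos_pi_sub, sub_neg_eq_add, ← sq_norm_one_add_exp] at h1
  refine ⟨abs_le_of_sq_le_sq' ?_ (norm_nonneg _) |>.2, abs_le_of_sq_le_sq' ?_ (norm_nonneg _) |>.2⟩
  · rw [div_pow, sq_abs]; nlinarith [sq_nonneg (Real.pi - θ)]
  · nlinarith [sq_nonneg u]

/-- The Cayley quotient is tanh(ζ/2)/2, so its real part changes sign exactly across the unit
circle. -/
theorem re_cayley_exp (u θ : ℝ) :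
    ((Complex.exp (u + θ * Complex.I) - 1) / (2 * (1 + Complex.exp (u + θ * Complex.I)))).re =
      Real.sinh u / (2 * (Real.cosh u + Real.cos θ)) := by
  have h1 := sq_norm_one_add_exp u θ
  set σ := Complex.exp (u + θ * Complex.I) with hσ
  have h2 : (1 - Real.exp u) ^ 2 + 2 * Real.exp u * (1 + Real.cos θ) =
      2 * Real.exp u * (Real.cosh u + Real.cos θ) := by
    rw [Real.cosh_eq, Real.exp_neg]
    have := (Real.exp_pos u).ne'
    field_simp; ring
  have h3 : ((σ - 1) / (2 * (1 + σ))).re = (‖σ‖ ^ 2 - 1) / (2 * ‖1 + σ‖ ^ 2) := by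
    rw [Complex.div_re, Complex.normSq_mul, Complex.sq_norm, Complex.sq_norm]
    simp only [Complex.normSq_apply, Complex.add_re, Complex.add_im, Complex.sub_re,
      Complex.sub_im, Complex.mul_re, Complex.mul_im, Complex.one_re, Complex.one_im,
      Complex.re_ofNat, Complex.im_ofNat]
    rw [← add_div]
    -- At σ = -1 both sides vanish, division by zero being zero.
    rcases eq_or_ne ((1 + σ.re) * (1 + σ.re) + (0 + σ.im) * (0 + σ.im)) 0 with h | h
    · rw [h]; simp
    · field_simp
      ring
  rw [h3, h1, h2, hσ, norm_exp_line, Real.sinh_eq, Real.exp_neg]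
  have := (Real.exp_pos u).ne'
  rcases eq_or_ne (Real.cosh u + Real.cos θ) 0 with h | h
  · rw [h]; simp
  · field_simp

theorem norm_cpow_neg_half_le {z : ℂ} {m : ℝ} (hm : 0 < m) (hz : m ≤ ‖z‖) :
    ‖z ^ (-1 / 2 : ℂ)‖ ≤ (Real.sqrt m)⁻¹ := by
  have hz0 : z ≠ 0 := norm_pos_iff.1 (hm.trans_le hz)
  have h1 : (-1 / 2 : ℂ) = ((-1 / 2 : ℝ) : ℂ) := by push_cast; ring
  rw [h1, Complex.norm_cpow_real, show (-1 / 2 : ℝ) = -(1 / 2) by norm_num,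
    Real.rpow_neg (norm_nonneg _), ← Real.sqrt_eq_rpow]
  exact inv_anti₀ (Real.sqrt_pos.2 hm) (Real.sqrt_le_sqrt hz)

theorem norm_kernelIntegrand_le {d : ℕ} {x τ : ℝ} {n : ℕ} {β δ : ℂ} {u θ m₁ m₂ m₃ C₁ C₂ : ℝ}
    (h₁ : 0 < m₁) (h₂ : 0 < m₂) (h₃ : 0 < m₃)
    (h1 : m₁ ≤ ‖1 - Complex.exp (u + θ * Complex.I)‖)
    (h2 : m₂ ≤ ‖1 + Complex.exp (u + θ * Complex.I)‖)
    (h3 : m₃ ≤ ‖τ - Complex.exp (u + θ * Complex.I)‖) (hu : u ≤ 1)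
    (hβ : ‖β‖ * (4 / (2 * m₂)) ≤ C₁) (hδ : ‖δ‖ * (3 / (m₁ * m₂)) ≤ C₂) :
    ‖kernelIntegrand d x τ n β δ (u + θ * Complex.I)‖ ≤
      (Real.sqrt m₁)⁻¹ ^ d * (Real.sqrt m₂)⁻¹ ^ d * Real.exp (C₁ + C₂) * m₃⁻¹ * 3 *
        Real.exp (n * (x ^ 2 * (Real.sinh u / (2 * (Real.cosh u + Real.cos θ))) - u)) := by
  have hre := re_cayley_exp u θ
  have hσ3 : ‖Complex.exp (u + θ * Complex.I)‖ ≤ 3 := by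
    rw [norm_exp_line]
    exact (Real.exp_le_exp.2 hu).trans (by linarith [Real.exp_one_lt_d9])
  unfold kernelIntegrand
  set σ := Complex.exp (u + θ * Complex.I) with hσ
  have e1 : ‖(σ - 1) / (2 * (1 + σ))‖ ≤ 4 / (2 * m₂) := by
    rw [norm_div, norm_mul, Complex.norm_ofNat]
    have : ‖σ - 1‖ ≤ 4 := (norm_sub_le _ _).trans (by rw [norm_one]; linarith)
    gcongr
  have e2 : ‖σ / (1 - σ ^ 2)‖ ≤ 3 / (m₁ * m₂) := by
    have : 1 - σ ^ 2 = (1 - σ) * (1 + σ) := by ring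
    rw [this, norm_div, norm_mul]
    gcongr
  rw [norm_mul, norm_mul, norm_mul, norm_mul, norm_mul, norm_pow, norm_pow, norm_inv,
    Complex.norm_exp (n * _)]
  have e3 : (n * ((x : ℂ) ^ 2 * ((σ - 1) / (2 * (1 + σ))) - (u + θ * Complex.I))).re =
      n * (x ^ 2 * (Real.sinh u / (2 * (Real.cosh u + Real.cos θ))) - u) := by
    rw [← hre, ← Complex.ofReal_pow, ← Complex.ofReal_natCast, Complex.re_ofReal_mul,
      Complex.sub_re, Complex.re_ofReal_mul]
    simp
  rw [e3]
  have e4 : ‖Complex.exp (β * ((σ - 1) / (2 * (1 + σ))) + δ * (σ / (1 - σ ^ 2)))‖ ≤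
      Real.exp (C₁ + C₂) := by
    rw [Complex.norm_exp]
    refine Real.exp_le_exp.2 ((Complex.re_le_norm _).trans ((norm_add_le _ _).trans ?_))
    rw [norm_mul, norm_mul]
    refine add_le_add (le_trans ?_ hβ) (le_trans ?_ hδ) <;> gcongr
  have e5 := norm_cpow_neg_half_le h₁ h1
  have e6 := norm_cpow_neg_half_le h₂ h2
  have e7 : ‖(τ : ℂ) - σ‖⁻¹ ≤ m₃⁻¹ := inv_anti₀ h₃ h3
  gcongr

theorem sinh_le_mul_cosh {u : ℝ} (hu : 0 ≤ u) : Real.sinh u ≤ u * Real.cosh u := by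
  have hmono : MonotoneOn (fun u => u * Real.cosh u - Real.sinh u) (Set.Ici 0) := by
    refine monotoneOn_of_deriv_nonneg (convex_Ici 0) (Continuous.continuousOn (by fun_prop))
      (Differentiable.differentiableOn (by fun_prop)) fun v hv => ?_
    rw [interior_Ici] at hv
    have hd : HasDerivAt (fun u => u * Real.cosh u - Real.sinh u)
        (1 * Real.cosh v + v * Real.sinh v - Real.cosh v) v :=
      ((hasDerivAt_id v).mul (Real.hasDerivAt_cosh v)).sub (Real.hasDerivAt_sinh v)
    rw [hd.deriv]
    have : 0 ≤ v * Real.sinh v := mul_nonneg (le_of_lt hv) (Real.sinh_nonneg_iff.2 (le_of_lt hv))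
    linarith
  have := hmono (Set.mem_Ici.2 le_rfl) (Set.mem_Ici.2 hu) hu
  simp at this
  linarith

/-- The inequality is affine in c. At c = -1 it says cosh u ≥ 1, and at c = 1 it is tanh(u/2) ≤ u/2.
-/
theorem one_add_mul_sinh_le {u c : ℝ} (hu : 0 ≤ u) (h1 : -1 ≤ c) (h2 : c ≤ 1) :
    (1 + c) * Real.sinh u ≤ u * (Real.cosh u + c) := by
  have e1 : 1 ≤ Real.cosh u := Real.one_le_cosh u
  have e2 : 2 * Real.sinh u ≤ u * (Real.cosh u + 1) := by
    have h := sinh_le_mul_cosh (u := u / 2) (by linarith)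
    have hs : Real.sinh u = 2 * Real.sinh (u / 2) * Real.cosh (u / 2) := by
      rw [← Real.sinh_two_mul]; congr 1; ring
    have hc : Real.cosh u = 2 * Real.cosh (u / 2) ^ 2 - 1 := by
      have := Real.cosh_two_mul (u / 2)
      rw [show 2 * (u / 2) = u by ring] at this
      rw [this]; linarith [Real.cosh_sq (u / 2)]
    have := Real.cosh_pos (u / 2)
    rw [hs, hc]; nlinarith
  nlinarith [mul_nonneg hu (sub_nonneg.2 e1)]

/-- Decay of the exponent outside the unit circle, before the saddle point. -/
theorem exponent_le_of_nonneg {u θ c : ℝ} (hu : 0 ≤ u) (h1 : -1 ≤ c) (h2 : c ≤ 1)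
    (hD : 0 < Real.cosh u + Real.cos θ) :
    (2 * (1 + c)) * (Real.sinh u / (2 * (Real.cosh u + Real.cos θ))) - u ≤
      -(u * (Real.cos θ - c)) / (Real.cosh u + Real.cos θ) := by
  have := one_add_mul_sinh_le hu h1 h2
  rw [le_div_iff₀ hD]
  have e : ((2 * (1 + c)) * (Real.sinh u / (2 * (Real.cosh u + Real.cos θ))) - u) *
      (Real.cosh u + Real.cos θ) = (1 + c) * Real.sinh u - u * (Real.cosh u + Real.cos θ) := by
    field_simp
  rw [e]; linarith

theorem cosh_sub_one_le {v : ℝ} (hv : |v| ≤ 1) : Real.cosh v - 1 ≤ v ^ 2 := by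
  have h1 := Real.cosh_le_exp_half_sq v
  have hv2 : v ^ 2 ≤ 1 := by rw [← sq_abs]; nlinarith [abs_nonneg v]
  have h2 := Real.norm_exp_sub_one_sub_id_le (x := v ^ 2 / 2) (by
    rw [Real.norm_of_nonneg (by positivity)]; linarith)
  rw [Real.norm_of_nonneg (by positivity : (0:ℝ) ≤ v ^ 2 / 2)] at h2
  have := (abs_le.1 h2).2
  nlinarith [sq_nonneg v]

/-- Decay of the exponent inside the unit circle, past the saddle point. -/
theorem exponent_le_of_nonpos {v θ c : ℝ} (hv : 0 ≤ v) (hv1 : v ≤ 1) (h1 : -1 ≤ c)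
    (hD : 0 < Real.cosh v + Real.cos θ) :
    (2 * (1 + c)) * (Real.sinh (-v) / (2 * (Real.cosh (-v) + Real.cos θ))) - (-v) ≤
      v * (v ^ 2 - (c - Real.cos θ)) / (Real.cosh v + Real.cos θ) := by
  have e1 := cosh_sub_one_le (v := v) (by rw [abs_of_nonneg hv]; exact hv1)
  have e2 : v ≤ Real.sinh v := Real.self_le_sinh_iff.2 hv
  rw [le_div_iff₀ hD, Real.sinh_neg, Real.cosh_neg]
  have e : ((2 * (1 + c)) * (-Real.sinh v / (2 * (Real.cosh v + Real.cos θ))) - (-v)) *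
      (Real.cosh v + Real.cos θ) = v * (Real.cosh v + Real.cos θ) - (1 + c) * Real.sinh v := by
    field_simp
    ring
  rw [e]
  nlinarith

/-- The product formula for cos θ - cos θ₀ has one factor sin((θ+θ₀)/2), smallest at the ends θ = 0
and θ = π, and one factor bounded linearly by Jordan's inequality. -/
theorem cos_sub_cos_ge {θ₀ m : ℝ} (h0 : 0 < θ₀) (hπ : θ₀ < Real.pi)
    (hm1 : m ≤ Real.sin (θ₀ / 2)) (hm2 : m ≤ Real.cos (θ₀ / 2)) {θ : ℝ}
    (ht0 : 0 ≤ θ) (htπ : θ ≤ Real.pi) :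
    (θ ≤ θ₀ → 2 * m / Real.pi * (θ₀ - θ) ≤ Real.cos θ - Real.cos θ₀) ∧
      (θ₀ ≤ θ → 2 * m / Real.pi * (θ - θ₀) ≤ Real.cos θ₀ - Real.cos θ) := by
  have hp := Real.pi_pos
  have hs : m ≤ Real.sin ((θ + θ₀) / 2) := by
    rcases le_total ((θ + θ₀) / 2) (Real.pi / 2) with h | h
    · exact hm1.trans (Real.sin_le_sin_of_le_of_le_pi_div_two (by linarith) h (by linarith))
    · have e : Real.sin ((θ + θ₀) / 2) = Real.cos ((θ + θ₀) / 2 - Real.pi / 2) := by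
        rw [Real.cos_sub_pi_div_two]
      rw [e]
      exact hm2.trans (Real.cos_le_cos_of_nonneg_of_le_pi (by linarith) (by linarith) (by linarith))
  have hj : ∀ y, 0 ≤ y → y ≤ Real.pi → y / Real.pi ≤ Real.sin (y / 2) := fun y h1 h2 => by
    have := Real.mul_le_sin (x := y / 2) (by linarith) (by linarith)
    calc y / Real.pi = 2 / Real.pi * (y / 2) := by ring
      _ ≤ _ := this
  have hm : ∀ y, 0 ≤ y → y ≤ Real.pi →
      2 * m / Real.pi * y ≤ 2 * Real.sin ((θ + θ₀) / 2) * Real.sin (y / 2) := fun y h1 h2 => by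
    have e1 := hj y h1 h2
    have e2 : 0 ≤ Real.sin ((θ + θ₀) / 2) :=
      Real.sin_nonneg_of_nonneg_of_le_pi (by linarith) (by linarith)
    have e3 : 0 ≤ y / Real.pi := by positivity
    calc 2 * m / Real.pi * y = 2 * m * (y / Real.pi) := by ring
      _ ≤ 2 * Real.sin ((θ + θ₀) / 2) * (y / Real.pi) := by gcongr
      _ ≤ _ := by gcongr
  refine ⟨fun h => ?_, fun h => ?_⟩
  · rw [Real.cos_sub_cos]
    have e : (θ - θ₀) / 2 = -((θ₀ - θ) / 2) := by ring
    rw [e, Real.sin_neg]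
    have := hm (θ₀ - θ) (by linarith) (by linarith)
    linarith
  · rw [Real.cos_sub_cos]
    have e : (θ₀ - θ) / 2 = -((θ - θ₀) / 2) := by ring
    rw [e, Real.sin_neg, add_comm θ₀ θ]
    have := hm (θ - θ₀) (by linarith) (by linarith)
    linarith

/-! ### Decay on the far part of the contour -/

/-- Size of the perturbation parameters of `kernelIntegrand`. -/
def Admissible (x C : ℝ) (n : ℕ) (β δ : ℂ) : Prop :=
  ‖β‖ ≤ C ∧ (x = 0 → ‖β‖ ≤ C / n) ∧ ‖δ‖ ≤ C / n

theorem cosh_add_cos_pos {u θ m : ℝ} (hm : 0 < m)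
    (h : m ≤ ‖1 + Complex.exp (u + θ * Complex.I)‖) : 0 < Real.cosh u + Real.cos θ := by
  have h1 := sq_norm_one_add_exp u θ
  have h2 : (1 - Real.exp u) ^ 2 + 2 * Real.exp u * (1 + Real.cos θ) =
      2 * Real.exp u * (Real.cosh u + Real.cos θ) := by
    rw [Real.cosh_eq, Real.exp_neg]
    have := (Real.exp_pos u).ne'
    field_simp; ring
  rw [h2] at h1
  have h3 : 0 < 2 * Real.exp u * (Real.cosh u + Real.cos θ) := by
    rw [← h1]; exact pow_pos (hm.trans_le h) 2
  exact pos_of_mul_pos_right h3 (by positivity)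

/-- At height θ ≥ η both 1 - σ and τ - σ are bounded below by multiples of η. The distance m to -1
stays a parameter: it is fixed when x > 0 but of order 1/n when x = 0. -/
theorem norm_kernelIntegrand_far_le {d : ℕ} {x k : ℝ} {n : ℕ} {β δ : ℂ} {u θ η m C₁ C₂ E : ℝ}
    (hη : 0 < η) (hm : 0 < m) (hk : |k / n| ≤ η / 6) (hu : |u| ≤ 1) (h0 : η ≤ θ) (hθ : θ ≤ Real.pi)
    (hm' : m ≤ ‖1 + Complex.exp (u + θ * Complex.I)‖)
    (hβ : ‖β‖ * (4 / (2 * m)) ≤ C₁) (hδ : ‖δ‖ * (3 / (η / 3 * m)) ≤ C₂)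
    (hE : x ^ 2 * (Real.sinh u / (2 * (Real.cosh u + Real.cos θ))) - u ≤ E) :
    ‖kernelIntegrand d x (1 - k / n) n β δ (u + θ * Complex.I)‖ ≤
      (Real.sqrt (η / 3))⁻¹ ^ d * (Real.sqrt m)⁻¹ ^ d * Real.exp (C₁ + C₂) * (η / 6)⁻¹ * 3 *
        Real.exp (n * E) := by
  have h1 : η / 3 ≤ ‖1 - Complex.exp (u + θ * Complex.I)‖ :=
    le_trans (by linarith) (norm_one_sub_exp_ge hu (by linarith) hθ).2
  have h3 : η / 6 ≤ ‖((1 - k / n : ℝ) : ℂ) - Complex.exp (u + θ * Complex.I)‖ := by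
    have e : 1 - Complex.exp (u + θ * Complex.I) =
        (((1 - k / n : ℝ) : ℂ) - Complex.exp (u + θ * Complex.I)) + ((k / n : ℝ) : ℂ) := by
      push_cast; ring
    rw [e] at h1
    have := h1.trans (norm_add_le _ _)
    rw [Complex.norm_real, Real.norm_eq_abs] at this
    linarith
  refine (norm_kernelIntegrand_le (by linarith) hm (by linarith) h1 hm' h3
    (le_of_abs_le hu) hβ hδ).trans ?_
  gcongr

theorem integral_exp_neg_mul_le {s : ℝ} (hs : 0 < s) {p q : ℝ} (hp : 0 ≤ p) :
    ∫ θ in p..q, Real.exp (-(s * θ)) ≤ 1 / s := by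
  have e : ∀ θ : ℝ, Real.exp (-(s * θ)) = Real.exp (-s * θ) := fun θ => by rw [neg_mul]
  simp only [e]
  rw [intervalIntegral.integral_comp_mul_left (fun t => Real.exp t) (neg_ne_zero.2 hs.ne'),
    integral_exp, smul_eq_mul]
  have h1 : Real.exp (-s * p) ≤ 1 := Real.exp_le_one_iff.2 (by nlinarith)
  have h2 := Real.exp_pos (-s * q)
  rw [inv_neg, neg_mul, ← mul_neg, one_div]
  have h3 : 0 < s⁻¹ := by positivity
  nlinarith

theorem integral_gaussian_le {s : ℝ} (hs : 0 < s) (θ₀ : ℝ) {p q : ℝ} (hpq : p ≤ q) :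
    ∫ θ in p..q, Real.exp (-(s * (θ - θ₀) ^ 2)) ≤ Real.sqrt (Real.pi / s) := by
  have e : ∀ θ : ℝ, Real.exp (-(s * (θ - θ₀) ^ 2)) = (fun t => Real.exp (-s * t ^ 2)) (θ - θ₀) :=
    fun θ => by simp only [neg_mul]
  simp only [e]
  rw [intervalIntegral.integral_comp_sub_right (fun t => Real.exp (-s * t ^ 2)), ← integral_gaussian,
    intervalIntegral.integral_of_le (by linarith)]
  exact MeasureTheory.setIntegral_le_integral (integrable_exp_neg_mul_sq hs)
    (Filter.Eventually.of_forall fun t => (Real.exp_pos _).le)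

theorem point_eq (c a θ : ℝ) : (-(c : ℂ)) + θ * (a + Complex.I) =
    ((a * θ - c : ℝ) : ℂ) + θ * Complex.I := by push_cast; ring

theorem point_eq' (e a θ : ℝ) : (e : ℂ) + θ * (-a + Complex.I) =
    ((e - a * θ : ℝ) : ℂ) + θ * Complex.I := by push_cast; ring

/-- Bound for the part of the contour that is far from `σ = 1`, with parameters to be chosen. -/
def FarBound (d : ℕ) (x k c C a η : ℝ) : Prop :=
  ∃ K : ℝ, ∀ᶠ n : ℕ in atTop, ∃ e m : ℝ, e < a * Real.pi ∧ a * m - c / n = e - a * m ∧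
    η ≤ m ∧ m ≤ Real.pi ∧ ∀ β δ : ℂ, Admissible x C n β δ → ∃ M : ℝ → ℝ, Continuous M ∧
      (∀ θ ∈ Set.Icc η m, ‖kernelIntegrand d x (1 - k / n) n β δ
        (-((c / n : ℝ) : ℂ) + θ * (a + Complex.I))‖ ≤ M θ) ∧
      (∀ θ ∈ Set.Icc m Real.pi, ‖kernelIntegrand d x (1 - k / n) n β δ
        ((e : ℂ) + θ * (-a + Complex.I))‖ ≤ M θ) ∧
      ∫ θ in η..Real.pi, M θ ≤ K * (Real.sqrt n ^ d / n)

/-- For x = 0 the exponent has real part -nu, so there is decay wherever the contour lies outside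
the unit circle. It has to return to -1 within distance of order 1/n. There the singular factor
costs n^{d/2}, integration of e^{-n(π-θ)/4} gains 1/n, and ‖β‖ ≤ C/n tames the essential singularity
at -1. -/
theorem farBound_zero (d : ℕ) (k : ℝ) {c C η : ℝ} (hc : 0 < c) (hη : 0 < η)
    (hη1 : η ≤ 1) : FarBound d 0 k c C (1 / 4) η := by
  set K₀ : ℝ := (Real.sqrt (η / 3))⁻¹ ^ d * (Real.sqrt (c / 6))⁻¹ ^ d *
    Real.exp (C * (4 / (2 * (c / 6))) + C * (3 / (η / 3 * (c / 6)))) * (η / 6)⁻¹ * 3 *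
      Real.exp c with hK₀
  have hpi := Real.pi_gt_three
  have hpi4 := Real.pi_le_four
  refine ⟨K₀ * 8, ?_⟩
  have hl1 : ∀ᶠ n : ℕ in atTop, |k / n| ≤ η / 6 := by
    have : Tendsto (fun n : ℕ => |k / n|) atTop (𝓝 0) := by
      simpa using (tendsto_const_div_atTop_nhds_zero_nat k).abs
    exact this.eventually_le_const (by linarith)
  have hl2 : ∀ᶠ n : ℕ in atTop, c / n ≤ η / 8 :=
    (tendsto_const_div_atTop_nhds_zero_nat c).eventually_le_const (by linarith)
  filter_upwards [hl1, hl2, eventually_gt_atTop 0] with n hn1 hn2 hn0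
  have hn : (0 : ℝ) < n := by exact_mod_cast hn0
  have hcn : 0 < c / n := by positivity
  -- The contour is symmetric about height π/2: it starts and ends with real part -c/n.
  refine ⟨1 / 4 * Real.pi - c / n, Real.pi / 2, by linarith, by ring, by linarith, by linarith, ?_⟩
  rintro β δ ⟨-, hβ, hδ⟩
  have hβ := hβ rfl
  refine ⟨fun θ => K₀ * Real.sqrt n ^ d * (Real.exp (-(n / 4 * θ)) +
    Real.exp (-(n / 4 * (Real.pi - θ)))), by fun_prop, ?_, ?_, ?_⟩
  · intro θ hθ
    rw [point_eq]
    have hu : |1 / 4 * θ - c / n| ≤ 1 := abs_le.2 ⟨by linarith [hθ.1], by linarith [hθ.2]⟩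
    have hm : c / 6 / n ≤ ‖1 + Complex.exp (((1 / 4 * θ - c / n : ℝ) : ℂ) + θ * Complex.I)‖ := by
      have := (norm_one_add_exp_ge (θ := θ) hu (by linarith [hθ.1]) (by linarith [hθ.2])).2
      refine le_trans ?_ this
      have e : c / 6 / n = c / n / 6 := by ring
      rw [e]; linarith [hθ.2]
    have := norm_kernelIntegrand_far_le (d := d) (x := 0) (k := k) (n := n) (β := β) (δ := δ)
      (C₁ := C * (4 / (2 * (c / 6)))) (C₂ := C * (3 / (η / 3 * (c / 6))))
      (E := c / n - θ / 4) hη (by positivity) hn1 hu hθ.1 (by linarith [hθ.2]) hm ?_ ?_ ?_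
    · refine this.trans ?_
      beta_reduce
      have e1 : (Real.sqrt (c / 6 / n))⁻¹ ^ d = (Real.sqrt (c / 6))⁻¹ ^ d * Real.sqrt n ^ d := by
        rw [Real.sqrt_div (by positivity), inv_div, div_eq_inv_mul, mul_pow]
      have e2 : Real.exp (n * (c / n - θ / 4)) = Real.exp c * Real.exp (-(n / 4 * θ)) := by
        rw [← Real.exp_add]; congr 1; field_simp; ring
      rw [e1, e2, hK₀]
      have : 0 ≤ Real.exp (-(n / 4 * (Real.pi - θ))) := (Real.exp_pos _).le
      calc _ = (Real.sqrt (η / 3))⁻¹ ^ d * (Real.sqrt (c / 6))⁻¹ ^ d *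
            Real.exp (C * (4 / (2 * (c / 6))) + C * (3 / (η / 3 * (c / 6)))) * (η / 6)⁻¹ * 3 *
            Real.exp c * Real.sqrt n ^ d * (Real.exp (-(n / 4 * θ)) + 0) := by ring
        _ ≤ _ := by gcongr
    · calc ‖β‖ * (4 / (2 * (c / 6 / n))) ≤ C / n * (4 / (2 * (c / 6 / n))) := by gcongr
        _ = _ := by field_simp
    · calc ‖δ‖ * (3 / (η / 3 * (c / 6 / n))) ≤ C / n * (3 / (η / 3 * (c / 6 / n))) := by gcongr
        _ = _ := by field_simp
    · simp; linarith
  · intro θ hθ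
    have hpt : (((1 / 4 * Real.pi - c / n : ℝ) : ℂ)) + θ * (-((1 / 4 : ℝ) : ℂ) + Complex.I) =
      (((1 / 4 * Real.pi - c / n) - 1 / 4 * θ : ℝ) : ℂ) + θ * Complex.I := point_eq' _ _ _
    rw [hpt]
    have hu : |(1 / 4 * Real.pi - c / n) - 1 / 4 * θ| ≤ 1 :=
      abs_le.2 ⟨by linarith [hθ.2], by linarith [hθ.1]⟩
    have hm : c / 6 / n ≤
        ‖1 + Complex.exp ((((1 / 4 * Real.pi - c / n) - 1 / 4 * θ : ℝ) : ℂ) + θ * Complex.I)‖ := by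
      obtain ⟨g1, g2⟩ := norm_one_add_exp_ge hu (by linarith [hθ.1]) hθ.2
      have e : c / 6 / n = c / n / 6 := by ring
      rw [e]
      have := neg_abs_le ((1 / 4 * Real.pi - c / n) - 1 / 4 * θ)
      -- Within c/(2n) of height π the real part keeps |1 + σ| of size c/n; otherwise the height
      -- does.
      rcases le_total (Real.pi - θ) (c / n / 2) with h | h <;> linarith [hθ.2]
    have := norm_kernelIntegrand_far_le (d := d) (x := 0) (k := k) (n := n) (β := β) (δ := δ)
      (C₁ := C * (4 / (2 * (c / 6)))) (C₂ := C * (3 / (η / 3 * (c / 6))))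
      (E := c / n - (Real.pi - θ) / 4) hη (by positivity) hn1 hu (by linarith [hθ.1]) hθ.2 hm ?_ ?_ ?_
    · refine this.trans ?_
      beta_reduce
      have e1 : (Real.sqrt (c / 6 / n))⁻¹ ^ d = (Real.sqrt (c / 6))⁻¹ ^ d * Real.sqrt n ^ d := by
        rw [Real.sqrt_div (by positivity), inv_div, div_eq_inv_mul, mul_pow]
      have e2 : Real.exp (n * (c / n - (Real.pi - θ) / 4)) =
          Real.exp c * Real.exp (-(n / 4 * (Real.pi - θ))) := by
        rw [← Real.exp_add]; congr 1; field_simp; ring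
      rw [e1, e2, hK₀]
      have : 0 ≤ Real.exp (-(n / 4 * θ)) := (Real.exp_pos _).le
      calc _ = (Real.sqrt (η / 3))⁻¹ ^ d * (Real.sqrt (c / 6))⁻¹ ^ d *
            Real.exp (C * (4 / (2 * (c / 6))) + C * (3 / (η / 3 * (c / 6)))) * (η / 6)⁻¹ * 3 *
            Real.exp c * Real.sqrt n ^ d * (0 + Real.exp (-(n / 4 * (Real.pi - θ)))) := by ring
        _ ≤ _ := by gcongr
    · calc ‖β‖ * (4 / (2 * (c / 6 / n))) ≤ C / n * (4 / (2 * (c / 6 / n))) := by gcongr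
        _ = _ := by field_simp
    · calc ‖δ‖ * (3 / (η / 3 * (c / 6 / n))) ≤ C / n * (3 / (η / 3 * (c / 6 / n))) := by gcongr
        _ = _ := by field_simp
    · simp; linarith
  · rw [intervalIntegral.integral_const_mul, intervalIntegral.integral_add
      (Continuous.intervalIntegrable (by fun_prop) _ _)
      (Continuous.intervalIntegrable (by fun_prop) _ _)]
    have i1 := integral_exp_neg_mul_le (s := n / 4) (q := Real.pi) (by positivity) hη.le
    have i2 : ∫ θ in η..Real.pi, Real.exp (-(n / 4 * (Real.pi - θ))) ≤ 1 / (n / 4) := by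
      rw [intervalIntegral.integral_comp_sub_left (fun t => Real.exp (-(n / 4 * t)))]
      exact integral_exp_neg_mul_le (by positivity) (by linarith)
    have hK0 : 0 ≤ K₀ * Real.sqrt n ^ d := by positivity
    calc _ ≤ K₀ * Real.sqrt n ^ d * (1 / (n / 4) + 1 / (n / 4)) := by gcongr
      _ = _ := by field_simp; ring

-- For x > 0 the contour crosses the unit circle at the saddle, strictly between 1 and -1, and stays
-- at a fixed distance from -1. Near the saddle the real part u of ζ and the gap cos θ - cos θ₀ are
-- both comparable to θ - θ₀, so the exponent decays quadratically and a Gaussian integral bounds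
-- this part.
set_option maxHeartbeats 400000 in
theorem farBound_pos {d : ℕ} (hd : 0 < d) {x : ℝ} (hx0 : 0 < x) (hx2 : x < 2) (k : ℝ) {c C : ℝ}
    (hc : 0 < c) (hC : 0 ≤ C) : ∃ a η₀ : ℝ, 0 < a ∧ a ≤ 1 / 4 ∧ 0 < η₀ ∧
      ∀ η, 0 < η → η ≤ η₀ → FarBound d x k c C a η := by
  have hpi := Real.pi_gt_three
  have hpi4 := Real.pi_le_four
  have hx4 : x ^ 2 < 4 := by nlinarith
  -- The saddle condition x² = 2(1 + cos θ₀); 0 < x < 2 places θ₀ strictly inside (0, π).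
  set c₀ : ℝ := x ^ 2 / 2 - 1 with hc₀
  have hc1 : -1 < c₀ := by have := pow_pos hx0 2; linarith
  have hc2 : c₀ < 1 := by linarith
  set θ₀ := Real.arccos c₀ with hθ₀
  have hcos : Real.cos θ₀ = c₀ := Real.cos_arccos hc1.le hc2.le
  have ht0 : 0 < θ₀ := Real.arccos_pos.2 hc2
  have htpi : θ₀ < Real.pi := by
    rw [hθ₀, Real.arccos]
    have := Real.neg_pi_div_two_lt_arcsin.2 hc1
    linarith
  have hx2' : x ^ 2 = 2 * (1 + Real.cos θ₀) := by rw [hcos, hc₀]; ring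
  obtain ⟨m₀, hm₀, hm1, hm2, hm3⟩ : ∃ m₀ : ℝ, 0 < m₀ ∧ m₀ ≤ Real.sin (θ₀ / 2) ∧
      m₀ ≤ Real.cos (θ₀ / 2) ∧ m₀ ≤ 1 := by
    refine ⟨min (Real.sin (θ₀ / 2)) (Real.cos (θ₀ / 2)), lt_min ?_ ?_, min_le_left _ _,
      min_le_right _ _, (min_le_left _ _).trans (Real.sin_le_one _)⟩
    · exact Real.sin_pos_of_pos_of_lt_pi (by linarith) (by linarith)
    · exact Real.cos_pos_of_mem_Ioo ⟨by linarith, by linarith⟩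
  -- With a ≤ m₀/π, the error v² in `exponent_le_of_nonpos` uses at most half of the lower bound
  -- 2m₀(θ - θ₀)/π for the cosine gap.
  obtain ⟨a, ha0, ha4, ham⟩ : ∃ a : ℝ, 0 < a ∧ a ≤ 1 / 4 ∧ a ≤ m₀ / Real.pi :=
    ⟨min (1 / 4) (m₀ / Real.pi), lt_min (by norm_num) (by positivity), min_le_left _ _,
      min_le_right _ _⟩
  refine ⟨a, θ₀ / 4, ha0, ha4, by linarith, fun η hη0 hη1 => ?_⟩
  set m₂ : ℝ := a * (Real.pi - θ₀) / 6 with hm₂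
  have hm₂0 : 0 < m₂ := by
    have : 0 < Real.pi - θ₀ := by linarith
    positivity
  -- Before the saddle u ≥ aη(θ₀ - θ)/(2π), the cosine gap is at least 2m₀(θ₀ - θ)/π, and the
  -- denominator cosh u + cos θ is at most 3.
  set c₃ : ℝ := a * η * m₀ / (3 * Real.pi ^ 2) with hc₃
  have hc₃0 : 0 < c₃ := by positivity
  set K₀ : ℝ := (Real.sqrt (η / 3))⁻¹ ^ d * (Real.sqrt m₂)⁻¹ ^ d *
    Real.exp (C * (4 / (2 * m₂)) + C * (3 / (η / 3 * m₂))) * (η / 6)⁻¹ * 3 with hK₀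
  have hK₀0 : 0 ≤ K₀ := by positivity
  refine ⟨K₀ * Real.sqrt (Real.pi / c₃), ?_⟩
  have hl1 : ∀ᶠ n : ℕ in atTop, |k / n| ≤ η / 6 := by
    have : Tendsto (fun n : ℕ => |k / n|) atTop (𝓝 0) := by
      simpa using (tendsto_const_div_atTop_nhds_zero_nat k).abs
    exact this.eventually_le_const (by linarith)
  have hl2 : ∀ᶠ n : ℕ in atTop, c / n ≤ a * η / 2 :=
    (tendsto_const_div_atTop_nhds_zero_nat c).eventually_le_const (by positivity)
  filter_upwards [hl1, hl2, eventually_gt_atTop 0] with n hn1 hn2 hn0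
  have hn : (1 : ℝ) ≤ n := by exact_mod_cast hn0
  have hcn : 0 < c / n := by positivity
  have haη : a * η ≤ a * (θ₀ / 4) := mul_le_mul_of_nonneg_left hη1 ha0.le
  have hmid1 : (a * θ₀ + c / n) / (2 * a) ≤ θ₀ := by
    rw [div_le_iff₀ (by positivity)]; linarith [mul_pos ha0 ht0]
  have hmid2 : θ₀ / 2 ≤ (a * θ₀ + c / n) / (2 * a) := by
    rw [le_div_iff₀ (by positivity)]; linarith [mul_pos ha0 ht0]
  have hlt : a * θ₀ < a * Real.pi := mul_lt_mul_of_pos_left htpi ha0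
  -- The descending line aθ₀ - aθ meets the imaginary axis at height θ₀; the second witness is the
  -- height at which it meets the ascending line aθ - c/n.
  refine ⟨a * θ₀, (a * θ₀ + c / n) / (2 * a), hlt, by field_simp; ring, by linarith,
    by linarith, ?_⟩
  rintro β δ ⟨hβ, -, hδ⟩
  have hδ' : ‖δ‖ ≤ C := hδ.trans (div_le_self hC hn)
  -- the bound at a point of the contour
  have key : ∀ u θ : ℝ, |u| ≤ 1 → η ≤ θ → θ ≤ Real.pi →
      m₂ ≤ ‖1 + Complex.exp (u + θ * Complex.I)‖ →
      x ^ 2 * (Real.sinh u / (2 * (Real.cosh u + Real.cos θ))) - u ≤ -(c₃ * (θ - θ₀) ^ 2) →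
      ‖kernelIntegrand d x (1 - k / n) n β δ (u + θ * Complex.I)‖ ≤
        K₀ * Real.exp (-(n * c₃ * (θ - θ₀) ^ 2)) := by
    intro u θ hu h1 h2 hm hE
    have := norm_kernelIntegrand_far_le (d := d) (x := x) (k := k) (n := n) (β := β) (δ := δ)
      (C₁ := C * (4 / (2 * m₂))) (C₂ := C * (3 / (η / 3 * m₂))) hη0 hm₂0 hn1 hu h1 h2 hm
      (by gcongr) (by gcongr) hE
    have e : (n : ℝ) * -(c₃ * (θ - θ₀) ^ 2) = -(n * c₃ * (θ - θ₀) ^ 2) := by ring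
    rwa [e] at this
  have hD3 : ∀ u θ : ℝ, |u| ≤ 1 → Real.cosh u + Real.cos θ ≤ 3 := by
    intro u θ hu
    have := cosh_sub_one_le hu
    have h2 : u ^ 2 ≤ 1 := by rw [← sq_abs]; nlinarith [abs_nonneg u]
    linarith [Real.cos_le_one θ]
  -- before the saddle point
  have hleft : ∀ u θ : ℝ, η ≤ θ → θ ≤ θ₀ → u ≤ 1 → a * η / (2 * Real.pi) * (θ₀ - θ) ≤ u →
      ‖kernelIntegrand d x (1 - k / n) n β δ (u + θ * Complex.I)‖ ≤
        K₀ * Real.exp (-(n * c₃ * (θ - θ₀) ^ 2)) := by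
    intro u θ h1 h2 hu1 hu2
    have hu0 : 0 ≤ u := le_trans (mul_nonneg (by positivity) (by linarith)) hu2
    have hu : |u| ≤ 1 := abs_le.2 ⟨by linarith, hu1⟩
    have hm : m₂ ≤ ‖1 + Complex.exp (u + θ * Complex.I)‖ := by
      have := (norm_one_add_exp_ge hu (by linarith : 0 ≤ θ) (by linarith)).2
      have g : a * (Real.pi - θ₀) ≤ 1 / 4 * (Real.pi - θ₀) :=
        mul_le_mul_of_nonneg_right ha4 (by linarith)
      rw [hm₂]; linarith
    have hD := cosh_add_cos_pos hm₂0 hm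
    refine key u θ hu h1 (by linarith) hm ?_
    rw [hx2']
    refine (exponent_le_of_nonneg hu0 (by linarith) (by linarith) hD).trans ?_
    rw [neg_div, neg_le_neg_iff, le_div_iff₀ hD]
    have g1 := (cos_sub_cos_ge ht0 htpi hm1 hm2 (by linarith : 0 ≤ θ) (by linarith)).1 h2
    have g2 : 0 ≤ 2 * m₀ / Real.pi * (θ₀ - θ) := mul_nonneg (by positivity) (by linarith)
    calc c₃ * (θ - θ₀) ^ 2 * (Real.cosh u + Real.cos θ) ≤ c₃ * (θ - θ₀) ^ 2 * 3 := by
          gcongr; exact hD3 u θ hu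
      _ = (a * η / (2 * Real.pi) * (θ₀ - θ)) * (2 * m₀ / Real.pi * (θ₀ - θ)) := by
          rw [hc₃]; field_simp; ring
      _ ≤ _ := by gcongr
  refine ⟨fun θ => K₀ * Real.exp (-(n * c₃ * (θ - θ₀) ^ 2)), by fun_prop, ?_, ?_, ?_⟩
  · intro θ hθ
    rw [point_eq]
    have h2 : θ ≤ θ₀ := hθ.2.trans hmid1
    have g1 : a * θ ≤ 1 / 4 * θ := mul_le_mul_of_nonneg_right ha4 (by linarith [hθ.1])
    refine hleft _ θ hθ.1 h2 (by linarith) ?_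
    have e1 : a * η / 2 ≤ a * θ - c / n := by
      linarith [mul_le_mul_of_nonneg_left hθ.1 ha0.le]
    refine le_trans ?_ e1
    calc a * η / (2 * Real.pi) * (θ₀ - θ) ≤ a * η / (2 * Real.pi) * Real.pi := by
          gcongr; linarith [hθ.1]
      _ = _ := by field_simp
  · intro θ hθ
    rw [point_eq']
    have hθη : η ≤ θ := by linarith [hθ.1]
    rcases le_total θ θ₀ with h | h
    · have g1 : a * (θ₀ - θ) ≤ 1 / 4 * (θ₀ - θ) := mul_le_mul_of_nonneg_right ha4 (by linarith)
      refine hleft _ θ hθη h (by linarith) ?_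
      have : a * η / (2 * Real.pi) ≤ a := by
        rw [div_le_iff₀ (by positivity)]
        exact mul_le_mul_of_nonneg_left (by linarith) ha0.le
      have g2 := mul_le_mul_of_nonneg_right this (sub_nonneg.2 h)
      linarith
    · set v : ℝ := a * (θ - θ₀) with hv
      have hv0 : 0 ≤ v := mul_nonneg ha0.le (by linarith)
      have hv1 : v ≤ 1 := by
        have : a * (θ - θ₀) ≤ 1 / 4 * (θ - θ₀) := mul_le_mul_of_nonneg_right ha4 (by linarith)
        rw [hv]; linarith [hθ.2]
      have e1 : a * θ₀ - a * θ = -v := by rw [hv]; ring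
      rw [e1]
      have hu : |(-v)| ≤ 1 := by rw [abs_neg, abs_of_nonneg hv0]; exact hv1
      have hm : m₂ ≤ ‖1 + Complex.exp (((-v : ℝ) : ℂ) + θ * Complex.I)‖ := by
        obtain ⟨g1, g2⟩ := norm_one_add_exp_ge hu (by linarith : 0 ≤ θ) hθ.2
        rw [abs_neg, abs_of_nonneg hv0] at g1
        rw [hm₂]
        rcases le_total θ ((Real.pi + θ₀) / 2) with h' | h'
        · have g : a * (Real.pi - θ₀) ≤ 1 / 4 * (Real.pi - θ₀) :=
            mul_le_mul_of_nonneg_right ha4 (by linarith)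
          linarith
        · have g : a * ((Real.pi - θ₀) / 2) ≤ a * (θ - θ₀) :=
            mul_le_mul_of_nonneg_left (by linarith) ha0.le
          rw [hv] at g1; linarith
      have hD := cosh_add_cos_pos hm₂0 hm
      rw [Real.cosh_neg] at hD
      refine key (-v) θ hu hθη hθ.2 hm ?_
      rw [hx2']
      refine (exponent_le_of_nonpos hv0 hv1 (by linarith) hD).trans ?_
      rw [div_le_iff₀ hD]
      have g1 := (cos_sub_cos_ge ht0 htpi hm1 hm2 (by linarith : 0 ≤ θ) hθ.2).2 h
      have hy : 0 ≤ θ - θ₀ := by linarith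
      have hy4 : θ - θ₀ ≤ Real.pi := by linarith [hθ.2]
      have g2 : v ^ 2 ≤ m₀ / Real.pi * (θ - θ₀) := by
        rw [hv]
        have : a * (θ - θ₀) ≤ 1 := hv1
        calc (a * (θ - θ₀)) ^ 2 = (a * (θ - θ₀)) * (a * (θ - θ₀)) := by ring
          _ ≤ 1 * (m₀ / Real.pi * (θ - θ₀)) := by gcongr
          _ = _ := by ring
      have g3 : v * (v ^ 2 - (Real.cos θ₀ - Real.cos θ)) ≤ v * (-(m₀ / Real.pi * (θ - θ₀))) := by
        refine mul_le_mul_of_nonneg_left ?_ hv0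
        have : 2 * m₀ / Real.pi * (θ - θ₀) = 2 * (m₀ / Real.pi * (θ - θ₀)) := by ring
        linarith
      refine g3.trans ?_
      have g4 : c₃ * (θ - θ₀) ^ 2 * (Real.cosh v + Real.cos θ) ≤ c₃ * (θ - θ₀) ^ 2 * 3 := by
        gcongr
        exact hD3 v θ (by rw [abs_of_nonneg hv0]; exact hv1)
      have g5 : c₃ * (θ - θ₀) ^ 2 * 3 ≤ v * (m₀ / Real.pi * (θ - θ₀)) := by
        have : c₃ * 3 ≤ a * (m₀ / Real.pi) := by
          have e2 : c₃ * 3 = a * (m₀ / Real.pi) * (η / Real.pi) := by rw [hc₃]; field_simp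
          rw [e2]
          refine mul_le_of_le_one_right (by positivity) ?_
          rw [div_le_one (by positivity)]; linarith
        calc c₃ * (θ - θ₀) ^ 2 * 3 = (c₃ * 3) * (θ - θ₀) ^ 2 := by ring
          _ ≤ (a * (m₀ / Real.pi)) * (θ - θ₀) ^ 2 := by gcongr
          _ = _ := by rw [hv]; ring
      linarith
  · rw [intervalIntegral.integral_const_mul]
    have i1 := integral_gaussian_le (s := n * c₃) (by positivity) θ₀
      (show η ≤ Real.pi by linarith)
    have hs : 1 ≤ Real.sqrt n := Real.one_le_sqrt.2 hn
    have e1 : Real.sqrt (Real.pi / (n * c₃)) = Real.sqrt (Real.pi / c₃) * (1 / Real.sqrt n) := by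
      rw [mul_comm (n : ℝ), ← div_div, Real.sqrt_div (by positivity)]; ring
    -- Here d ≥ 1 is decisive: the saddle contribution n^{-1/2} is no larger than n^{d/2-1}, of
    -- equal order when d = 1.
    have e2 : 1 / Real.sqrt n ≤ Real.sqrt n ^ d / n := by
      have : Real.sqrt n ≤ Real.sqrt n ^ d := le_self_pow₀ hs hd.ne'
      rw [← Real.sqrt_div_self']
      gcongr
    calc K₀ * ∫ θ in η..Real.pi, Real.exp (-(n * c₃ * (θ - θ₀) ^ 2))
        ≤ K₀ * (Real.sqrt (Real.pi / c₃) * (1 / Real.sqrt n)) := by rw [← e1]; gcongr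
      _ ≤ K₀ * (Real.sqrt (Real.pi / c₃) * (Real.sqrt n ^ d / n)) := by gcongr
      _ = _ := by ring

/-! ### The model integrand and the comparison near σ = 1 -/

/-- The integrand of the model contour integral, singular at `σ = 1` only. -/
def modelIntegrand (d : ℕ) (τ : ℝ) (n N : ℕ) (δ ζ : ℂ) : ℂ :=
  ((1 - Complex.exp ζ) ^ (-1 / 2 : ℂ)) ^ d * ((2 : ℂ) ^ (-1 / 2 : ℂ)) ^ d *
    Complex.exp (δ / n / (2 * (1 - Complex.exp ζ))) *
    (τ - Complex.exp ζ)⁻¹ * Complex.exp ζ * Complex.exp (-(N * ζ))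

/-- The effective truncation level `n - ⌊n x² / 4⌋`. -/
def effLevel (x : ℝ) (n : ℕ) : ℕ := n - ⌊(n : ℝ) * (x ^ 2 / 4)⌋₊

theorem floor_le_self {x : ℝ} (hx0 : 0 ≤ x) (hx2 : x < 2) (n : ℕ) :
    ⌊(n : ℝ) * (x ^ 2 / 4)⌋₊ ≤ n := by
  refine Nat.floor_le_of_le ?_
  have : x ^ 2 / 4 ≤ 1 := by nlinarith
  exact mul_le_of_le_one_right (Nat.cast_nonneg n) this

theorem effLevel_cast {x : ℝ} (hx0 : 0 ≤ x) (hx2 : x < 2) (n : ℕ) :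
    (effLevel x n : ℝ) = n - (⌊(n : ℝ) * (x ^ 2 / 4)⌋₊ : ℝ) := by
  rw [effLevel, Nat.cast_sub (floor_le_self hx0 hx2 n)]

/-- The level is rounded to an integer so that the model integrand is 2πi-periodic in ζ and its
integral is a Taylor coefficient. The rounding changes the exponent only by a multiple of ζ bounded
by one. -/
theorem le_effLevel {x : ℝ} (hx0 : 0 ≤ x) (hx2 : x < 2) (n : ℕ) :
    (1 - x ^ 2 / 4) * n ≤ effLevel x n := by
  rw [effLevel_cast hx0 hx2]
  have := Nat.floor_le (a := (n : ℝ) * (x ^ 2 / 4)) (by positivity)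
  linarith

theorem effLevel_le {x : ℝ} (hx0 : 0 ≤ x) (hx2 : x < 2) (n : ℕ) :
    (effLevel x n : ℝ) ≤ (1 - x ^ 2 / 4) * n + 1 := by
  rw [effLevel_cast hx0 hx2]
  have := Nat.lt_floor_add_one ((n : ℝ) * (x ^ 2 / 4))
  linarith

theorem effLevel_le_self (x : ℝ) (n : ℕ) : effLevel x n ≤ n := Nat.sub_le _ _

theorem norm_exp_sub_exp_le {p q : ℂ} {R : ℝ} (hp : p.re ≤ R) (hq : q.re ≤ R) :
    ‖Complex.exp p - Complex.exp q‖ ≤ Real.exp R * ‖p - q‖ := by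
  refine (convex_halfSpace_re_le R).norm_image_sub_le_of_norm_deriv_le
    (fun z _ => Complex.differentiableAt_exp) (fun z hz => ?_) hq hp
  rw [Complex.deriv_exp, Complex.norm_exp]
  exact Real.exp_le_exp.2 hz

/-- Linearisation of tanh(ζ/2)/2 at 0: its slope 1/4 is the source of the effective level n(1 -
x²/4). -/
theorem cayley_exp_bounds {ζ : ℂ} (h : ‖ζ‖ ≤ 1 / 4) :
    ‖(Complex.exp ζ - 1) / (2 * (1 + Complex.exp ζ))‖ ≤ ‖ζ‖ ∧
    ‖(Complex.exp ζ - 1) / (2 * (1 + Complex.exp ζ)) - ζ / 4‖ ≤ ‖ζ‖ ^ 2 ∧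
    1 ≤ ‖1 + Complex.exp ζ‖ := by
  have h1 := Complex.norm_exp_sub_one_le (x := ζ) (by linarith)
  have h2 := Complex.norm_exp_sub_one_sub_id_le (x := ζ) (by linarith)
  set σ := Complex.exp ζ
  have h3 : 1 ≤ ‖1 + σ‖ := by
    have : (2 : ℂ) = (1 + σ) - (σ - 1) := by ring
    have h4 := norm_sub_le (1 + σ) (σ - 1)
    rw [← this, Complex.norm_ofNat] at h4
    linarith
  have h0 : 1 + σ ≠ 0 := norm_pos_iff.1 (by linarith)
  refine ⟨?_, ?_, h3⟩
  · rw [norm_div, norm_mul, Complex.norm_ofNat, div_le_iff₀ (by positivity)]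
    nlinarith [norm_nonneg ζ]
  · have e : (σ - 1) / (2 * (1 + σ)) - ζ / 4 =
        (2 * (σ - 1 - ζ) - ζ * (σ - 1)) / (4 * (1 + σ)) := by field_simp; ring
    rw [e, norm_div, norm_mul, Complex.norm_ofNat, div_le_iff₀ (by positivity)]
    calc ‖2 * (σ - 1 - ζ) - ζ * (σ - 1)‖ ≤ ‖2 * (σ - 1 - ζ)‖ + ‖ζ * (σ - 1)‖ := norm_sub_le _ _
      _ = 2 * ‖σ - 1 - ζ‖ + ‖ζ‖ * ‖σ - 1‖ := by rw [norm_mul, norm_mul, Complex.norm_ofNat]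
      _ ≤ 2 * ‖ζ‖ ^ 2 + ‖ζ‖ * (2 * ‖ζ‖) := by gcongr
      _ = ‖ζ‖ ^ 2 * (4 * 1) := by ring
      _ ≤ ‖ζ‖ ^ 2 * (4 * ‖1 + σ‖) := by gcongr

theorem exists_cpow_local_bound (d : ℕ) : ∃ r L : ℝ, 0 < r ∧ 0 ≤ L ∧ ∀ ζ : ℂ, ‖ζ‖ ≤ r →
    ‖((1 + Complex.exp ζ) ^ (-1 / 2 : ℂ)) ^ d - ((2 : ℂ) ^ (-1 / 2 : ℂ)) ^ d‖ ≤ L * ‖ζ‖ := by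
  have hd : DifferentiableAt ℂ (fun ζ : ℂ => ((1 + Complex.exp ζ) ^ (-1 / 2 : ℂ)) ^ d) 0 := by
    refine DifferentiableAt.pow (DifferentiableAt.cpow (by fun_prop) (by fun_prop) ?_) d
    left; simp
  have hO := hd.isBigO_sub
  obtain ⟨L, hL, hb⟩ := hO.exists_pos
  rw [Asymptotics.isBigOWith_iff, Metric.eventually_nhds_iff] at hb
  obtain ⟨r, hr, hb⟩ := hb
  refine ⟨r / 2, L, by positivity, hL.le, fun ζ hζ => ?_⟩
  have := hb (y := ζ) (by rw [dist_zero_right]; linarith)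
  simp only [Complex.exp_zero, sub_zero] at this
  norm_num at this
  norm_num
  exact this

/-- Half of the exponential decay is spent on the factor (1 + y)² lost in the Taylor errors, with y
= nθ. -/
theorem one_add_sq_mul_exp_le {μ y : ℝ} (hμ : 0 < μ) (hy : 0 ≤ y) :
    (1 + y) ^ 2 * Real.exp (-(2 * μ * y)) ≤ (2 + 4 / μ ^ 2) * Real.exp (-(μ * y)) := by
  have h1 : Real.exp (-(2 * μ * y)) = Real.exp (-(μ * y)) * Real.exp (-(μ * y)) := by
    rw [← Real.exp_add]; ring_nf
  have h2 : (1 + y) ^ 2 ≤ (2 + 4 / μ ^ 2) * Real.exp (μ * y) := by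
    have e1 := Real.quadratic_le_exp_of_nonneg (x := μ * y) (by positivity)
    have e2 : y ^ 2 = 2 / μ ^ 2 * ((μ * y) ^ 2 / 2) := by field_simp
    have e3 : (μ * y) ^ 2 / 2 ≤ Real.exp (μ * y) := by nlinarith [mul_nonneg hμ.le hy]
    have e4 : 1 ≤ Real.exp (μ * y) := Real.one_le_exp (by positivity)
    have e5 : y ^ 2 ≤ 2 / μ ^ 2 * Real.exp (μ * y) := by rw [e2]; gcongr
    have e6 : (2 + 4 / μ ^ 2) * Real.exp (μ * y) =
      2 * Real.exp (μ * y) + 2 * (2 / μ ^ 2 * Real.exp (μ * y)) := by ring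
    rw [e6]; nlinarith [sq_nonneg (1 - y)]
  have h3 : Real.exp (μ * y) * Real.exp (-(μ * y)) = 1 := by rw [← Real.exp_add]; simp
  rw [h1]
  calc (1 + y) ^ 2 * (Real.exp (-(μ * y)) * Real.exp (-(μ * y)))
      ≤ ((2 + 4 / μ ^ 2) * Real.exp (μ * y)) * (Real.exp (-(μ * y)) * Real.exp (-(μ * y))) := by
        gcongr
    _ = (2 + 4 / μ ^ 2) * (Real.exp (μ * y) * Real.exp (-(μ * y))) * Real.exp (-(μ * y)) := by ring
    _ = _ := by rw [h3, mul_one]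

/-- Lower bounds along the slanted line through `-c`. -/
theorem norm_one_sub_exp_slant_ge {a θ c : ℝ} (ha0 : 0 ≤ a) (ha : a ≤ 1 / 4) (hc : 0 ≤ c)
    (hc1 : c ≤ 1) (h0 : 0 ≤ θ) (hθ : θ ≤ Real.pi) :
    c / 5 ≤ ‖1 - Complex.exp (((a * θ - c : ℝ) : ℂ) + θ * Complex.I)‖ := by
  have h1 : a * θ ≤ 1 / 4 * θ := mul_le_mul_of_nonneg_right ha h0
  have h2 : 0 ≤ a * θ := mul_nonneg ha0 h0
  have hu : |a * θ - c| ≤ 1 := abs_le.2 ⟨by linarith, by linarith [Real.pi_le_four]⟩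
  obtain ⟨g1, g2⟩ := norm_one_sub_exp_ge hu h0 hθ
  have := neg_abs_le (a * θ - c)
  linarith

theorem norm_sub_exp_ge {k m : ℝ} {n : ℕ} {σ : ℂ} (h : m ≤ ‖1 - σ‖) (hk : |k / n| ≤ m / 2) :
    m / 2 ≤ ‖((1 - k / n : ℝ) : ℂ) - σ‖ := by
  have e : 1 - σ = (((1 - k / n : ℝ) : ℂ) - σ) + ((k / n : ℝ) : ℂ) := by push_cast; ring
  rw [e] at h
  have := h.trans (norm_add_le _ _)
  rw [Complex.norm_real, Real.norm_eq_abs] at this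
  linarith

/-- The common factor of the kernel and model integrands. -/
theorem norm_commonFactor_le {d n : ℕ} {τ m M : ℝ} {δ σ : ℂ} (hn : 0 < n) (hm : 0 < m)
    (h1 : m / n ≤ ‖1 - σ‖) (h2 : m / n / 2 ≤ ‖(τ : ℂ) - σ‖) (h3 : ‖σ‖ ≤ M) :
    ‖((1 - σ) ^ (-1 / 2 : ℂ)) ^ d * Complex.exp (δ / n / (2 * (1 - σ))) * (τ - σ)⁻¹ * σ‖ ≤
      (Real.sqrt m)⁻¹ ^ d * Real.exp (‖δ‖ / (2 * m)) * (2 / m) * M * (Real.sqrt n ^ d * n) := by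
  have hn' : (0 : ℝ) < n := by exact_mod_cast hn
  have e1 : ‖(1 - σ) ^ (-1 / 2 : ℂ)‖ ^ d ≤ (Real.sqrt m)⁻¹ ^ d * Real.sqrt n ^ d := by
    have : ‖(1 - σ) ^ (-1 / 2 : ℂ)‖ ≤ (Real.sqrt m)⁻¹ * Real.sqrt n :=
      (norm_cpow_neg_half_le (by positivity) h1).trans_eq (by
        rw [Real.sqrt_div hm.le, inv_div, div_eq_inv_mul])
    rw [← mul_pow]
    gcongr
  have e2 : ‖Complex.exp (δ / n / (2 * (1 - σ)))‖ ≤ Real.exp (‖δ‖ / (2 * m)) := by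
    rw [Complex.norm_exp]
    refine Real.exp_le_exp.2 ((Complex.re_le_norm _).trans ?_)
    rw [norm_div, norm_div, norm_mul, Complex.norm_natCast, Complex.norm_ofNat]
    calc ‖δ‖ / n / (2 * ‖1 - σ‖) ≤ ‖δ‖ / n / (2 * (m / n)) := by gcongr
      _ = _ := by field_simp
  have e3 : ‖(τ : ℂ) - σ‖⁻¹ ≤ 2 / m * n := by
    have := inv_anti₀ (by positivity) h2
    refine this.trans (le_of_eq ?_)
    field_simp
  rw [norm_mul, norm_mul, norm_mul, norm_pow, norm_inv]
  calc _ ≤ ((Real.sqrt m)⁻¹ ^ d * Real.sqrt n ^ d) * Real.exp (‖δ‖ / (2 * m)) * (2 / m * n) * M := by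
        gcongr
    _ = _ := by ring

theorem abs_effLevel_sub_le {x : ℝ} (hx0 : 0 ≤ x) (hx2 : x < 2) (n : ℕ) :
    |(effLevel x n : ℝ) - n + n * x ^ 2 / 4| ≤ 1 := by
  have g1 := le_effLevel hx0 hx2 n
  have g2 := effLevel_le hx0 hx2 n
  rw [abs_le]
  constructor <;> linarith

/-- Partial fractions, σ/(1-σ²) = 1/(2(1-σ)) - 1/(2(1+σ)), isolate the part of δ that is singular at
1. Once the common singular factor is taken out, only differences that are regular or of lower order
remain. -/
theorem kernelIntegrand_sub_modelIntegrand {d n N : ℕ} {x τ : ℝ} {β δ δ₀ ζ : ℂ}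
    (h1 : 1 - Complex.exp ζ ≠ 0) (h2 : 1 + Complex.exp ζ ≠ 0) :
    ∃ p : ℂ, kernelIntegrand d x τ n β δ ζ - modelIntegrand d τ n N δ₀ ζ =
      (((1 - Complex.exp ζ) ^ (-1 / 2 : ℂ)) ^ d *
        Complex.exp (δ₀ / n / (2 * (1 - Complex.exp ζ))) * (τ - Complex.exp ζ)⁻¹ *
          Complex.exp ζ) *
      ((((1 + Complex.exp ζ) ^ (-1 / 2 : ℂ)) ^ d - ((2 : ℂ) ^ (-1 / 2 : ℂ)) ^ d) * Complex.exp p +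
        ((2 : ℂ) ^ (-1 / 2 : ℂ)) ^ d * (Complex.exp p - Complex.exp (-(N * ζ)))) ∧
      p - -(N * ζ) = β * ((Complex.exp ζ - 1) / (2 * (1 + Complex.exp ζ))) +
        (δ - δ₀ / n) / (2 * (1 - Complex.exp ζ)) - δ / (2 * (1 + Complex.exp ζ)) +
        n * (x : ℂ) ^ 2 * ((Complex.exp ζ - 1) / (2 * (1 + Complex.exp ζ)) - ζ / 4) +
        (N - n + n * (x : ℂ) ^ 2 / 4) * ζ := by
  set σ := Complex.exp ζ with hσ
  set w := (σ - 1) / (2 * (1 + σ)) with hw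
  refine ⟨β * w + (δ - δ₀ / n) / (2 * (1 - σ)) - δ / (2 * (1 + σ)) +
    n * ((x : ℂ) ^ 2 * w - ζ), ?_, by ring⟩
  have e1 : β * w + δ * (σ / (1 - σ ^ 2)) =
      δ₀ / n / (2 * (1 - σ)) + (β * w + (δ - δ₀ / n) / (2 * (1 - σ)) - δ / (2 * (1 + σ))) := by
    have : 1 - σ ^ 2 = (1 - σ) * (1 + σ) := by ring
    have h3 : σ / (1 - σ ^ 2) = 1 / (2 * (1 - σ)) - 1 / (2 * (1 + σ)) := by
      rw [this]; field_simp; ring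
    rw [h3]; ring
  rw [kernelIntegrand, modelIntegrand, ← hσ, ← hw, e1, Complex.exp_add (δ₀ / n / _),
    Complex.exp_add (_ - _)]
  ring

/-- Size of the difference of the two exponents. -/
theorem norm_exponent_sub_le {x c C : ℝ} {n : ℕ} {β δ δ₀ ζ s : ℂ} (hx0 : 0 ≤ x) (hx2 : x < 2)
    (hx4 : x ^ 2 ≤ 4) (hn : 1 ≤ (n : ℝ)) (hc0 : 0 < c) (hC : 0 ≤ C) (hβ : ‖β‖ ≤ C)
    (hδ : ‖δ‖ ≤ C / n) (hδδ : ‖δ - δ₀ / n‖ ≤ C / n ^ 2) (hζ4 : ‖ζ‖ ≤ 1 / 4)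
    (b5 : c / n / 5 ≤ ‖1 - Complex.exp ζ‖)
    (hs : s = β * ((Complex.exp ζ - 1) / (2 * (1 + Complex.exp ζ))) +
        (δ - δ₀ / n) / (2 * (1 - Complex.exp ζ)) - δ / (2 * (1 + Complex.exp ζ)) +
        n * (x : ℂ) ^ 2 * ((Complex.exp ζ - 1) / (2 * (1 + Complex.exp ζ)) - ζ / 4) +
        ((effLevel x n : ℕ) - n + n * (x : ℂ) ^ 2 / 4) * ζ) :
    ‖s‖ ≤ (C + 1) * ‖ζ‖ + (C * (5 / (2 * c)) + C) / n + 4 * n * ‖ζ‖ ^ 2 := by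
  obtain ⟨b1, b2, b3⟩ := cayley_exp_bounds hζ4
  have hn0' : (0 : ℝ) < n := by linarith
  have t1 : ‖β * ((Complex.exp ζ - 1) / (2 * (1 + Complex.exp ζ)))‖ ≤ C * ‖ζ‖ := by
    rw [norm_mul]; gcongr
  have t2 : ‖(δ - δ₀ / n) / (2 * (1 - Complex.exp ζ))‖ ≤ C * (5 / (2 * c)) / n := by
    rw [norm_div, norm_mul, Complex.norm_ofNat]
    calc ‖δ - δ₀ / n‖ / (2 * ‖1 - Complex.exp ζ‖) ≤ C / n ^ 2 / (2 * (c / n / 5)) := by gcongr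
      _ = _ := by field_simp
  have t3 : ‖δ / (2 * (1 + Complex.exp ζ))‖ ≤ C / n := by
    rw [norm_div, norm_mul, Complex.norm_ofNat]
    exact (div_le_self (norm_nonneg _) (by linarith)).trans hδ
  have t4 : ‖n * (x : ℂ) ^ 2 * ((Complex.exp ζ - 1) / (2 * (1 + Complex.exp ζ)) - ζ / 4)‖ ≤
      4 * n * ‖ζ‖ ^ 2 := by
    rw [norm_mul, norm_mul, norm_pow, Complex.norm_natCast, Complex.norm_real, Real.norm_eq_abs,
      sq_abs, mul_comm (n : ℝ)]
    gcongr
  have t5 : ‖((effLevel x n : ℕ) - n + n * (x : ℂ) ^ 2 / 4) * ζ‖ ≤ 1 * ‖ζ‖ := by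
    rw [norm_mul]
    gcongr
    have : ((effLevel x n : ℕ) - n + n * (x : ℂ) ^ 2 / 4) =
        (((effLevel x n : ℝ) - n + n * x ^ 2 / 4 : ℝ) : ℂ) := by push_cast; ring
    rw [this, Complex.norm_real, Real.norm_eq_abs]
    exact abs_effLevel_sub_le hx0 hx2 n
  rw [hs]
  refine (norm_add_le _ _).trans ?_
  refine (add_le_add ((norm_add_le _ _).trans (add_le_add ((norm_sub_le _ _).trans
    (add_le_add ((norm_add_le _ _).trans (add_le_add t1 t2)) t3)) t4)) t5).trans (le_of_eq ?_)
  ring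

theorem add_two_mul_le {c y : ℝ} (hc : 0 ≤ c) (hy : 0 ≤ y) :
    c + 2 * y ≤ (c + 2) * (1 + y) ^ 2 := by
  nlinarith [mul_nonneg hc hy, mul_nonneg hc (sq_nonneg y), sq_nonneg y]

set_option maxHeartbeats 400000 in
/-- Comparison of the kernel and model integrands on the part of the contour close to `σ = 1`. -/
theorem near_bound (d : ℕ) {x k c C a : ℝ} (hx0 : 0 ≤ x) (hx2 : x < 2) (hk : 0 < k)
    (hc : 10 * k ≤ c) (hC : 0 ≤ C) (ha0 : 0 < a) (ha : a ≤ 1 / 4) (D : ℝ) :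
    ∃ η₁ : ℝ, 0 < η₁ ∧ ∀ η, η ≤ η₁ → ∃ K μ : ℝ, 0 ≤ K ∧ 0 < μ ∧ ∀ᶠ n : ℕ in atTop,
      ∀ β δ δ₀ : ℂ, Admissible x C n β δ → ‖δ - δ₀ / n‖ ≤ C / n ^ 2 → ‖δ₀‖ ≤ D →
      ∀ θ ∈ Set.Icc 0 η, ‖kernelIntegrand d x (1 - k / n) n β δ
          (-((c / n : ℝ) : ℂ) + θ * (a + Complex.I)) -
        modelIntegrand d (1 - k / n) n (effLevel x n) δ₀
          (-((c / n : ℝ) : ℂ) + θ * (a + Complex.I))‖ ≤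
        K * Real.sqrt n ^ d * Real.exp (-(μ * n * θ)) := by
  have hc0 : 0 < c := by linarith
  obtain ⟨r, L, hr, hL, hloc⟩ := exists_cpow_local_bound d
  set lam : ℝ := 1 - x ^ 2 / 4 with hlam
  have hx4' : x ^ 2 < 4 := by nlinarith
  have hx4 : x ^ 2 ≤ 4 := hx4'.le
  have hlam0 : 0 < lam := by rw [hlam]; linarith
  set μ : ℝ := lam * a / 4 with hμ
  have hμ0 : 0 < μ := by positivity
  set L₂ : ℝ := ‖((2 : ℂ) ^ (-1 / 2 : ℂ)) ^ d‖ with hL₂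
  have hL₂0 : 0 ≤ L₂ := norm_nonneg _
  set C₁ : ℝ := C * (5 / (2 * c)) + C with hC₁
  have hC₁0 : 0 ≤ C₁ := by positivity
  set C₂ : ℝ := (C + 1) * (c + 2) + C₁ + 8 * c ^ 2 + 32 with hC₂
  have hC₂0 : 0 ≤ C₂ := by positivity
  set C₃ : ℝ := (C + 1) * (c + 2) + C₁ + 8 * c ^ 2 with hC₃
  set KP : ℝ := (Real.sqrt (c / 5))⁻¹ ^ d * Real.exp (D / (2 * (c / 5))) * (2 / (c / 5)) * 3 with hKP
  have hKP0 : 0 ≤ KP := by positivity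
  -- The first two caps keep ‖ζ‖ ≤ c/n + 2θ below r and 1/4 for large n. The third makes the
  -- quadratic error 32y²/n = 32yθ at most half of the decay rate times y.
  obtain ⟨η₁, hη₁, hη1, hη2, hη3⟩ : ∃ η₁ : ℝ, 0 < η₁ ∧ η₁ ≤ r / 4 ∧ η₁ ≤ 1 / 16 ∧
      η₁ ≤ lam * a / 64 :=
    ⟨min (r / 4) (min (1 / 16) (lam * a / 64)), by positivity, min_le_left _ _,
      (min_le_right _ _).trans (min_le_left _ _), (min_le_right _ _).trans (min_le_right _ _)⟩
  refine ⟨η₁, hη₁, fun η hη => ?_⟩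
  refine ⟨KP * (L * (c + 2) + L₂ * C₂) * Real.exp (c + C₃) * (2 + 4 / μ ^ 2), μ, by positivity,
    hμ0, ?_⟩
  have hl1 : ∀ᶠ n : ℕ in atTop, c / n ≤ min (r / 2) (1 / 8) :=
    (tendsto_const_div_atTop_nhds_zero_nat c).eventually_le_const (by positivity)
  filter_upwards [hl1, eventually_gt_atTop 0] with n hn1 hn0
  rintro β δ δ₀ ⟨hβ, -, hδ⟩ hδδ hD θ ⟨hθ0, hθ1⟩
  have hn : (1 : ℝ) ≤ n := by exact_mod_cast hn0
  have hn0' : (0 : ℝ) < n := by linarith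
  have hcn : 0 < c / n := by positivity
  have hnr : c / n ≤ r / 2 := hn1.trans (min_le_left _ _)
  have hn8 : c / n ≤ 1 / 8 := hn1.trans (min_le_right _ _)
  have hpi := Real.pi_gt_three
  set y : ℝ := n * θ with hy
  have hy0 : 0 ≤ y := by positivity
  have hζ : (-((c / n : ℝ) : ℂ) + θ * (a + Complex.I)) =
      ((a * θ - c / n : ℝ) : ℂ) + θ * Complex.I := point_eq _ _ _
  rw [hζ]
  set ζ : ℂ := ((a * θ - c / n : ℝ) : ℂ) + θ * Complex.I with hζd
  have hζn : ‖ζ‖ ≤ c / n + 2 * θ := by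
    have h1 := norm_add_le (((a * θ - c / n : ℝ) : ℂ)) (θ * Complex.I)
    rw [norm_mul, Complex.norm_I, mul_one, Complex.norm_real, Complex.norm_real, Real.norm_eq_abs,
      Real.norm_of_nonneg hθ0] at h1
    have h2 : |a * θ - c / n| ≤ c / n + θ := by
      have : 0 ≤ a * θ := by positivity
      have h3 : a * θ ≤ 1 / 4 * θ := mul_le_mul_of_nonneg_right ha hθ0
      exact abs_le.2 ⟨by linarith, by linarith⟩
    linarith
  have hζr : ‖ζ‖ ≤ r := by linarith
  have hζ4 : ‖ζ‖ ≤ 1 / 4 := by linarith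
  obtain ⟨b1, b2, b3⟩ := cayley_exp_bounds hζ4
  have b4 := hloc ζ hζr
  have b5 : c / n / 5 ≤ ‖1 - Complex.exp ζ‖ :=
    norm_one_sub_exp_slant_ge ha0.le ha hcn.le (by linarith) hθ0 (by linarith)
  have b5' : c / 5 / n ≤ ‖1 - Complex.exp ζ‖ := by
    rw [div_right_comm]; exact b5
  -- From 10k ≤ c, the pole lies within half the lower bound c/(5n) of the branch point, so the
  -- distance to τ is at least c/(10n).
  have b6 : c / 5 / n / 2 ≤ ‖((1 - k / n : ℝ) : ℂ) - Complex.exp ζ‖ := by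
    refine norm_sub_exp_ge b5' ?_
    rw [abs_of_nonneg (by positivity)]
    rw [div_right_comm _ (n : ℝ) 2]
    gcongr
    linarith
  have b7 : ‖Complex.exp ζ‖ ≤ 3 := by
    rw [Complex.norm_exp]
    have := (Complex.re_le_norm ζ).trans hζ4
    exact (Real.exp_le_exp.2 (by linarith : ζ.re ≤ 1)).trans (by linarith [Real.exp_one_lt_d9])
  have h1 : 1 - Complex.exp ζ ≠ 0 := norm_pos_iff.1 (lt_of_lt_of_le (by positivity) b5)
  have h2 : 1 + Complex.exp ζ ≠ 0 := norm_pos_iff.1 (by linarith)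
  obtain ⟨p, hp1, hp2⟩ := kernelIntegrand_sub_modelIntegrand (d := d) (n := n) (N := effLevel x n)
    (x := x) (τ := 1 - k / n) (β := β) (δ := δ) (δ₀ := δ₀) h1 h2
  rw [hp1]
  set q : ℂ := -((effLevel x n : ℕ) * ζ) with hq
  have hpq : ‖p - q‖ ≤ (C + 1) * ‖ζ‖ + C₁ / n + 4 * n * ‖ζ‖ ^ 2 :=
    norm_exponent_sub_le hx0 hx2 hx4 hn hc0 hC hβ hδ hδδ hζ4 b5 hp2
  have hζy : ‖ζ‖ ≤ (c + 2 * y) / n := by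
    refine hζn.trans (le_of_eq ?_)
    rw [hy]; field_simp
  have hζy2 : n * ‖ζ‖ ^ 2 ≤ (2 * c ^ 2 + 8 * y ^ 2) / n := by
    calc n * ‖ζ‖ ^ 2 ≤ n * ((c + 2 * y) / n) ^ 2 := by gcongr
      _ = (c + 2 * y) ^ 2 / n := by field_simp
      _ ≤ _ := by gcongr; linarith [sq_nonneg (c - 2 * y)]
  have hW : ‖p - q‖ ≤ ((C + 1) * (c + 2 * y) + C₁ + 8 * c ^ 2 + 32 * y ^ 2) / n := by
    refine hpq.trans ?_
    calc (C + 1) * ‖ζ‖ + C₁ / n + 4 * n * ‖ζ‖ ^ 2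
        = (C + 1) * ‖ζ‖ + C₁ / n + 4 * (n * ‖ζ‖ ^ 2) := by ring
      _ ≤ (C + 1) * ((c + 2 * y) / n) + C₁ / n + 4 * ((2 * c ^ 2 + 8 * y ^ 2) / n) := by gcongr
      _ = _ := by ring
  have hW1 : ‖p - q‖ ≤ C₂ * (1 + y) ^ 2 / n := by
    refine hW.trans ?_
    gcongr
    have g1 : c + 2 * y ≤ (c + 2) * (1 + y) ^ 2 := add_two_mul_le hc0.le hy0
    have g2 : (C + 1) * (c + 2 * y) ≤ (C + 1) * ((c + 2) * (1 + y) ^ 2) := by gcongr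
    have g3 : 1 ≤ (1 + y) ^ 2 := one_le_pow₀ (by linarith)
    have g4 : C₁ ≤ C₁ * (1 + y) ^ 2 := le_mul_of_one_le_right hC₁0 g3
    have g5 : 8 * c ^ 2 ≤ 8 * c ^ 2 * (1 + y) ^ 2 := le_mul_of_one_le_right (by positivity) g3
    have g6 : 32 * y ^ 2 ≤ 32 * (1 + y) ^ 2 := by gcongr; linarith
    rw [hC₂]; linarith
  have hyn : y / n = θ := by rw [hy]; field_simp
  -- A second bound on the same difference: the previous one gives the gain 1/n, this one shows that
  -- p keeps half of the exponential decay of q.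
  have hW2 : ‖p - q‖ ≤ C₃ + lam * a / 2 * y := by
    refine hW.trans ?_
    have hθ16 : θ ≤ 1 := by linarith
    have e : ((C + 1) * (c + 2 * y) + C₁ + 8 * c ^ 2 + 32 * y ^ 2) / n =
        (C + 1) * (c / n + 2 * (y / n)) + C₁ / n + 8 * c ^ 2 / n + 32 * y * (y / n) := by
      field_simp
    rw [e, hyn, hC₃]
    have g1 : c / n ≤ c := div_le_self hc0.le hn
    have g2 : C₁ / n ≤ C₁ := div_le_self hC₁0 hn
    have g3 : 8 * c ^ 2 / n ≤ 8 * c ^ 2 := div_le_self (by positivity) hn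
    have g4 : 32 * y * θ ≤ 32 * y * (lam * a / 64) := by gcongr; linarith
    have g5 : (C + 1) * (c / n + 2 * θ) ≤ (C + 1) * (c + 2) := by gcongr; linarith
    linarith
  have hq_re : q.re ≤ c - lam * a * y := by
    have e : q.re = -(effLevel x n * (a * θ - c / n)) := by
      rw [hq, Complex.neg_re, ← Complex.ofReal_natCast, Complex.re_ofReal_mul, hζd]
      simp
    rw [e]
    have g1 := le_effLevel hx0 hx2 n
    have g2 : (effLevel x n : ℝ) ≤ n := by exact_mod_cast effLevel_le_self x n
    have g3 : (effLevel x n : ℝ) * (c / n) ≤ c := by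
      calc (effLevel x n : ℝ) * (c / n) ≤ n * (c / n) := by gcongr
        _ = c := by field_simp
    have g4 : lam * n * (a * θ) ≤ effLevel x n * (a * θ) := by gcongr
    have g5 : lam * n * (a * θ) = lam * a * y := by rw [hy]; ring
    linarith
  have hC₃0 : 0 ≤ C₃ := by positivity
  have hlay : 0 ≤ lam * a * y := by positivity
  have hp_re : p.re ≤ (c + C₃) - 2 * μ * y := by
    have e : p.re = q.re + (p - q).re := by simp
    have := (Complex.re_le_norm (p - q)).trans hW2
    rw [e, hμ]; linarith
  have hq_re' : q.re ≤ (c + C₃) - 2 * μ * y := by rw [hμ]; linarith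
  set R : ℝ := (c + C₃) - 2 * μ * y with hR
  have hP := norm_commonFactor_le (d := d) (n := n) (τ := 1 - k / n) (δ := δ₀)
    hn0 (by positivity) b5' b6 b7
  have hP' : ‖((1 - Complex.exp ζ) ^ (-1 / 2 : ℂ)) ^ d *
      Complex.exp (δ₀ / n / (2 * (1 - Complex.exp ζ))) *
      (((1 - k / n : ℝ) : ℂ) - Complex.exp ζ)⁻¹ * Complex.exp ζ‖ ≤ KP * (Real.sqrt n ^ d * n) := by
    refine hP.trans ?_
    rw [hKP]
    gcongr
  have hζ1 : ‖ζ‖ ≤ (c + 2) * (1 + y) ^ 2 / n := by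
    refine hζy.trans ?_
    gcongr
    exact add_two_mul_le hc0.le hy0
  have hbr : ‖(((1 + Complex.exp ζ) ^ (-1 / 2 : ℂ)) ^ d - ((2 : ℂ) ^ (-1 / 2 : ℂ)) ^ d) *
      Complex.exp p + ((2 : ℂ) ^ (-1 / 2 : ℂ)) ^ d * (Complex.exp p - Complex.exp q)‖ ≤
      (L * (c + 2) + L₂ * C₂) * ((1 + y) ^ 2 / n) * Real.exp R := by
    refine (norm_add_le _ _).trans ?_
    rw [norm_mul, norm_mul]
    have g1 : ‖Complex.exp p‖ ≤ Real.exp R := by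
      rw [Complex.norm_exp]; exact Real.exp_le_exp.2 hp_re
    have g2 := norm_exp_sub_exp_le hp_re hq_re'
    calc _ ≤ (L * ((c + 2) * (1 + y) ^ 2 / n)) * Real.exp R +
          L₂ * (Real.exp R * (C₂ * (1 + y) ^ 2 / n)) := by
          gcongr
          · exact b4.trans (by gcongr)
          · exact g2.trans (by gcongr)
      _ = _ := by ring
  rw [norm_mul]
  have hexp : Real.exp R = Real.exp (c + C₃) * Real.exp (-(2 * μ * y)) := by
    rw [← Real.exp_add]; congr 1
  calc _ ≤ (KP * (Real.sqrt n ^ d * n)) *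
        ((L * (c + 2) + L₂ * C₂) * ((1 + y) ^ 2 / n) * Real.exp R) := by
        refine mul_le_mul hP' hbr (norm_nonneg _) (by positivity)
    _ = KP * (L * (c + 2) + L₂ * C₂) * Real.exp (c + C₃) * Real.sqrt n ^ d *
        ((1 + y) ^ 2 * Real.exp (-(2 * μ * y))) := by rw [hexp]; field_simp
    _ ≤ KP * (L * (c + 2) + L₂ * C₂) * Real.exp (c + C₃) * Real.sqrt n ^ d *
        ((2 + 4 / μ ^ 2) * Real.exp (-(μ * y))) := by
        exact mul_le_mul_of_nonneg_left (one_add_sq_mul_exp_le hμ0 hy0) (by positivity)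
    _ = _ := by rw [hy, ← mul_assoc μ]; ring

/-! ### Holomorphy and symmetry; comparison of the two contour integrals -/

theorem differentiableAt_kernelIntegrand {d n : ℕ} {x τ : ℝ} {β δ ζ : ℂ}
    (h1 : 1 - Complex.exp ζ ∈ Complex.slitPlane) (h2 : 1 + Complex.exp ζ ∈ Complex.slitPlane)
    (h3 : (τ : ℂ) - Complex.exp ζ ≠ 0) :
    DifferentiableAt ℂ (kernelIntegrand d x τ n β δ) ζ := by
  have n1 := Complex.slitPlane_ne_zero h1
  have n2 := Complex.slitPlane_ne_zero h2
  have n3 : 1 - Complex.exp ζ ^ 2 ≠ 0 := by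
    have : 1 - Complex.exp ζ ^ 2 = (1 - Complex.exp ζ) * (1 + Complex.exp ζ) := by ring
    rw [this]; exact mul_ne_zero n1 n2
  have n4 : 2 * (1 + Complex.exp ζ) ≠ 0 := mul_ne_zero two_ne_zero n2
  have d1 : DifferentiableAt ℂ (fun ζ => (1 - Complex.exp ζ) ^ (-1 / 2 : ℂ)) ζ :=
    DifferentiableAt.cpow (by fun_prop) (by fun_prop) h1
  have d2 : DifferentiableAt ℂ (fun ζ => (1 + Complex.exp ζ) ^ (-1 / 2 : ℂ)) ζ :=
    DifferentiableAt.cpow (by fun_prop) (by fun_prop) h2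
  have d3 : DifferentiableAt ℂ (fun ζ => (Complex.exp ζ - 1) / (2 * (1 + Complex.exp ζ))) ζ :=
    DifferentiableAt.div (by fun_prop) (by fun_prop) n4
  have d4 : DifferentiableAt ℂ (fun ζ => Complex.exp ζ / (1 - Complex.exp ζ ^ 2)) ζ :=
    DifferentiableAt.div (by fun_prop) (by fun_prop) n3
  have d5 : DifferentiableAt ℂ (fun ζ => ((τ : ℂ) - Complex.exp ζ)⁻¹) ζ :=
    DifferentiableAt.inv (by fun_prop) h3
  have d6 := (((d3.const_mul β).add (d4.const_mul δ))).cexp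
  have d7 := (((d3.const_mul ((x : ℂ) ^ 2)).sub differentiableAt_id).const_mul (n : ℂ)).cexp
  exact (((((d1.pow d).mul (d2.pow d)).mul d6).mul d5).mul Complex.differentiableAt_exp).mul d7

theorem differentiableAt_modelIntegrand {d n N : ℕ} {τ : ℝ} {δ ζ : ℂ}
    (h1 : 1 - Complex.exp ζ ∈ Complex.slitPlane)
    (h3 : (τ : ℂ) - Complex.exp ζ ≠ 0) :
    DifferentiableAt ℂ (modelIntegrand d τ n N δ) ζ := by
  have n1 : 2 * (1 - Complex.exp ζ) ≠ 0 := mul_ne_zero two_ne_zero (Complex.slitPlane_ne_zero h1)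
  have d1 : DifferentiableAt ℂ (fun ζ => (1 - Complex.exp ζ) ^ (-1 / 2 : ℂ)) ζ :=
    DifferentiableAt.cpow (by fun_prop) (by fun_prop) h1
  have d2 : DifferentiableAt ℂ (fun ζ => δ / n / (2 * (1 - Complex.exp ζ))) ζ :=
    DifferentiableAt.div (by fun_prop) (by fun_prop) n1
  have d5 : DifferentiableAt ℂ (fun ζ => ((τ : ℂ) - Complex.exp ζ)⁻¹) ζ :=
    DifferentiableAt.inv (by fun_prop) h3
  have d7 : DifferentiableAt ℂ (fun ζ => Complex.exp (-(N * ζ))) ζ := by fun_prop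
  exact (((((d1.pow d).mul_const _).mul d2.cexp).mul d5).mul Complex.differentiableAt_exp).mul d7

theorem exp_add_pi_mul_I (t : ℂ) :
    Complex.exp (t + Real.pi * Complex.I) = Complex.exp (t - Real.pi * Complex.I) := by
  rw [Complex.exp_add, Complex.exp_sub, Complex.exp_pi_mul_I, mul_neg_one, div_neg, div_one]

theorem exp_neg_nat_mul (n : ℕ) (ζ : ℂ) :
    Complex.exp (-(n * ζ)) = (Complex.exp ζ ^ n)⁻¹ := by
  rw [Complex.exp_neg, Complex.exp_nat_mul]

theorem kernelIntegrand_periodic (d : ℕ) (x τ : ℝ) (n : ℕ) (β δ : ℂ) (t : ℝ) :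
    kernelIntegrand d x τ n β δ (t + Real.pi * Complex.I) =
      kernelIntegrand d x τ n β δ (t - Real.pi * Complex.I) := by
  have h : ∀ A ζ : ℂ, Complex.exp (n * (A - ζ)) = Complex.exp (n * A) * (Complex.exp ζ ^ n)⁻¹ :=
    fun A ζ => by rw [mul_sub, sub_eq_add_neg, Complex.exp_add, exp_neg_nat_mul]
  simp only [kernelIntegrand, h, exp_add_pi_mul_I]

theorem modelIntegrand_periodic (d : ℕ) (τ : ℝ) (n N : ℕ) (δ : ℂ) (t : ℝ) :
    modelIntegrand d τ n N δ (t + Real.pi * Complex.I) =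
      modelIntegrand d τ n N δ (t - Real.pi * Complex.I) := by
  simp only [modelIntegrand, exp_neg_nat_mul, exp_add_pi_mul_I]

theorem conj_cpow_neg_half {z : ℂ} (hz : 0 < z.re) :
    (conj z) ^ (-1 / 2 : ℂ) = conj (z ^ (-1 / 2 : ℂ)) := by
  have h : z.arg ≠ Real.pi := Complex.slitPlane_arg_ne_pi (Or.inl hz)
  have e : conj (-1 / 2 : ℂ) = -1 / 2 := by simp [Complex.conj_ofNat]
  rw [Complex.conj_cpow _ _ h, e]

/-- For Re ζ < 0 both 1 - σ and 1 + σ have positive real part, where the principal branch commutes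
with conjugation. -/
theorem kernelIntegrand_conj {d n : ℕ} {x τ : ℝ} {β δ ζ : ℂ} (h : ζ.re < 0) :
    kernelIntegrand d x τ n (conj β) (conj δ) ζ =
      conj (kernelIntegrand d x τ n β δ (conj ζ)) := by
  have hσ : ‖Complex.exp ζ‖ < 1 := by
    rw [Complex.norm_exp]; exact Real.exp_lt_one_iff.2 h
  have hre := (abs_lt.1 ((Complex.abs_re_le_norm _).trans_lt hσ))
  have e1 := conj_cpow_neg_half (z := 1 - Complex.exp ζ) (by
    rw [Complex.sub_re, Complex.one_re]; linarith)
  have e2 := conj_cpow_neg_half (z := 1 + Complex.exp ζ) (by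
    rw [Complex.add_re, Complex.one_re]; linarith)
  simp only [map_sub, map_add, map_one] at e1 e2
  simp only [kernelIntegrand, map_mul, map_pow, map_inv₀, map_sub, map_add, map_div₀, map_one,
    ← Complex.exp_conj, Complex.conj_conj, Complex.conj_ofReal, map_natCast, map_ofNat]
  rw [Complex.exp_conj, e1, e2]
  simp

/-- The model contour ends outside the unit circle, so the line Im ζ = π is allowed as well: there 1
- σ is a positive real. -/
theorem modelIntegrand_conj {d n N : ℕ} {τ : ℝ} {δ ζ : ℂ} (h : ζ.re < 0 ∨ ζ.im = Real.pi) :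
    modelIntegrand d τ n N (conj δ) ζ = conj (modelIntegrand d τ n N δ (conj ζ)) := by
  have hre : (Complex.exp ζ).re < 1 := by
    rcases h with h | h
    · have hσ : ‖Complex.exp ζ‖ < 1 := by
        rw [Complex.norm_exp]; exact Real.exp_lt_one_iff.2 h
      exact (Complex.re_le_norm _).trans_lt hσ
    · rw [exp_of_im_pi h, Complex.neg_re, Complex.ofReal_re]
      linarith [Real.exp_pos ζ.re]
  have e1 := conj_cpow_neg_half (z := 1 - Complex.exp ζ) (by
    rw [Complex.sub_re, Complex.one_re]; linarith)
  have e2 := conj_cpow_neg_half (z := 2) (by simp)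
  simp only [map_sub, map_one, map_ofNat] at e1 e2
  simp only [modelIntegrand, map_mul, map_pow, map_inv₀, map_sub, map_neg, map_div₀, map_one,
    ← Complex.exp_conj, Complex.conj_conj, Complex.conj_ofReal, map_natCast, map_ofNat]
  rw [Complex.exp_conj, e1, ← e2]
  simp

/-- Bound for the model integrand on a vertical segment to the right of the imaginary axis. -/
theorem norm_modelIntegrand_far_le {d n N : ℕ} {k D η s u θ : ℝ} {δ : ℂ} (hη : 0 < η)
    (hn : 0 < n) (hk : |k / n| ≤ η / 6) (hδ : ‖δ‖ ≤ D) (hs : 0 < s) (hu : |u| ≤ 1) (h0 : η ≤ θ)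
    (hθ : θ ≤ Real.pi) (hN : s * n ≤ N * u) :
    ‖modelIntegrand d (1 - k / n) n N δ (u + θ * Complex.I)‖ ≤
      (Real.sqrt (η / 3))⁻¹ ^ d * ‖((2 : ℂ) ^ (-1 / 2 : ℂ)) ^ d‖ * Real.exp (D / (2 * (η / 3))) *
        (η / 6)⁻¹ * 3 * (1 / s) * (1 / n) := by
  have hn1 : (1 : ℝ) ≤ n := by exact_mod_cast hn
  have h1 : η / 3 ≤ ‖1 - Complex.exp (u + θ * Complex.I)‖ :=
    le_trans (by linarith) (norm_one_sub_exp_ge hu (by linarith) hθ).2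
  have h3 : η / 6 ≤ ‖((1 - k / n : ℝ) : ℂ) - Complex.exp (u + θ * Complex.I)‖ := by
    have := norm_sub_exp_ge (k := k) (n := n) h1 (by linarith)
    linarith
  have hσ3 : ‖Complex.exp (u + θ * Complex.I)‖ ≤ 3 := by
    rw [norm_exp_line]
    exact (Real.exp_le_exp.2 (le_of_abs_le hu)).trans (by linarith [Real.exp_one_lt_d9])
  have e4 : ‖Complex.exp (-(N * (u + θ * Complex.I)))‖ ≤ 1 / s * (1 / n) := by
    have e : (-(N * ((u : ℂ) + θ * Complex.I))).re = -(N * u) := by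
      rw [Complex.neg_re, ← Complex.ofReal_natCast, Complex.re_ofReal_mul]; simp
    rw [Complex.norm_exp, e, Real.exp_neg, one_div_mul_one_div, one_div]
    -- Of the exponential decay only e^{-y} ≤ 1/y is used; a factor 1/n suffices.
    have : s * n ≤ Real.exp (N * u) := by linarith [Real.add_one_le_exp (N * u)]
    exact inv_anti₀ (by positivity) this
  unfold modelIntegrand
  set σ := Complex.exp (u + θ * Complex.I) with hσ
  have e5 := norm_cpow_neg_half_le (by linarith) h1
  have e7 := inv_anti₀ (by linarith) h3
  have e6 : ‖Complex.exp (δ / n / (2 * (1 - σ)))‖ ≤ Real.exp (D / (2 * (η / 3))) := by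
    rw [Complex.norm_exp]
    refine Real.exp_le_exp.2 ((Complex.re_le_norm _).trans ?_)
    rw [norm_div, norm_div, norm_mul, Complex.norm_natCast, Complex.norm_ofNat]
    have : ‖δ‖ / n ≤ D := (div_le_self (norm_nonneg _) hn1).trans hδ
    have hD : 0 ≤ D := (norm_nonneg _).trans hδ
    gcongr
  rw [norm_mul, norm_mul, norm_mul, norm_mul, norm_mul, norm_pow, norm_inv]
  calc _ ≤ (Real.sqrt (η / 3))⁻¹ ^ d * ‖((2 : ℂ) ^ (-1 / 2 : ℂ)) ^ d‖ *
        Real.exp (D / (2 * (η / 3))) * (η / 6)⁻¹ * 3 * (1 / s * (1 / n)) := by gcongr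
    _ = _ := by ring

/-- The circle of radius e^{-c/n} lies inside |σ| < τ, as the truncation formula requires. -/
theorem exp_neg_div_lt {k c : ℝ} (hk : 0 < k) (hc : 10 * k ≤ c) :
    ∀ᶠ n : ℕ in atTop, Real.exp (-(c / n)) < 1 - k / n := by
  have hl : ∀ᶠ n : ℕ in atTop, c / n ≤ 1 / 2 :=
    (tendsto_const_div_atTop_nhds_zero_nat c).eventually_le_const (by positivity)
  filter_upwards [hl, eventually_gt_atTop 0] with n h1 hn
  have hn : (0 : ℝ) < n := by exact_mod_cast hn
  have hy : 0 < c / n := by have : 0 < c := by linarith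
                            positivity
  have hkc : k / n ≤ c / n / 10 := by
    rw [div_right_comm]; gcongr; linarith
  rw [Real.exp_neg]
  have h2 := Real.add_one_le_exp (c / n)
  refine (inv_anti₀ (by linarith) h2).trans_lt ?_
  rw [inv_lt_iff_one_lt_mul₀ (by linarith)]
  have h3 : c / n * (k / n) ≤ 1 / 2 * (k / n) := by
    gcongr
  linarith

/-- The contour data common to all parameters: the moved upper halves of the two contours differ
by a lower order term. -/
theorem upper_half_comparison {d : ℕ} {x k c C a η₀ D : ℝ} (hx0 : 0 ≤ x) (hx2 : x < 2) (hk : 0 < k)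
    (hc : 10 * k ≤ c) (hC : 0 ≤ C) (ha0 : 0 < a) (ha : a ≤ 1 / 4) (hη₀ : 0 < η₀)
    (hfar : ∀ η, 0 < η → η ≤ η₀ → FarBound d x k c C a η) :
    ∃ K : ℝ, ∀ᶠ n : ℕ in atTop, ∃ e e' : ℝ, e < 0 ∧ ∀ β δ δ₀ : ℂ,
      Admissible x C n β δ → ‖δ - δ₀ / n‖ ≤ C / n ^ 2 → ‖δ₀‖ ≤ D → ∃ Q Q' : ℂ,
      IntervalIntegrable (fun θ : ℝ => kernelIntegrand d x (1 - k / n) n β δ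
        (-((c / n : ℝ) : ℂ) + θ * Complex.I)) MeasureTheory.volume 0 Real.pi ∧
      IntervalIntegrable (fun θ : ℝ => modelIntegrand d (1 - k / n) n (effLevel x n) δ₀
        (-((c / n : ℝ) : ℂ) + θ * Complex.I)) MeasureTheory.volume 0 Real.pi ∧
      lineInt (kernelIntegrand d x (1 - k / n) n β δ) (-((c / n : ℝ) : ℂ)) Complex.I 0 Real.pi =
        Q + ∫ t in e..(-(c / n)),
          kernelIntegrand d x (1 - k / n) n β δ (t + Real.pi * Complex.I) ∧
      lineInt (modelIntegrand d (1 - k / n) n (effLevel x n) δ₀) (-((c / n : ℝ) : ℂ))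
        Complex.I 0 Real.pi = Q' + ∫ t in e'..(-(c / n)),
          modelIntegrand d (1 - k / n) n (effLevel x n) δ₀ (t + Real.pi * Complex.I) ∧
      ‖Q - Q'‖ ≤ K * (Real.sqrt n ^ d / n) := by
  have hc0 : 0 < c := by linarith
  have hpi := Real.pi_gt_three
  have hpi4 := Real.pi_le_four
  have hx4 : x ^ 2 < 4 := by nlinarith
  obtain ⟨η₁, hη₁, hnear⟩ := near_bound d hx0 hx2 hk hc hC ha0 ha D
  -- The slope a is fixed before η, and the bound η₁ depends on a. Hence the far estimate is assumed
  -- for all sufficiently small η.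
  obtain ⟨η, hη, hηη₀, hηη₁, hη1⟩ : ∃ η : ℝ, 0 < η ∧ η ≤ η₀ ∧ η ≤ η₁ ∧ η ≤ 1 :=
    ⟨min η₀ (min η₁ 1), by positivity, min_le_left _ _, (min_le_right _ _).trans (min_le_left _ _),
      (min_le_right _ _).trans (min_le_right _ _)⟩
  obtain ⟨K₁, μ, hK₁, hμ, hnear⟩ := hnear η hηη₁
  obtain ⟨K₂, hfar⟩ := hfar η hη hηη₀
  set s : ℝ := (1 - x ^ 2 / 4) * (a * η / 2) with hs
  have hs0 : 0 < s := mul_pos (by linarith) (by positivity)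
  set K₃ : ℝ := (Real.sqrt (η / 3))⁻¹ ^ d * ‖((2 : ℂ) ^ (-1 / 2 : ℂ)) ^ d‖ *
    Real.exp (D / (2 * (η / 3))) * (η / 6)⁻¹ * 3 * (1 / s) with hK₃
  have hK₃0 : 0 ≤ K₃ := by positivity
  have hl1 : ∀ᶠ n : ℕ in atTop, |k / n| ≤ η / 6 := by
    have : Tendsto (fun n : ℕ => |k / n|) atTop (𝓝 0) := by
      simpa using (tendsto_const_div_atTop_nhds_zero_nat k).abs
    exact this.eventually_le_const (by linarith)
  have hl2 : ∀ᶠ n : ℕ in atTop, c / n ≤ a * η / 2 :=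
    (tendsto_const_div_atTop_nhds_zero_nat c).eventually_le_const (by positivity)
  refine ⟨2 * (K₁ * (1 / μ)) + 2 * K₂ + K₃ * 4, ?_⟩
  filter_upwards [hnear, hfar, hl1, hl2, exp_neg_div_lt hk hc, eventually_gt_atTop 0] with
    n hnear hfar hn1 hn2 hτ hn0
  have hn : (1 : ℝ) ≤ n := by exact_mod_cast hn0
  have hn' : (0 : ℝ) < n := by linarith
  have hcn : 0 < c / n := by positivity
  obtain ⟨e, m, he, hem, hm1, hm2, hfar⟩ := hfar
  have hmpi : a * m ≤ a * Real.pi := by gcongr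
  have hηpi : a * η ≤ a * Real.pi := by gcongr; linarith
  have haη : a * η ≤ 1 / 4 * η := by gcongr
  have hapi : 0 < a * Real.pi := by positivity
  -- Real parts of the two upper endpoints. They depend on n alone, so the same ones serve the
  -- conjugated parameters and the horizontal pieces cancel.
  refine ⟨e - a * Real.pi, a * η - c / n, by linarith, fun β δ δ₀ hadm hδδ hD => ?_⟩
  obtain ⟨M, hM, hMl, hMr, hMi⟩ := hfar β δ hadm
  have hnear := hnear β δ δ₀ hadm hδδ hD
  set p : ℂ := -((c / n : ℝ) : ℂ) with hp
  set f := kernelIntegrand d x (1 - k / n) n β δ with hf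
  set g := modelIntegrand d (1 - k / n) n (effLevel x n) δ₀ with hg
  set v : ℂ := (a : ℂ) + Complex.I with hv
  set w : ℂ := -(a : ℂ) + Complex.I with hw
  have hnv : ‖v‖ ≤ 2 := by
    refine (norm_add_le _ _).trans ?_
    rw [Complex.norm_I, Complex.norm_real, Real.norm_of_nonneg ha0.le]; linarith
  have hnw : ‖w‖ ≤ 2 := by
    refine (norm_add_le _ _).trans ?_
    rw [norm_neg, Complex.norm_I, Complex.norm_real, Real.norm_of_nonneg ha0.le]; linarith
  -- The largest margin from iπ compatible with both the vertical line and the end of the moved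
  -- contour.
  set ε : ℝ := min (c / n) (a * Real.pi - e) with hε
  have hε0 : 0 < ε := lt_min hcn (by linarith)
  have hε1 : ε ≤ c / n := min_le_left _ _
  have hε2 : ε ≤ a * Real.pi - e := min_le_right _ _
  have hfd : DifferentiableOn ℂ f (wedge a (c / n) ε) := fun ζ hζ =>
    (differentiableAt_kernelIntegrand
      (one_sub_exp_mem_slitPlane hcn (wedge_subset_halfWedge _ _ _ hζ))
      (one_add_exp_mem_slitPlane hε0 hζ)
      (sub_exp_ne_zero hτ (wedge_subset_halfWedge _ _ _ hζ))).differentiableWithinAt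
  have hgd : DifferentiableOn ℂ g (halfWedge a (c / n)) := fun ζ hζ =>
    (differentiableAt_modelIntegrand (one_sub_exp_mem_slitPlane hcn hζ)
      (sub_exp_ne_zero hτ hζ)).differentiableWithinAt
  have hpre : p.re = -(c / n) := by rw [hp, Complex.neg_re, Complex.ofReal_re]
  have hpim : p.im = 0 := by rw [hp, Complex.neg_im, Complex.ofReal_im, neg_zero]
  have hvre : v.re = a := by simp [hv]
  have hvim : v.im = 1 := by simp [hv]
  have hwre : w.re = -a := by simp [hw]
  have hwim : w.im = 1 := by simp [hw]
  have hre : ∀ (q u : ℂ) (t : ℝ), (q + t * u).re = q.re + t * u.re := fun q u t => by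
    rw [Complex.add_re, Complex.re_ofReal_mul]
  have him : ∀ (q u : ℂ) (t : ℝ), (q + t * u).im = q.im + t * u.im := fun q u t => by
    rw [Complex.add_im, Complex.im_ofReal_mul]
  have w1 : p ∈ wedge a (c / n) ε := by
    simp only [wedge, Set.mem_ofPred_eq, hpre, hpim]
    exact ⟨le_rfl, by linarith, by linarith, by linarith⟩
  have w2 : p + Real.pi * Complex.I ∈ wedge a (c / n) ε := by
    simp only [wedge, Set.mem_ofPred_eq, hre, him, hpre, hpim, Complex.I_re, Complex.I_im]
    exact ⟨by linarith, by linarith, by linarith, by linarith⟩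
  have w3 : p + m * v ∈ wedge a (c / n) ε := by
    simp only [wedge, Set.mem_ofPred_eq, hre, him, hpre, hpim, hvre, hvim]
    exact ⟨by linarith, by linarith, by linarith, by linarith⟩
  have w4 : (e : ℂ) + Real.pi * w ∈ wedge a (c / n) ε := by
    simp only [wedge, Set.mem_ofPred_eq, hre, him, hwre, hwim, Complex.ofReal_re,
      Complex.ofReal_im]
    exact ⟨by linarith, by linarith, by linarith, by linarith⟩
  have w5 : p + η * v ∈ wedge a (c / n) ε := by
    have : a * η ≤ a * m := by gcongr
    simp only [wedge, Set.mem_ofPred_eq, hre, him, hpre, hpim, hvre, hvim]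
    exact ⟨by linarith, by linarith, by linarith, by linarith⟩
  set q' : ℂ := ((a * η - c / n : ℝ) : ℂ) with hq'
  have w6 : q' + Real.pi * Complex.I ∈ halfWedge a (c / n) := by
    simp only [halfWedge, Set.mem_ofPred_eq, hre, him, hq', Complex.ofReal_re, Complex.ofReal_im,
      Complex.I_re, Complex.I_im]
    exact ⟨by linarith, by linarith, by linarith⟩
  have hsub := wedge_subset_halfWedge a (c / n) ε
  have z1 : p + ((0 : ℝ) : ℂ) * Complex.I ∈ wedge a (c / n) ε := by simpa using w1
  have z2 : p + ((0 : ℝ) : ℂ) * v ∈ wedge a (c / n) ε := by simpa using w1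
  have hmv : p + m * v = (e : ℂ) + m * w := by
    have : ((a * m - c / n : ℝ) : ℂ) = ((e - a * m : ℝ) : ℂ) := by rw [hem]
    rw [hp, hv, hw, point_eq, point_eq', this]
  have hηv : p + η * v = q' + η * Complex.I := by
    rw [hp, hv, point_eq]
  have E1 := lineInt_vertical_eq (convex_wedge _ _ _) hfd (e := e - a * Real.pi) (b := Real.pi)
    hp hmv (by rw [hw, point_eq']) w1 w2 w3 w4
  have E2 := lineInt_vertical_eq (convex_halfWedge _ _) hgd (e := a * η - c / n) (b := Real.pi)
    hp hηv rfl (hsub w1) (hsub w2) (hsub w5) w6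
  refine ⟨_, _, (continuousOn_line (convex_wedge _ _ _) hfd.continuousOn z1 w2).intervalIntegrable,
    (continuousOn_line (convex_halfWedge _ _) hgd.continuousOn (hsub z1)
      (hsub w2)).intervalIntegrable, E1, E2, ?_⟩
  have i1 : IntervalIntegrable (fun θ : ℝ => f (p + θ * v) * v) MeasureTheory.volume 0 η :=
    ((continuousOn_line (convex_wedge _ _ _) hfd.continuousOn z2 w5).mul
      continuousOn_const).intervalIntegrable
  have i2 : IntervalIntegrable (fun θ : ℝ => f (p + θ * v) * v) MeasureTheory.volume η m :=
    ((continuousOn_line (convex_wedge _ _ _) hfd.continuousOn w5 w3).mul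
      continuousOn_const).intervalIntegrable
  have i3 : IntervalIntegrable (fun θ : ℝ => g (p + θ * v) * v) MeasureTheory.volume 0 η :=
    ((continuousOn_line (convex_halfWedge _ _) hgd.continuousOn (hsub z2) (hsub w5)).mul
      continuousOn_const).intervalIntegrable
  have hsplit : lineInt f p v 0 m = lineInt f p v 0 η + lineInt f p v η m :=
    (intervalIntegral.integral_add_adjacent_intervals i1 i2).symm
  have hdiff : lineInt f p v 0 η - lineInt g p v 0 η = lineInt (fun ζ => f ζ - g ζ) p v 0 η := by
    rw [lineInt, lineInt, ← intervalIntegral.integral_sub i1 i3]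
    simp only [lineInt, sub_mul]
  have hsq : 1 ≤ Real.sqrt n ^ d := one_le_pow₀ (Real.one_le_sqrt.2 hn)
  have B1 : ‖lineInt (fun ζ => f ζ - g ζ) p v 0 η‖ ≤
      2 * (K₁ * (1 / μ)) * (Real.sqrt n ^ d / n) := by
    refine (norm_lineInt_le (M := fun θ => K₁ * Real.sqrt n ^ d * Real.exp (-(μ * n * θ))) hη.le
      (by fun_prop) hnear).trans ?_
    rw [intervalIntegral.integral_const_mul]
    have := integral_exp_neg_mul_le (s := μ * n) (p := 0) (q := η) (by positivity) le_rfl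
    calc ‖v‖ * (K₁ * Real.sqrt n ^ d * ∫ θ in (0 : ℝ)..η, Real.exp (-(μ * n * θ)))
        ≤ ‖v‖ * (K₁ * Real.sqrt n ^ d * (1 / (μ * n))) := by gcongr
      _ ≤ 2 * (K₁ * Real.sqrt n ^ d * (1 / (μ * n))) := by gcongr
      _ = _ := by field_simp
  have B2 : ‖lineInt f p v η m + lineInt f e w m Real.pi‖ ≤ 2 * K₂ * (Real.sqrt n ^ d / n) := by
    have j1 := norm_lineInt_le hm1 hM hMl
    have j2 := norm_lineInt_le hm2 hM hMr
    have p1 : 0 ≤ ∫ θ in η..m, M θ := intervalIntegral.integral_nonneg hm1 fun θ hθ =>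
      (norm_nonneg _).trans (hMl θ hθ)
    have p2 : 0 ≤ ∫ θ in m..Real.pi, M θ := intervalIntegral.integral_nonneg hm2 fun θ hθ =>
      (norm_nonneg _).trans (hMr θ hθ)
    have j3 := intervalIntegral.integral_add_adjacent_intervals
      (hM.intervalIntegrable (μ := MeasureTheory.volume) η m)
      (hM.intervalIntegrable (μ := MeasureTheory.volume) m Real.pi)
    calc _ ≤ ‖v‖ * (∫ θ in η..m, M θ) + ‖w‖ * ∫ θ in m..Real.pi, M θ :=
          (norm_add_le _ _).trans (add_le_add j1 j2)
      _ ≤ 2 * (∫ θ in η..m, M θ) + 2 * ∫ θ in m..Real.pi, M θ := by gcongr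
      _ = 2 * ∫ θ in η..Real.pi, M θ := by rw [← j3]; ring
      _ ≤ 2 * (K₂ * (Real.sqrt n ^ d / n)) := by gcongr
      _ = _ := by ring
  have B3 : ‖lineInt g q' Complex.I η Real.pi‖ ≤ K₃ * 4 * (Real.sqrt n ^ d / n) := by
    have hu : |a * η - c / n| ≤ 1 := abs_le.2 ⟨by linarith, by linarith⟩
    have hN : s * n ≤ effLevel x n * (a * η - c / n) := by
      have g1 := le_effLevel hx0 hx2 n
      calc s * n = (1 - x ^ 2 / 4) * n * (a * η / 2) := by rw [hs]; ring
        _ ≤ effLevel x n * (a * η - c / n) := by gcongr; linarith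
    refine (norm_lineInt_le (M := fun _ => K₃ * (1 / n)) (by linarith) (by fun_prop)
      fun θ hθ => norm_modelIntegrand_far_le hη hn0 hn1 hD hs0 hu hθ.1 hθ.2 hN).trans ?_
    rw [Complex.norm_I, one_mul, intervalIntegral.integral_const, smul_eq_mul]
    calc (Real.pi - η) * (K₃ * (1 / n)) ≤ 4 * (K₃ * (1 / n)) := by gcongr; linarith
      _ ≤ 4 * (K₃ * (Real.sqrt n ^ d / n)) := by gcongr
      _ = _ := by ring
  -- The contours share the slanted segment up to height η, where the difference is small. Above it
  -- each integral is small by itself, the model one on a vertical line outside the unit circle.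
  have hfin : lineInt f p v 0 m + lineInt f e w m Real.pi -
      (lineInt g p v 0 η + lineInt g q' Complex.I η Real.pi) =
      lineInt (fun ζ => f ζ - g ζ) p v 0 η + (lineInt f p v η m + lineInt f e w m Real.pi) -
        lineInt g q' Complex.I η Real.pi := by
    rw [hsplit, ← hdiff]; ring
  rw [hfin]
  refine (norm_sub_le _ _).trans ((add_le_add ((norm_add_le _ _).trans (add_le_add B1 B2))
    B3).trans (le_of_eq ?_))
  ring

/-- The kernel integral and the model integral agree up to a lower order term. -/
theorem integral_comparison {d : ℕ} {x k c C a η₀ D : ℝ} (hx0 : 0 ≤ x) (hx2 : x < 2) (hk : 0 < k)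
    (hc : 10 * k ≤ c) (hC : 0 ≤ C) (ha0 : 0 < a) (ha : a ≤ 1 / 4) (hη₀ : 0 < η₀)
    (hfar : ∀ η, 0 < η → η ≤ η₀ → FarBound d x k c C a η) :
    ∃ K : ℝ, ∀ᶠ n : ℕ in atTop, ∀ β δ δ₀ : ℂ,
      Admissible x C n β δ → ‖δ - δ₀ / n‖ ≤ C / n ^ 2 → ‖δ₀‖ ≤ D →
      ‖(∫ θ in (-Real.pi)..Real.pi, kernelIntegrand d x (1 - k / n) n β δ
          (-((c / n : ℝ) : ℂ) + θ * Complex.I)) -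
        ∫ θ in (-Real.pi)..Real.pi, modelIntegrand d (1 - k / n) n (effLevel x n) δ₀
          (-((c / n : ℝ) : ℂ) + θ * Complex.I)‖ ≤ K * (Real.sqrt n ^ d / n) := by
  obtain ⟨K, hK⟩ := upper_half_comparison (D := D) hx0 hx2 hk hc hC ha0 ha hη₀ hfar
  refine ⟨2 * K, ?_⟩
  filter_upwards [hK, eventually_gt_atTop 0] with n hK hn
  intro β δ δ₀ hadm hδδ hD
  have hc0 : 0 < c := by linarith
  have hn : (0 : ℝ) < n := by exact_mod_cast hn
  have hcn : 0 < c / n := by positivity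
  obtain ⟨e, e', he, hK⟩ := hK
  obtain ⟨Q, Q', i1, i2, h1, h2, h3⟩ := hK β δ δ₀ hadm hδδ hD
  -- The lower half of the contour is the upper half for conjugated parameters.
  have hadm' : Admissible x C n (conj β) (conj δ) := by
    simpa only [Admissible, RCLike.norm_conj] using hadm
  have hδδ' : ‖conj δ - conj δ₀ / n‖ ≤ C / n ^ 2 := by
    have : conj δ - conj δ₀ / n = conj (δ - δ₀ / n) := by simp
    rw [this, RCLike.norm_conj]; exact hδδ
  obtain ⟨R, R', j1, j2, k1, k2, k3⟩ := hK (conj β) (conj δ) (conj δ₀) hadm' hδδ'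
    (by rwa [RCLike.norm_conj])
  have F1 := I_mul_integral_eq_sub_conj (T := {ζ | ζ.re < 0}) (c := c / n) (e := e)
    (fun ζ hζ => kernelIntegrand_conj hζ) (fun θ => by simpa using hcn)
    (fun t ht => by
      have : t < 0 := by
        rcases Set.mem_uIcc.1 ht with h | h <;> linarith [h.2]
      simpa using this)
    (kernelIntegrand_periodic d x (1 - k / n) n β δ) i1 j1 h1 k1
  have F2 := I_mul_integral_eq_sub_conj (T := {ζ | ζ.re < 0 ∨ ζ.im = Real.pi}) (c := c / n)
    (e := e')
    (fun ζ hζ => modelIntegrand_conj hζ) (fun θ => Or.inl (by simpa using hcn))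
    (fun t _ => Or.inr (by simp))
    (modelIntegrand_periodic d (1 - k / n) n (effLevel x n) δ₀) i2 j2 h2 k2
  have hI : ∀ z : ℂ, ‖z‖ = ‖Complex.I * z‖ := fun z => by rw [norm_mul, Complex.norm_I, one_mul]
  rw [hI, mul_sub, F1, F2]
  have : Q - conj R - (Q' - conj R') = (Q - Q') - conj (R - R') := by rw [map_sub]; ring
  rw [this]
  refine (norm_sub_le _ _).trans ?_
  rw [RCLike.norm_conj]
  linarith

/-! ### Series evaluation of the model integral -/

/-- The Taylor coefficients of `(1 - σ)^{-h/2}`. -/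
def binomCoeff (h m : ℕ) : ℝ := Real.Gamma (m + h / 2) / (Real.Gamma (h / 2) * m !)

theorem binomCoeff_succ {h : ℕ} (hh : 0 < h) (m : ℕ) :
    (m + 1) * binomCoeff h (m + 1) = (m + h / 2) * binomCoeff h m := by
  have h1 : (0 : ℝ) < h := by exact_mod_cast hh
  have h2 : Real.Gamma ((m + 1 : ℕ) + (h : ℝ) / 2) = (m + h / 2) * Real.Gamma (m + h / 2) := by
    rw [← Real.Gamma_add_one (by positivity)]
    congr 1; push_cast; ring
  have h3 : Real.Gamma ((h : ℝ) / 2) ≠ 0 := (Real.Gamma_pos_of_pos (by positivity)).ne'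
  rw [binomCoeff, binomCoeff, h2, Nat.factorial_succ]
  push_cast
  field_simp

theorem binomCoeff_zero {h : ℕ} (hh : 0 < h) : binomCoeff h 0 = 1 := by
  have h1 : (0 : ℝ) < h := by exact_mod_cast hh
  have h3 : Real.Gamma ((h : ℝ) / 2) ≠ 0 := (Real.Gamma_pos_of_pos (by positivity)).ne'
  simp [binomCoeff, h3]

theorem cpow_neg_half_sq {z : ℂ} (hz : z ≠ 0) : (z ^ (-1 / 2 : ℂ)) ^ 2 = z⁻¹ := by
  rw [pow_two, ← Complex.cpow_add _ _ hz]
  norm_num [Complex.cpow_neg_one]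

theorem hasDerivAt_one_sub_cpow_pow (h : ℕ) {σ : ℂ} (hσ : ‖σ‖ < 1) :
    HasDerivAt (fun σ : ℂ => ((1 - σ) ^ (-1 / 2 : ℂ)) ^ h)
      (h / 2 * ((1 - σ) ^ (-1 / 2 : ℂ)) ^ h / (1 - σ)) σ := by
  have h1 := one_sub_mem_slitPlane hσ
  have h1' := Complex.slitPlane_ne_zero h1
  have d1 : HasDerivAt (fun σ : ℂ => (1 - σ) ^ (-1 / 2 : ℂ))
      ((-1 / 2) * (1 - σ) ^ (-1 / 2 - 1 : ℂ) * (-1)) σ :=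
    ((hasDerivAt_id σ).const_sub 1).cpow_const h1
  refine (d1.pow h).congr_deriv ?_
  rw [Complex.cpow_sub _ _ h1', Complex.cpow_one]
  cases h with
  | zero => simp
  | succ h =>
    rw [Nat.add_sub_cancel, pow_succ]
    field_simp

/-- Both sides satisfy (1 - σ)f' = (h/2)f with value 1 at 0. -/
theorem hasPS_binom {h : ℕ} (hh : 0 < h) :
    HasPS 1 (PowerSeries.mk fun m => (binomCoeff h m : ℂ))
      (fun σ => ((1 - σ) ^ (-1 / 2 : ℂ)) ^ h) := by
  have hd : DifferentiableOn ℂ (fun σ : ℂ => ((1 - σ) ^ (-1 / 2 : ℂ)) ^ h) (Metric.ball 0 1) :=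
    fun σ hσ => (hasDerivAt_one_sub_cpow_pow h
      (by simpa using hσ)).differentiableAt.differentiableWithinAt
  have h1 := HasPS.of_differentiableOn hd
  have h2 := HasPS.deriv_of_differentiableOn hd
  set f := PowerSeries.mk fun m =>
    iteratedDeriv m (fun σ : ℂ => ((1 - σ) ^ (-1 / 2 : ℂ)) ^ h) 0 / (m ! : ℂ) with hf
  have hode := ((HasPS.one.sub HasPS.X).mul h2).unique one_pos ((HasPS.C (h / 2 : ℂ)).mul h1)
    (fun z hz => by
      rw [(hasDerivAt_one_sub_cpow_pow h hz).deriv]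
      have := Complex.slitPlane_ne_zero (one_sub_mem_slitPlane hz)
      field_simp)
  have : f = PowerSeries.mk fun m => (binomCoeff h m : ℂ) := by
    refine eq_of_derivative_ode (by simp) hode ?_ ?_
    · ext m
      have key : ((m : ℂ) + 1) * binomCoeff h (m + 1) = (m + h / 2) * binomCoeff h m := by
        have := congrArg (fun t : ℝ => (t : ℂ)) (binomCoeff_succ hh m)
        push_cast at this
        exact this
      rw [PowerSeries.coeff_C_mul, PowerSeries.coeff_mk, sub_mul, one_mul, map_sub]
      cases m with
      | zero =>
        rw [PowerSeries.coeff_zero_X_mul, PowerSeries.coeff_derivative, PowerSeries.coeff_mk]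
        push_cast at key ⊢
        linear_combination key
      | succ m =>
        rw [PowerSeries.coeff_succ_X_mul, PowerSeries.coeff_derivative,
          PowerSeries.coeff_derivative, PowerSeries.coeff_mk, PowerSeries.coeff_mk]
        push_cast at key ⊢
        linear_combination key
    · simp [hf, binomCoeff_zero hh]
  exact this ▸ h1

/-- The expansion of `e^{δ z / 2} / (1 - k z)`. -/
def modelSeries (k : ℝ) (δ : ℂ) : PowerSeries ℂ :=
  (PowerSeries.mk fun j => (δ / 2) ^ j / (j ! : ℂ)) * PowerSeries.mk fun i => (k : ℂ) ^ i

theorem hasPS_modelSeries {k : ℝ} (hk : 0 < k) (δ : ℂ) :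
    HasPS (1 / k) (modelSeries k δ) (fun z => Complex.exp (δ / 2 * z) * (1 - k * z)⁻¹) := by
  refine HasPS.mul ?_ ?_
  · intro z _
    have := NormedSpace.expSeries_div_hasSum_exp (δ / 2 * z)
    rw [← Complex.exp_eq_exp_ℂ] at this
    refine this.congr_fun fun m => ?_
    rw [PowerSeries.coeff_mk, mul_pow]; ring
  · intro z hz
    have h1 : ‖(k : ℂ) * z‖ < 1 := by
      rw [norm_mul, Complex.norm_real, Real.norm_of_nonneg hk.le]
      rwa [lt_div_iff₀' hk] at hz
    refine (hasSum_geometric_of_norm_lt_one h1).congr_fun fun m => ?_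
    rw [PowerSeries.coeff_mk, mul_pow]

/-- With z = (1-σ)^{-1}/n one has τ - σ = (1-σ)(1 - kz), so everything except a power of 1 - σ is a
function of z. The factor (τ-σ)^{-1} raises the exponent from d to d + 2. -/
theorem modelIntegrand_eq {d n N : ℕ} {k : ℝ} {δ ζ : ℂ} (h1 : 1 - Complex.exp ζ ≠ 0) :
    modelIntegrand d (1 - k / n) n N δ ζ = ((2 : ℂ) ^ (-1 / 2 : ℂ)) ^ d *
      ((Complex.exp (δ / 2 * (((1 - Complex.exp ζ) ^ (-1 / 2 : ℂ)) ^ 2 / n)) *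
        (1 - k * (((1 - Complex.exp ζ) ^ (-1 / 2 : ℂ)) ^ 2 / n))⁻¹) *
      (((1 - Complex.exp ζ) ^ (-1 / 2 : ℂ)) ^ (d + 2) * Complex.exp ζ *
        Complex.exp (-(N * ζ)))) := by
  have h2 := cpow_neg_half_sq h1
  rw [modelIntegrand, pow_add, h2]
  set σ := Complex.exp ζ
  have e1 : δ / n / (2 * (1 - σ)) = δ / 2 * ((1 - σ)⁻¹ / n) := by
    rw [div_div, div_eq_mul_inv, div_eq_mul_inv, div_eq_mul_inv, mul_inv, mul_inv]; ring
  have e2 : (((1 - k / n : ℝ) : ℂ) - σ) = (1 - σ) * (1 - k * ((1 - σ)⁻¹ / n)) := by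
    push_cast
    field_simp
    ring
  rw [e1, e2, mul_inv]
  ring

theorem half_le_norm_one_sub {y : ℝ} (hy0 : 0 ≤ y) (hy1 : y ≤ 1) (θ : ℝ) :
    y / 2 ≤ ‖1 - Complex.exp (((-y : ℝ) : ℂ) + θ * Complex.I)‖ := by
  have h1 := norm_sub_norm_le (1 : ℂ) (Complex.exp (((-y : ℝ) : ℂ) + θ * Complex.I))
  rw [norm_one, norm_exp_line] at h1
  have h2 := Real.add_one_le_exp y
  have h3 : Real.exp (-y) ≤ 1 - y / 2 := by
    rw [Real.exp_neg]
    refine (inv_anti₀ (by linarith) h2).trans ?_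
    rw [inv_le_iff_one_le_mul₀ (by linarith)]
    nlinarith
  linarith

/-- The model integral as a series. -/
theorem hasSum_integral_modelIntegrand {d n N : ℕ} {k c : ℝ} (δ : ℂ) (hk : 0 < k)
    (hc : 10 * k ≤ c) (hn : 0 < n) (hcn1 : c / n ≤ 1) (hN : 0 < N) :
    HasSum (fun l : ℕ => ((2 : ℂ) ^ (-1 / 2 : ℂ)) ^ d * (PowerSeries.coeff l (modelSeries k δ) *
        (1 / n) ^ l * (2 * Real.pi * binomCoeff (d + 2 + 2 * l) (N - 1))))
      (∫ θ in (-Real.pi)..Real.pi, modelIntegrand d (1 - k / n) n N δ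
        (-((c / n : ℝ) : ℂ) + θ * Complex.I)) := by
  have hc0 : 0 < c := by linarith
  have hn' : (0 : ℝ) < n := by exact_mod_cast hn
  have hcn : 0 < c / n := by positivity
  obtain ⟨M, rfl⟩ := Nat.exists_eq_succ_of_ne_zero hN.ne'
  set s : ℝ → ℂ := fun θ => (1 - Complex.exp (((-(c / n) : ℝ) : ℂ) + θ * Complex.I)) ^ (-1 / 2 : ℂ)
    with hs
  have hlow : ∀ θ : ℝ, c / n / 2 ≤ ‖1 - Complex.exp (((-(c / n) : ℝ) : ℂ) + θ * Complex.I)‖ :=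
    half_le_norm_one_sub hcn.le hcn1
  have hne : ∀ θ : ℝ, 1 - Complex.exp (((-(c / n) : ℝ) : ℂ) + θ * Complex.I) ≠ 0 := fun θ =>
    norm_pos_iff.1 (lt_of_lt_of_le (by positivity) (hlow θ))
  have hs1 : ∀ θ, ‖s θ‖ ≤ (Real.sqrt (c / n / 2))⁻¹ := fun θ =>
    norm_cpow_neg_half_le (by positivity) (hlow θ)
  have hs2 : ∀ θ, ‖s θ ^ 2 / n‖ ≤ 2 / c := fun θ => by
    rw [hs, cpow_neg_half_sq (hne θ), norm_div, norm_inv, Complex.norm_natCast]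
    calc _ ≤ (c / n / 2)⁻¹ / n := by
          gcongr; exact hlow θ
      _ = 2 / c := by field_simp
  -- On the whole circle |z| ≤ 2/c, which lies inside the radius 1/k of convergence of the
  -- expansion.
  have h2c : 2 / c < 1 / k := by
    rw [div_lt_div_iff₀ hc0 hk]; linarith
  have hsum : Summable fun l => ‖PowerSeries.coeff l (modelSeries k δ)‖ * (2 / c) ^ l := by
    have := (hasPS_modelSeries hk δ ((2 / c : ℝ) : ℂ) (by
      rw [Complex.norm_real, Real.norm_of_nonneg (by positivity)]; exact h2c)).summable.norm
    refine this.congr fun l => ?_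
    rw [norm_mul, norm_pow, Complex.norm_real, Real.norm_of_nonneg (by positivity)]
  have hcont : Continuous s := by
    rw [hs]
    refine Continuous.cpow (by fun_prop) continuous_const fun θ => ?_
    refine one_sub_mem_slitPlane ?_
    rw [norm_exp_line, Real.exp_lt_one_iff]; linarith
  set B : ℝ := (Real.sqrt (c / n / 2))⁻¹ ^ (d + 2) * Real.exp (-(c / n)) *
    Real.exp ((M + 1) * (c / n)) with hB
  have hnN : ∀ θ : ℝ, ‖Complex.exp (-((M.succ : ℕ) * (((-(c / n) : ℝ) : ℂ) + θ * Complex.I)))‖ =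
      Real.exp ((M + 1) * (c / n)) := fun θ => by
    have e : (-((M.succ : ℕ) * (((-(c / n) : ℝ) : ℂ) + θ * Complex.I))).re =
        (M + 1) * (c / n) := by
      rw [Complex.neg_re, ← Complex.ofReal_natCast, Complex.re_ofReal_mul]; simp
    rw [Complex.norm_exp, e]
  have key := intervalIntegral.hasSum_integral_of_dominated_convergence (μ := MeasureTheory.volume)
    (a := -Real.pi) (b := Real.pi)
    (F := fun l θ => ((2 : ℂ) ^ (-1 / 2 : ℂ)) ^ d * (PowerSeries.coeff l (modelSeries k δ) *
      (s θ ^ 2 / n) ^ l * (s θ ^ (d + 2) * Complex.exp (((-(c / n) : ℝ) : ℂ) + θ * Complex.I) *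
        Complex.exp (-((M.succ : ℕ) * (((-(c / n) : ℝ) : ℂ) + θ * Complex.I))))))
    (f := fun θ => modelIntegrand d (1 - k / n) n M.succ δ
        (((-(c / n) : ℝ) : ℂ) + θ * Complex.I))
    (fun l _ => ‖((2 : ℂ) ^ (-1 / 2 : ℂ)) ^ d‖ *
      (‖PowerSeries.coeff l (modelSeries k δ)‖ * (2 / c) ^ l * B)) ?_ ?_ ?_ ?_ ?_
  · rw [← Complex.ofReal_neg]
    refine key.congr_fun fun l => ?_
    have e := (hasPS_binom (h := d + 2 + 2 * l) (by omega)).integral_eq (u := -(c / n))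
      (by rw [Real.exp_lt_one_iff]; linarith) M
    rw [PowerSeries.coeff_mk] at e
    rw [Nat.succ_sub_one, ← e, ← intervalIntegral.integral_const_mul,
      ← intervalIntegral.integral_const_mul]
    refine intervalIntegral.integral_congr fun θ _ => ?_
    have e2 : Complex.exp (((-(c / n) : ℝ) : ℂ) + θ * Complex.I) *
        Complex.exp (-((M.succ : ℕ) * (((-(c / n) : ℝ) : ℂ) + θ * Complex.I))) =
        Complex.exp (-(M * (((-(c / n) : ℝ) : ℂ) + θ * Complex.I))) := by
      rw [← Complex.exp_add]; congr 1; push_cast; ring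
    rw [mul_assoc (s θ ^ (d + 2)), e2, pow_add _ (d + 2), pow_mul, div_pow, one_pow, div_pow]
    ring
  · intro l
    exact Continuous.aestronglyMeasurable (by fun_prop)
  · intro l
    refine Filter.Eventually.of_forall fun θ _ => ?_
    rw [norm_mul, norm_mul, norm_mul, norm_mul, norm_mul, norm_pow (_ / _), norm_pow (s θ), hnN,
      norm_exp_line, hB]
    gcongr
    · exact hs2 θ
    · exact hs1 θ
  · exact Filter.Eventually.of_forall fun θ _ => (hsum.mul_right _).mul_left _
  · exact intervalIntegrable_const
  · refine Filter.Eventually.of_forall fun θ _ => ?_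
    rw [modelIntegrand_eq (hne θ)]
    have := hasPS_modelSeries hk δ (s θ ^ 2 / n) ((hs2 θ).trans_lt h2c)
    exact (this.mul_right _).mul_left _

/-! ### Gamma quotients, uniformly in the summation index -/

/-- `Γ(N + h/2) / (Γ(N) N^{h/2})`. -/
def gammaRatio (N h : ℕ) : ℝ := Real.Gamma (N + h / 2) / (Real.Gamma N * Real.sqrt N ^ h)

theorem gammaRatio_zero {N : ℕ} (hN : 0 < N) : gammaRatio N 0 = 1 := by
  have h1 : (0 : ℝ) < N := by exact_mod_cast hN
  have := (Real.Gamma_pos_of_pos h1).ne'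
  simp [gammaRatio, this]

theorem gammaRatio_add_two {N : ℕ} (hN : 0 < N) (h : ℕ) :
    gammaRatio N (h + 2) = gammaRatio N h * (1 + h / 2 / N) := by
  have h1 : (0 : ℝ) < N := by exact_mod_cast hN
  have h2 : Real.Gamma (N + ((h + 2 : ℕ) : ℝ) / 2) = (N + h / 2) * Real.Gamma (N + h / 2) := by
    rw [← Real.Gamma_add_one (by positivity)]
    congr 1; push_cast; ring
  have h3 : Real.Gamma N ≠ 0 := (Real.Gamma_pos_of_pos h1).ne'
  rw [gammaRatio, gammaRatio, h2, pow_add, Real.sq_sqrt h1.le]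
  have h4 : Real.sqrt N ≠ 0 := (Real.sqrt_pos.2 h1).ne'
  field_simp

/-- Log-convexity of Γ at the midpoint of x and x + 1. -/
theorem Gamma_add_half_le {x : ℝ} (hx : 0 < x) :
    Real.Gamma (x + 1 / 2) ≤ Real.Gamma x * Real.sqrt x := by
  have h := Real.Gamma_mul_add_mul_le_rpow_Gamma_mul_rpow_Gamma (s := x) (t := x + 1)
    (a := 1 / 2) (b := 1 / 2) hx (by linarith) (by norm_num) (by norm_num) (by norm_num)
  have e : 1 / 2 * x + 1 / 2 * (x + 1) = x + 1 / 2 := by ring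
  have hG := Real.Gamma_pos_of_pos hx
  rw [e, ← Real.sqrt_eq_rpow, ← Real.sqrt_eq_rpow, Real.Gamma_add_one hx.ne', mul_comm x,
    Real.sqrt_mul hG.le, ← mul_assoc, Real.mul_self_sqrt hG.le] at h
  exact h

/-- The upper bound is the midpoint inequality at N; the lower bound is the same inequality at N +
1/2, which reaches Γ(N + 1). -/
theorem abs_gammaRatio_one_sub_le {N : ℕ} (hN : 0 < N) : |gammaRatio N 1 - 1| ≤ 1 / N := by
  have h1 : (0 : ℝ) < N := by exact_mod_cast hN
  have hG := Real.Gamma_pos_of_pos h1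
  have hs := Real.sqrt_pos.2 h1
  have e1 := Gamma_add_half_le h1
  have e2 := Gamma_add_half_le (x := N + 1 / 2) (by positivity)
  have e3 : (N : ℝ) + 1 / 2 + 1 / 2 = N + 1 := by ring
  rw [e3, Real.Gamma_add_one h1.ne'] at e2
  have hT : gammaRatio N 1 = Real.Gamma (N + 1 / 2) / (Real.Gamma N * Real.sqrt N) := by
    simp [gammaRatio]
  have u1 : gammaRatio N 1 ≤ 1 := by
    rw [hT, div_le_one (by positivity)]; exact e1
  have e4 : Real.sqrt (N + 1 / 2) ≤ Real.sqrt N * (1 + 1 / N) := by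
    rw [Real.sqrt_le_left (by positivity), mul_pow, Real.sq_sqrt h1.le]
    have : (N : ℝ) * (1 + 1 / N) ^ 2 = N + 2 + 1 / N := by field_simp; ring
    rw [this]
    have : 0 < 1 / (N : ℝ) := by positivity
    linarith
  have u2 : 1 ≤ gammaRatio N 1 * (1 + 1 / N) := by
    rw [hT, div_mul_eq_mul_div, le_div_iff₀ (by positivity), one_mul]
    have hGp := Real.Gamma_pos_of_pos (show (0 : ℝ) < N + 1 / 2 by positivity)
    have := e2.trans (mul_le_mul_of_nonneg_left e4 hGp.le)
    have e5 : (N : ℝ) * Real.Gamma N = Real.sqrt N * (Real.Gamma N * Real.sqrt N) := by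
      nth_rewrite 1 [← Real.mul_self_sqrt h1.le]; ring
    rw [e5] at this
    refine le_of_mul_le_mul_left (this.trans_eq (by ring)) hs
  have u3 : 0 < 1 / (N : ℝ) := by positivity
  rw [abs_le]
  constructor <;> nlinarith

theorem exists_gammaRatio_bound : ∀ h : ℕ, ∃ C : ℝ, 0 ≤ C ∧ ∀ N : ℕ, 0 < N →
    |gammaRatio N h - 1| ≤ C / N
  | 0 => ⟨0, le_rfl, fun N hN => by simp [gammaRatio_zero hN]⟩
  | 1 => ⟨1, zero_le_one, fun N hN => abs_gammaRatio_one_sub_le hN⟩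
  | h + 2 => by
    obtain ⟨C, hC, hb⟩ := exists_gammaRatio_bound h
    refine ⟨C * (1 + h / 2) + h / 2, by positivity, fun N hN => ?_⟩
    have h1 : (1 : ℝ) ≤ N := by exact_mod_cast hN
    have h2 : (h : ℝ) / 2 / N ≤ h / 2 := div_le_self (by positivity) h1
    rw [gammaRatio_add_two hN]
    have e : gammaRatio N h * (1 + h / 2 / N) - 1 =
        (gammaRatio N h - 1) * (1 + h / 2 / N) + h / 2 / N := by ring
    rw [e]
    refine (abs_add_le _ _).trans ?_
    rw [abs_mul, abs_of_nonneg (by positivity : (0 : ℝ) ≤ 1 + h / 2 / N),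
      abs_of_nonneg (by positivity : (0 : ℝ) ≤ (h : ℝ) / 2 / N)]
    calc _ ≤ C / N * (1 + h / 2) + h / 2 / N := by gcongr; exact hb N hN
      _ = _ := by ring

/-- `∏_{i<l} (1 + (d/2 + i) / N)`. -/
def risingProd (d N l : ℕ) : ℝ := ∏ i ∈ Finset.range l, (1 + ((d : ℝ) / 2 + i) / N)

theorem risingProd_succ (d N l : ℕ) :
    risingProd d N (l + 1) = risingProd d N l * (1 + ((d : ℝ) / 2 + l) / N) :=
  Finset.prod_range_succ _ _

theorem one_le_risingProd (d N l : ℕ) : 1 ≤ risingProd d N l := by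
  induction l with
  | zero => simp [risingProd]
  | succ l ih =>
    rw [risingProd_succ]
    have : 0 ≤ ((d : ℝ) / 2 + l) / N := by positivity
    nlinarith

theorem gammaRatio_add_two_mul {N : ℕ} (hN : 0 < N) (d l : ℕ) :
    gammaRatio N (d + 2 * l) = gammaRatio N d * risingProd d N l := by
  induction l with
  | zero => simp [risingProd]
  | succ l ih =>
    rw [mul_add, ← add_assoc, mul_one, gammaRatio_add_two hN, ih, risingProd_succ]
    push_cast; ring

theorem risingProd_anti {N₀ N : ℕ} (hN₀ : 0 < N₀) (hN : N₀ ≤ N) (d l : ℕ) :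
    risingProd d N l ≤ risingProd d N₀ l := by
  have h0 : (0 : ℝ) < N₀ := by exact_mod_cast hN₀
  unfold risingProd
  gcongr

/-- The product is a polynomial in 1/N with nonnegative coefficients and constant term 1, so N times
its excess over 1 decreases in N. This yields a rate 1/N at a cost in l measured by the product at a
fixed N₀. -/
theorem mul_risingProd_sub_one_anti {N₀ N : ℕ} (hN₀ : 0 < N₀) (hN : N₀ ≤ N) (d l : ℕ) :
    N * (risingProd d N l - 1) ≤ N₀ * (risingProd d N₀ l - 1) := by
  have h0 : (0 : ℝ) < N₀ := by exact_mod_cast hN₀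
  have h1 : (0 : ℝ) < N := by exact_mod_cast hN₀.trans_le hN
  induction l with
  | zero => simp [risingProd]
  | succ l ih =>
    have e : ∀ M : ℕ, (0 : ℝ) < M → M * (risingProd d M (l + 1) - 1) =
        M * (risingProd d M l - 1) + risingProd d M l * ((d : ℝ) / 2 + l) := fun M hM => by
      rw [risingProd_succ]; field_simp; ring
    rw [e N h1, e N₀ h0]
    have := mul_le_mul_of_nonneg_right (risingProd_anti hN₀ hN d l)
      (by positivity : (0 : ℝ) ≤ (d : ℝ) / 2 + l)
    linarith

/-- Lets the factor d + 2l from differences of powers be absorbed into the same product. -/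
theorem add_le_mul_risingProd {N₀ : ℕ} (hN₀ : 0 < N₀) (d l : ℕ) :
    N₀ + l * ((d : ℝ) / 2) ≤ N₀ * risingProd d N₀ l := by
  have h0 : (0 : ℝ) < N₀ := by exact_mod_cast hN₀
  induction l with
  | zero => simp [risingProd]
  | succ l ih =>
    have e : N₀ * risingProd d N₀ (l + 1) =
        N₀ * risingProd d N₀ l + risingProd d N₀ l * ((d : ℝ) / 2 + l) := by
      rw [risingProd_succ]; field_simp
    have h1 := le_mul_of_one_le_left (by positivity : (0 : ℝ) ≤ (d : ℝ) / 2 + l)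
      (one_le_risingProd d N₀ l)
    have h2 : (0 : ℝ) ≤ l := Nat.cast_nonneg l
    rw [e]; push_cast; linarith

/-- With s = d/2 + l, consecutive terms have ratio (1 + s/N₀)/(s + 1), at most 2 always and at most
2/N₀ once l ≥ N₀. The first N₀ steps therefore lose at most a factor N₀ each. -/
theorem risingProd_div_Gamma_le {N₀ : ℕ} (hN₀ : 0 < N₀) (d l : ℕ) :
    risingProd d N₀ l / Real.Gamma ((d : ℝ) / 2 + l + 1) ≤
      (N₀ : ℝ) ^ N₀ / Real.Gamma ((d : ℝ) / 2 + 1) * (2 / N₀) ^ l := by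
  have h0 : (1 : ℝ) ≤ N₀ := by exact_mod_cast hN₀
  have hG : 0 < Real.Gamma ((d : ℝ) / 2 + 1) := Real.Gamma_pos_of_pos (by positivity)
  have key : risingProd d N₀ l / Real.Gamma ((d : ℝ) / 2 + l + 1) ≤
      (N₀ : ℝ) ^ (min l N₀) / Real.Gamma ((d : ℝ) / 2 + 1) * (2 / N₀) ^ l := by
    induction l with
    | zero => simp [risingProd]
    | succ l ih =>
      have e1 : Real.Gamma ((d : ℝ) / 2 + (l + 1 : ℕ) + 1) =
          ((d : ℝ) / 2 + l + 1) * Real.Gamma ((d : ℝ) / 2 + l + 1) := by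
        rw [← Real.Gamma_add_one (by positivity)]; congr 1; push_cast; ring
      have hG2 : 0 < Real.Gamma ((d : ℝ) / 2 + l + 1) := Real.Gamma_pos_of_pos (by positivity)
      set x : ℝ := (d : ℝ) / 2 + l with hx
      have hx0 : 0 ≤ x := by positivity
      have e2 : risingProd d N₀ (l + 1) / Real.Gamma ((d : ℝ) / 2 + (l + 1 : ℕ) + 1) =
          risingProd d N₀ l / Real.Gamma (x + 1) * ((1 + x / N₀) / (x + 1)) := by
        rw [e1, risingProd_succ, ← hx]
        field_simp
      rw [e2]
      have hf0 : 0 ≤ (1 + x / N₀) / (x + 1) := by positivity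
      refine (mul_le_mul_of_nonneg_right ih hf0).trans ?_
      rcases lt_or_ge l N₀ with h | h
      · rw [min_eq_left h.le, min_eq_left (by omega : l + 1 ≤ N₀), pow_succ (N₀ : ℝ) l,
          pow_succ _ l]
        have hf : (1 + x / N₀) / (x + 1) ≤ 2 := by
          rw [div_le_iff₀ (by positivity)]
          have := div_le_self hx0 h0
          linarith
        have e3 : (N₀ : ℝ) ^ l * N₀ / Real.Gamma ((d : ℝ) / 2 + 1) * ((2 / N₀) ^ l * (2 / N₀)) =
            (N₀ : ℝ) ^ l / Real.Gamma ((d : ℝ) / 2 + 1) * (2 / N₀) ^ l * 2 := by field_simp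
        rw [e3]
        gcongr
      · rw [min_eq_right h, min_eq_right (by omega : N₀ ≤ l + 1), pow_succ _ l, ← mul_assoc]
        have hf : (1 + x / N₀) / (x + 1) ≤ 2 / N₀ := by
          rw [div_le_div_iff₀ (by positivity) (by positivity)]
          have h' : (N₀ : ℝ) ≤ l := by exact_mod_cast h
          have hd : (0 : ℝ) ≤ (d : ℝ) / 2 := by positivity
          have : (1 + x / N₀) * N₀ = N₀ + x := by field_simp
          rw [this]; linarith
        gcongr
  refine key.trans ?_
  gcongr
  exact min_le_right _ _

theorem abs_pow_sub_pow_le_of_le_one {a b : ℝ} (ha0 : 0 ≤ a) (ha1 : a ≤ 1) (hb0 : 0 ≤ b)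
    (hb1 : b ≤ 1) (h : ℕ) : |a ^ h - b ^ h| ≤ h * |a - b| := by
  induction h with
  | zero => simp
  | succ h ih =>
    have e : a ^ (h + 1) - b ^ (h + 1) = a ^ h * (a - b) + (a ^ h - b ^ h) * b := by ring
    rw [e]
    refine (abs_add_le _ _).trans ?_
    rw [abs_mul, abs_mul, abs_of_nonneg hb0, abs_of_nonneg (pow_nonneg ha0 h)]
    calc a ^ h * |a - b| + |a ^ h - b ^ h| * b ≤ 1 * |a - b| + h * |a - b| * 1 := by
          gcongr
          exact pow_le_one₀ ha0 ha1
      _ = _ := by push_cast; ring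

theorem abs_sqrt_div_sqrt_sub_le {x : ℝ} (hx0 : 0 ≤ x) (hx2 : x < 2) {n : ℕ} (hn : 0 < n) :
    |Real.sqrt (effLevel x n) / Real.sqrt n - Real.sqrt (1 - x ^ 2 / 4)| ≤
      1 / Real.sqrt (1 - x ^ 2 / 4) / n := by
  have hn' : (0 : ℝ) < n := by exact_mod_cast hn
  have hx4 : x ^ 2 < 4 := by nlinarith
  set lam : ℝ := 1 - x ^ 2 / 4 with hlam
  have hl0 : 0 < lam := by rw [hlam]; linarith
  have g1 : lam ≤ effLevel x n / n := by
    rw [le_div_iff₀ hn']; exact le_effLevel hx0 hx2 n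
  have g2 : effLevel x n / n ≤ lam + 1 / n := by
    rw [div_le_iff₀ hn', add_mul, one_div_mul_cancel hn'.ne']; exact effLevel_le hx0 hx2 n
  rw [← Real.sqrt_div' _ hn'.le, abs_of_nonneg (sub_nonneg.2 (Real.sqrt_le_sqrt g1)),
    div_right_comm, le_div_iff₀ (Real.sqrt_pos.2 hl0)]
  set r : ℝ := effLevel x n / n with hr
  have hr0 : 0 ≤ r := hl0.le.trans g1
  have e1 := Real.mul_self_sqrt hr0
  have e2 := Real.mul_self_sqrt hl0.le
  have e3 := Real.sqrt_le_sqrt g1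
  have e4 := mul_le_mul_of_nonneg_left e3 (sub_nonneg.2 e3)
  have e5 : (Real.sqrt r - Real.sqrt lam) * Real.sqrt r ≥ 0 :=
    mul_nonneg (sub_nonneg.2 e3) (Real.sqrt_nonneg _)
  linarith

/-- All dependence on l is put into `risingProd d N₀ l`, so that one summable majorant serves every
n. -/
theorem abs_gammaRatio_mul_sub_le {d : ℕ} (hd : 0 < d) {x : ℝ} (hx0 : 0 ≤ x) (hx2 : x < 2)
    {N₀ : ℕ} (hN₀ : 0 < N₀) : ∃ K : ℝ, 0 ≤ K ∧ ∀ n : ℕ, 0 < n → N₀ ≤ effLevel x n → ∀ l : ℕ,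
      |gammaRatio (effLevel x n) (d + 2 * l) *
          (Real.sqrt (effLevel x n) / Real.sqrt n) ^ (d + 2 * l) -
        Real.sqrt (1 - x ^ 2 / 4) ^ (d + 2 * l)| ≤ K * risingProd d N₀ l / n := by
  have hx4 : x ^ 2 < 4 := by nlinarith
  set lam : ℝ := 1 - x ^ 2 / 4 with hlam
  have hl0 : 0 < lam := by rw [hlam]; linarith
  have hl1 : lam ≤ 1 := by rw [hlam]; linarith [sq_nonneg x]
  obtain ⟨C, hC, hCb⟩ := exists_gammaRatio_bound d
  refine ⟨(C + N₀) / lam + (d + 4) * N₀ * (1 / Real.sqrt lam), by positivity,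
    fun n hn hN l => ?_⟩
  have hn' : (0 : ℝ) < n := by exact_mod_cast hn
  have hNpos : 0 < effLevel x n := hN₀.trans_le hN
  have hN0' : (1 : ℝ) ≤ N₀ := by exact_mod_cast hN₀
  have hd1 : (1 : ℝ) ≤ d := by exact_mod_cast hd
  have hlow : lam * n ≤ effLevel x n := le_effLevel hx0 hx2 n
  have hup : (effLevel x n : ℝ) ≤ n := by exact_mod_cast effLevel_le_self x n
  have hsq := abs_sqrt_div_sqrt_sub_le hx0 hx2 hn
  rw [← hlam] at hsq
  set N := effLevel x n with hNd
  have hN' : (0 : ℝ) < N := by exact_mod_cast hNpos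
  have h1N : 1 / (N : ℝ) ≤ 1 / lam / n := by
    rw [div_div]; exact one_div_le_one_div_of_le (by positivity) hlow
  set P := risingProd d N₀ l with hP
  have hP1 : 1 ≤ P := one_le_risingProd d N₀ l
  have hQ1 : 1 ≤ risingProd d N l := one_le_risingProd d N l
  have hQP : risingProd d N l ≤ P := risingProd_anti hN₀ hN d l
  have hQ2 : risingProd d N l - 1 ≤ N₀ * P * (1 / N) := by
    have := mul_risingProd_sub_one_anti hN₀ hN d l
    rw [mul_one_div, le_div_iff₀ hN', mul_comm]
    refine this.trans ?_
    gcongr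
    linarith
  have hT : |gammaRatio N (d + 2 * l) - 1| ≤ (C + N₀) * P * (1 / N) := by
    rw [gammaRatio_add_two_mul hNpos]
    have e : gammaRatio N d * risingProd d N l - 1 =
        (gammaRatio N d - 1) * risingProd d N l + (risingProd d N l - 1) := by ring
    rw [e]
    refine (abs_add_le _ _).trans ?_
    rw [abs_mul, abs_of_nonneg (by linarith : 0 ≤ risingProd d N l),
      abs_of_nonneg (by linarith : 0 ≤ risingProd d N l - 1)]
    calc _ ≤ C / N * P + N₀ * P * (1 / N) := by
          gcongr
          exact hCb N hNpos
      _ = _ := by ring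
  set ρ := Real.sqrt N / Real.sqrt n with hρ
  have hρ0 : 0 ≤ ρ := by positivity
  have hρ1 : ρ ≤ 1 := div_le_one_of_le₀ (Real.sqrt_le_sqrt hup) (Real.sqrt_nonneg _)
  have hb1 : Real.sqrt lam ≤ 1 := Real.sqrt_le_one.2 hl1
  have hpow := abs_pow_sub_pow_le_of_le_one hρ0 hρ1 (Real.sqrt_nonneg lam) hb1 (d + 2 * l)
  have hh : ((d + 2 * l : ℕ) : ℝ) ≤ (d + 4) * N₀ * P := by
    have h1 := add_le_mul_risingProd hN₀ d l
    have h2 : (l : ℝ) * (1 / 2) ≤ l * ((d : ℝ) / 2) := by gcongr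
    have h3 : 1 + (l : ℝ) * (1 / 2) ≤ N₀ * P := by linarith
    have h4 : ((d : ℝ) + 4) * (1 + l * (1 / 2)) ≤ (d + 4) * (N₀ * P) := by gcongr
    have h5 : 0 ≤ (d : ℝ) * l := by positivity
    push_cast
    linarith
  have e : gammaRatio N (d + 2 * l) * ρ ^ (d + 2 * l) - Real.sqrt lam ^ (d + 2 * l) =
      (gammaRatio N (d + 2 * l) - 1) * ρ ^ (d + 2 * l) +
        (ρ ^ (d + 2 * l) - Real.sqrt lam ^ (d + 2 * l)) := by ring
  rw [e]
  refine (abs_add_le _ _).trans ?_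
  rw [abs_mul, abs_of_nonneg (pow_nonneg hρ0 _)]
  calc _ ≤ (C + N₀) * P * (1 / lam / n) * 1 +
        (d + 4) * N₀ * P * (1 / Real.sqrt lam / n) := by
        gcongr
        · exact hT.trans (by gcongr)
        · exact pow_le_one₀ hρ0 hρ1
        · exact hpow.trans (by gcongr)
    _ = _ := by ring

theorem binomCoeff_eq_gammaRatio {d N n : ℕ} (hN : 0 < N) (hn : 0 < n) (l : ℕ) :
    (Real.sqrt n ^ d)⁻¹ * ((1 / n) ^ l * binomCoeff (d + 2 + 2 * l) (N - 1)) =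
      gammaRatio N (d + 2 * l) * (Real.sqrt N / Real.sqrt n) ^ (d + 2 * l) /
        Real.Gamma ((d : ℝ) / 2 + l + 1) := by
  have hn' : (0 : ℝ) < n := by exact_mod_cast hn
  have hN' : (0 : ℝ) < N := by exact_mod_cast hN
  obtain ⟨M, rfl⟩ := Nat.exists_eq_succ_of_ne_zero hN.ne'
  have h1 : (Real.Gamma ((M.succ : ℕ) : ℝ)) = M ! := by
    rw [Nat.cast_succ, Real.Gamma_nat_eq_factorial]
  have e1 : (M : ℝ) + ((d + 2 + 2 * l : ℕ) : ℝ) / 2 =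
      (M.succ : ℕ) + ((d + 2 * l : ℕ) : ℝ) / 2 := by push_cast; ring
  have e2 : ((d + 2 + 2 * l : ℕ) : ℝ) / 2 = (d : ℝ) / 2 + l + 1 := by push_cast; ring
  have e3 : Real.sqrt n ^ (d + 2 * l) = Real.sqrt n ^ d * n ^ l := by
    rw [pow_add, pow_mul, Real.sq_sqrt hn'.le]
  have hs1 : Real.sqrt n ≠ 0 := (Real.sqrt_pos.2 hn').ne'
  have hs2 : Real.sqrt (M.succ : ℕ) ≠ 0 := (Real.sqrt_pos.2 hN').ne'
  have hG : Real.Gamma ((d : ℝ) / 2 + l + 1) ≠ 0 :=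
    (Real.Gamma_pos_of_pos (by positivity)).ne'
  rw [Nat.succ_sub_one, binomCoeff, gammaRatio, e1, e2, h1, div_pow (Real.sqrt _), e3, one_div_pow]
  field_simp

/-! ### Limit of the model integral and of the kernel integral -/

/-- Asymptotics of the model integral. -/
theorem modelIntegral_asymptotics {d : ℕ} (hd : 0 < d) {x k c : ℝ} (hx0 : 0 ≤ x) (hx2 : x < 2)
    (hk : 0 < k) (hc : 10 * k ≤ c) (δ : ℂ) : ∃ K : ℝ, ∀ᶠ n : ℕ in atTop,
      ‖(((Real.sqrt n ^ d)⁻¹ : ℝ) : ℂ) * ((2 * Real.pi : ℂ)⁻¹ * ∫ θ in (-Real.pi)..Real.pi,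
          modelIntegrand d (1 - k / n) n (effLevel x n) δ
            (-((c / n : ℝ) : ℂ) + θ * Complex.I)) -
        ((2 : ℂ) ^ (-1 / 2 : ℂ)) ^ d * ∑' l : ℕ, PowerSeries.coeff l (modelSeries k δ) *
          ((Real.sqrt (1 - x ^ 2 / 4) ^ (d + 2 * l) /
            Real.Gamma ((d : ℝ) / 2 + l + 1) : ℝ) : ℂ)‖ ≤ K / n := by
  have hc0 : 0 < c := by linarith
  have hx4 : x ^ 2 < 4 := by nlinarith
  set lam : ℝ := 1 - x ^ 2 / 4 with hlam
  have hl0 : 0 < lam := by rw [hlam]; linarith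
  have hl1 : lam ≤ 1 := by rw [hlam]; linarith [sq_nonneg x]
  -- The majorant decays like (2/N₀)^l, while the coefficients of `modelSeries` have convergence
  -- radius at least 1/k; 2/N₀ < 1/k is what makes the product summable.
  obtain ⟨N₀, hN₀k⟩ := exists_nat_gt (2 * k)
  have hN₀' : (0 : ℝ) < N₀ := lt_trans (by positivity) hN₀k
  have hN₀ : 0 < N₀ := by exact_mod_cast hN₀'
  obtain ⟨K, hK, hKb⟩ := abs_gammaRatio_mul_sub_le hd hx0 hx2 hN₀
  set a : ℕ → ℂ := fun l => PowerSeries.coeff l (modelSeries k δ) with ha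
  set g : ℕ → ℝ := fun l => risingProd d N₀ l / Real.Gamma ((d : ℝ) / 2 + l + 1) with hg
  have hG : ∀ l : ℕ, 0 < Real.Gamma ((d : ℝ) / 2 + l + 1) := fun l =>
    Real.Gamma_pos_of_pos (by positivity)
  have hg0 : ∀ l, 0 ≤ g l := fun l =>
    div_nonneg (zero_le_one.trans (one_le_risingProd d N₀ l)) (hG l).le
  have hsum : Summable fun l => ‖a l‖ * g l := by
    have h1 : (2 : ℝ) / N₀ < 1 / k := by
      rw [div_lt_div_iff₀ hN₀' hk]; linarith
    have h2 := (hasPS_modelSeries hk δ ((2 / N₀ : ℝ) : ℂ) (by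
      rw [Complex.norm_real, Real.norm_of_nonneg (by positivity)]; exact h1)).summable.norm
    refine Summable.of_nonneg_of_le (fun l => mul_nonneg (norm_nonneg _) (hg0 l)) (fun l => ?_)
      (h2.mul_left ((N₀ : ℝ) ^ N₀ / Real.Gamma ((d : ℝ) / 2 + 1)))
    rw [norm_mul, norm_pow, Complex.norm_real, Real.norm_of_nonneg (by positivity)]
    calc ‖a l‖ * g l ≤ ‖a l‖ * ((N₀ : ℝ) ^ N₀ / Real.Gamma ((d : ℝ) / 2 + 1) * (2 / N₀) ^ l) :=
          mul_le_mul_of_nonneg_left (risingProd_div_Gamma_le hN₀ d l) (norm_nonneg _)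
      _ = _ := by rw [ha]; ring
  have hlim : Summable fun l => a l *
      ((Real.sqrt lam ^ (d + 2 * l) / Real.Gamma ((d : ℝ) / 2 + l + 1) : ℝ) : ℂ) := by
    refine Summable.of_norm_bounded hsum fun l => ?_
    rw [norm_mul, Complex.norm_real, Real.norm_of_nonneg (div_nonneg (by positivity) (hG l).le)]
    refine mul_le_mul_of_nonneg_left (div_le_div_of_nonneg_right ?_ (hG l).le) (norm_nonneg _)
    exact (pow_le_one₀ (Real.sqrt_nonneg _) (Real.sqrt_le_one.2 hl1)).trans
      (one_le_risingProd d N₀ l)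
  set c₂ : ℂ := ((2 : ℂ) ^ (-1 / 2 : ℂ)) ^ d with hc₂
  refine ⟨‖c₂‖ * (K * ∑' l, ‖a l‖ * g l), ?_⟩
  have ev1 : ∀ᶠ n : ℕ in atTop, c / n ≤ 1 :=
    (tendsto_const_div_atTop_nhds_zero_nat c).eventually_le_const (by positivity)
  have ev2 : ∀ᶠ n : ℕ in atTop, N₀ ≤ effLevel x n := by
    have : Tendsto (fun n : ℕ => lam * (n : ℝ)) atTop atTop :=
      tendsto_natCast_atTop_atTop.const_mul_atTop hl0
    filter_upwards [this.eventually_ge_atTop (N₀ : ℝ)] with n hn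
    exact_mod_cast hn.trans (le_effLevel hx0 hx2 n)
  filter_upwards [ev1, ev2, eventually_gt_atTop 0] with n hn1 hn2 hn
  have hn' : (0 : ℝ) < n := by exact_mod_cast hn
  have hN : 0 < effLevel x n := hN₀.trans_le hn2
  have hS := ((hasSum_integral_modelIntegrand (d := d) δ hk hc hn hn1 hN).mul_left
    (2 * Real.pi : ℂ)⁻¹).mul_left (((Real.sqrt n ^ d)⁻¹ : ℝ) : ℂ)
  have hpi : (Real.pi : ℂ) ≠ 0 := by exact_mod_cast Real.pi_ne_zero
  have hD := hS.sub (hlim.hasSum.mul_left c₂)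
  have hB : HasSum (fun l => ‖c₂‖ * (K * (‖a l‖ * g l)) / n)
      (‖c₂‖ * (K * ∑' l, ‖a l‖ * g l) / n) :=
    ((hsum.hasSum.mul_left K).mul_left _).div_const _
  refine hD.norm_le_of_bounded hB fun l => ?_
  have e := binomCoeff_eq_gammaRatio (d := d) hN hn l
  have e' : (((Real.sqrt n ^ d)⁻¹ : ℝ) : ℂ) * ((2 * Real.pi : ℂ)⁻¹ *
      (c₂ * (PowerSeries.coeff l (modelSeries k δ) * (1 / n) ^ l *
        (2 * Real.pi * binomCoeff (d + 2 + 2 * l) (effLevel x n - 1))))) -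
      c₂ * (a l * ((Real.sqrt lam ^ (d + 2 * l) / Real.Gamma ((d : ℝ) / 2 + l + 1) : ℝ) : ℂ)) =
      c₂ * (a l * (((gammaRatio (effLevel x n) (d + 2 * l) *
        (Real.sqrt (effLevel x n) / Real.sqrt n) ^ (d + 2 * l) - Real.sqrt lam ^ (d + 2 * l)) /
          Real.Gamma ((d : ℝ) / 2 + l + 1) : ℝ) : ℂ)) := by
    rw [sub_div, ← e, ha]
    push_cast
    field_simp
  rw [e', norm_mul, norm_mul, Complex.norm_real, norm_div, Real.norm_eq_abs,
    Real.norm_of_nonneg (hG l).le]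
  have hb := hKb n hn hn2 l
  calc _ ≤ ‖c₂‖ * (‖a l‖ * (K * risingProd d N₀ l / n / Real.Gamma ((d : ℝ) / 2 + l + 1))) := by
        have := (hG l).le
        gcongr
    _ = _ := by rw [hg]; ring

/-- Rearrangement of the limit of the model integral. -/
theorem tsum_modelSeries {d : ℕ} (hd : 0 < d) {k lam : ℝ} (hk : 0 ≤ k) (hlam : 0 ≤ lam) (δ : ℂ) :
    ∑' l : ℕ, PowerSeries.coeff l (modelSeries k δ) *
        ((Real.sqrt lam ^ (d + 2 * l) / Real.Gamma ((d : ℝ) / 2 + l + 1) : ℝ) : ℂ) =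
      ((Real.sqrt lam ^ d * Real.exp (k * lam) : ℝ) : ℂ) *
        ∑' j : ℕ, (δ * lam / 2) ^ j / (j ! : ℂ) * (incGamma (2 * j + d) (k * lam) : ℂ) := by
  set A : ℝ := k * lam with hA
  have hA0 : 0 ≤ A := mul_nonneg hk hlam
  -- Splitting l = j + i separates the exponential series in δ from the geometric series in k.
  -- Summing over i at fixed j gives e^A `incGamma (2 * j + d) A`; summing over antidiagonals
  -- returns the left side.
  set F : ℕ × ℕ → ℂ := fun p => (δ * lam / 2) ^ p.1 / (p.1 ! : ℂ) *
    ((A ^ p.2 / Real.Gamma ((d : ℝ) / 2 + (p.1 + p.2 : ℕ) + 1) : ℝ) : ℂ) with hF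
  have hGam : ∀ j i : ℕ, ((2 * j + d : ℕ) : ℝ) / 2 + i + 1 = (d : ℝ) / 2 + (j + i : ℕ) + 1 :=
    fun j i => by push_cast; ring
  have hG : 0 < Real.Gamma ((d : ℝ) / 2 + 1) := Real.Gamma_pos_of_pos (by positivity)
  have hin : ∀ j : ℕ, HasSum (fun i : ℕ => A ^ i / Real.Gamma ((d : ℝ) / 2 + (j + i : ℕ) + 1))
      (Real.exp A * incGamma (2 * j + d) A) := fun j => by
    have := (hasSum_incGamma (h := 2 * j + d) (by omega) hA0).mul_left (Real.exp A)
    refine this.congr_fun fun i => ?_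
    rw [← mul_assoc, ← Real.exp_add, add_neg_cancel, Real.exp_zero, one_mul, hGam]
  have hpos : ∀ j i : ℕ, 0 ≤ A ^ i / Real.Gamma ((d : ℝ) / 2 + (j + i : ℕ) + 1) := fun j i =>
    div_nonneg (by positivity) (Real.Gamma_nonneg_of_nonneg (by positivity))
  have hnorm : ∀ p : ℕ × ℕ, ‖F p‖ = (‖δ * lam / 2‖ ^ p.1 / p.1 !) *
      (A ^ p.2 / Real.Gamma ((d : ℝ) / 2 + (p.1 + p.2 : ℕ) + 1)) := fun p => by
    rw [hF, norm_mul, norm_div, norm_pow, Complex.norm_natCast, Complex.norm_real,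
      Real.norm_of_nonneg (hpos _ _)]
  have hFs : Summable F := by
    rw [← summable_norm_iff]
    refine (summable_prod_of_nonneg fun p => norm_nonneg _).2 ⟨fun j => ?_, ?_⟩
    · simp only [hnorm]
      exact (hin j).summable.mul_left _
    · simp only [hnorm, tsum_mul_left, (hin _).tsum_eq]
      refine Summable.of_nonneg_of_le
        (f := fun j : ℕ => ‖δ * lam / 2‖ ^ j / j ! * (Real.exp A * (1 / Real.Gamma ((d : ℝ) / 2 + 1))))
        (fun j => ?_) (fun j => ?_)
        ((Real.summable_pow_div_factorial _).mul_right _)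
      · have := incGamma_nonneg (2 * j + d) A
        positivity
      · have h1 := incGamma_le (h := 2 * j + d) (by omega) hA0
        have h2 := factorial_mul_Gamma_le (s := (d : ℝ) / 2) (by positivity) j
        have h3 : Real.Gamma ((d : ℝ) / 2 + 1) ≤ Real.Gamma (((2 * j + d : ℕ) : ℝ) / 2 + 1) := by
          have e : ((2 * j + d : ℕ) : ℝ) / 2 + 1 = (d : ℝ) / 2 + j + 1 := by push_cast; ring
          rw [e]
          exact (le_mul_of_one_le_left hG.le (by exact_mod_cast Nat.factorial_pos j)).trans h2
        gcongr
        exact h1.trans (one_div_le_one_div_of_le hG h3)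
  have e1 : ∑' p, F p = (Real.exp A : ℂ) *
      ∑' j : ℕ, (δ * lam / 2) ^ j / (j ! : ℂ) * (incGamma (2 * j + d) A : ℂ) := by
    rw [hFs.tsum_prod, ← tsum_mul_left]
    refine tsum_congr fun j => ?_
    have := ((Complex.hasSum_ofReal.2 (hin j)).mul_left ((δ * lam / 2) ^ j / (j ! : ℂ))).tsum_eq
    rw [hF, this]
    push_cast; ring
  have e2 : ∑' p, F p = ∑' l : ℕ, ∑ p ∈ Finset.HasAntidiagonal.antidiagonal l, F p := by
    have hs := Finset.HasAntidiagonal.sigmaAntidiagonalEquivProd.summable_iff.2 hFs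
    rw [← Finset.HasAntidiagonal.sigmaAntidiagonalEquivProd.tsum_eq F]
    refine (hs.tsum_sigma' fun l => (hasSum_fintype _).summable).trans (tsum_congr fun l => ?_)
    rw [tsum_fintype]
    exact Finset.sum_coe_sort _ F
  have e3 : ∀ l : ℕ, PowerSeries.coeff l (modelSeries k δ) *
      ((Real.sqrt lam ^ (d + 2 * l) / Real.Gamma ((d : ℝ) / 2 + l + 1) : ℝ) : ℂ) =
      ((Real.sqrt lam ^ d : ℝ) : ℂ) * ∑ p ∈ Finset.HasAntidiagonal.antidiagonal l, F p := fun l => by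
    rw [modelSeries, PowerSeries.coeff_mul, Finset.sum_mul, Finset.mul_sum]
    refine Finset.sum_congr rfl fun p hp => ?_
    have hp' := Finset.HasAntidiagonal.mem_antidiagonal.1 hp
    rw [PowerSeries.coeff_mk, PowerSeries.coeff_mk, hF, ← hp', pow_add (Real.sqrt lam), pow_mul,
      Real.sq_sqrt hlam, pow_add lam, hA]
    push_cast
    rw [mul_div_right_comm δ, mul_pow (δ / 2), mul_pow (k : ℂ)]
    ring
  rw [tsum_congr e3, tsum_mul_left, ← e2, e1]
  push_cast; ring

/-- Asymptotics of the kernel integral. -/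
theorem kernelIntegral_asymptotics {d : ℕ} (hd : 0 < d) {x k C : ℝ} (hx0 : 0 ≤ x) (hx2 : x < 2)
    (hk : 0 < k) (hC : 0 ≤ C) {β δ : ℕ → ℂ} {δ₀ : ℂ}
    (hadm : ∀ᶠ n : ℕ in atTop, Admissible x C n (β n) (δ n))
    (hδ : ∀ᶠ n : ℕ in atTop, ‖δ n - δ₀ / n‖ ≤ C / n ^ 2) :
    (fun n : ℕ => (((Real.sqrt n ^ d)⁻¹ : ℝ) : ℂ) * ((2 * Real.pi : ℂ)⁻¹ *
        ∫ θ in (-Real.pi)..Real.pi, kernelIntegrand d x (1 - k / n) n (β n) (δ n)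
          (-((10 * k / n : ℝ) : ℂ) + θ * Complex.I)) -
      ((2 : ℂ) ^ (-1 / 2 : ℂ)) ^ d * (((Real.sqrt (1 - x ^ 2 / 4) ^ d *
        Real.exp (k * (1 - x ^ 2 / 4)) : ℝ) : ℂ) *
          ∑' j : ℕ, (δ₀ * (1 - x ^ 2 / 4 : ℝ) / 2) ^ j / (j ! : ℂ) *
            (incGamma (2 * j + d) (k * (1 - x ^ 2 / 4)) : ℂ)))
      =O[atTop] fun n : ℕ => 1 / (n : ℝ) := by
  have hx4 : x ^ 2 < 4 := by nlinarith
  obtain ⟨a, η₀, ha0, ha, hη₀, hfar⟩ : ∃ a η₀ : ℝ, 0 < a ∧ a ≤ 1 / 4 ∧ 0 < η₀ ∧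
      ∀ η, 0 < η → η ≤ η₀ → FarBound d x k (10 * k) C a η := by
    -- At the centre x = 0 there is no saddle separate from -1, hence the different far contour.
    rcases hx0.eq_or_lt with rfl | hx
    · exact ⟨1 / 4, 1, by norm_num, le_rfl, one_pos, fun η h1 h2 =>
        farBound_zero d k (by positivity) h1 h2⟩
    · exact farBound_pos hd hx hx2 k (by positivity) hC
  obtain ⟨K₁, hK₁⟩ := integral_comparison (D := ‖δ₀‖) hx0 hx2 hk le_rfl hC ha0 ha hη₀ hfar
  obtain ⟨K₂, hK₂⟩ := modelIntegral_asymptotics hd hx0 hx2 hk le_rfl δ₀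
  rw [← tsum_modelSeries hd hk.le (by linarith) δ₀]
  refine IsBigO.of_bound (‖(2 * Real.pi : ℂ)⁻¹‖ * K₁ + K₂) ?_
  filter_upwards [hK₁, hK₂, hadm, hδ, eventually_gt_atTop 0] with n h1 h2 h3 h4 hn
  have hn' : (0 : ℝ) < n := by exact_mod_cast hn
  have hs : 0 < Real.sqrt n ^ d := pow_pos (Real.sqrt_pos.2 hn') d
  have h5 := h1 (β n) (δ n) δ₀ h3 h4 le_rfl
  set I₁ := ∫ θ in (-Real.pi)..Real.pi, kernelIntegrand d x (1 - k / n) n (β n) (δ n)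
    (-((10 * k / n : ℝ) : ℂ) + θ * Complex.I)
  set I₂ := ∫ θ in (-Real.pi)..Real.pi, modelIntegrand d (1 - k / n) n (effLevel x n) δ₀
    (-((10 * k / n : ℝ) : ℂ) + θ * Complex.I)
  have e : ∀ s p L : ℂ, s * (p * I₁) - L = s * (p * (I₁ - I₂)) + (s * (p * I₂) - L) :=
    fun s p L => by ring
  rw [e, Real.norm_of_nonneg (by positivity)]
  refine (norm_add_le _ _).trans ?_
  have h6 : ‖(((Real.sqrt n ^ d)⁻¹ : ℝ) : ℂ) * ((2 * Real.pi : ℂ)⁻¹ * (I₁ - I₂))‖ ≤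
      ‖(2 * Real.pi : ℂ)⁻¹‖ * K₁ / n := by
    rw [norm_mul, norm_mul, Complex.norm_real, Real.norm_of_nonneg (by positivity)]
    calc _ ≤ (Real.sqrt n ^ d)⁻¹ * (‖(2 * Real.pi : ℂ)⁻¹‖ * (K₁ * (Real.sqrt n ^ d / n))) := by
          gcongr
      _ = _ := by field_simp
  calc _ ≤ ‖(2 * Real.pi : ℂ)⁻¹‖ * K₁ / n + K₂ / n := add_le_add h6 h2
    _ = _ := by ring

/-! ### The kernel as a contour integral -/

theorem sqrt_weight_mul (τ : ℝ) (z w : ℂ) : Real.sqrt (weight τ z * weight τ w) =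
    Real.exp (-((z.re ^ 2 + w.re ^ 2) / (2 * (1 + τ))) -
      (z.im ^ 2 + w.im ^ 2) / (2 * (1 - τ))) := by
  rw [weight, weight, ← Real.exp_add, ← Real.exp_half]
  congr 1
  rw [mul_comm 2 (1 + τ), mul_comm 2 (1 - τ), ← div_div, ← div_div]
  ring

/-- The kernel as a contour integral. -/
theorem planarKernel_eq {d n : ℕ} {τ u : ℝ} (hτ0 : 0 < τ) (hτ1 : τ ≤ 1) (hn : 0 < n)
    (hu : Real.exp u < τ) (x : ℝ) (Z W : Fin d → ℂ) :
    planarKernel d τ n Z W = (1 / (Real.pi ^ d * (1 - τ ^ 2) ^ ((d : ℝ) / 2)) : ℝ) *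
      (Complex.exp ((-((∑ k, ((Z k).re ^ 2 + (W k).re ^ 2)) / (2 * (1 + τ))) -
        (∑ k, ((Z k).im ^ 2 + (W k).im ^ 2)) / (2 * (1 - τ)) : ℝ) +
          (∑ k, (Z k ^ 2 + conj (W k) ^ 2)) / (2 * τ) / 2) *
      (τ ^ n * ((2 * Real.pi : ℂ)⁻¹ * ∫ θ in (-Real.pi)..Real.pi, kernelIntegrand d x τ n
        ((∑ k, (Z k ^ 2 + conj (W k) ^ 2)) / (2 * τ) - n * (x : ℂ) ^ 2)
        (-(∑ k, (Z k - conj (W k)) ^ 2) / (2 * τ)) (u + θ * Complex.I)))) := by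
  set r : ℂ := (Real.sqrt (2 * τ) : ℂ) with hr
  have hτ' : (τ : ℂ) ≠ 0 := by exact_mod_cast hτ0.ne'
  have hr2 : r ^ 2 = 2 * τ := by
    rw [hr, ← Complex.ofReal_pow, Real.sq_sqrt (by positivity)]; push_cast; ring
  have hr0 : r ≠ 0 := by
    intro h
    rw [h] at hr2
    exact mul_ne_zero two_ne_zero hτ' (by rw [← hr2]; simp)
  set b : ℂ := (∑ k, (Z k ^ 2 + conj (W k) ^ 2)) / (2 * τ) with hb
  set δ : ℂ := -(∑ k, (Z k - conj (W k)) ^ 2) / (2 * τ) with hδ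
  have hsq : ∑ k, ((Z k / r) ^ 2 + (conj (W k) / r) ^ 2) = b := by
    rw [hb, ← hr2, Finset.sum_div]
    exact Finset.sum_congr rfl fun k _ => by rw [div_pow, div_pow, add_div]
  have hxy : 2 * ∑ k, Z k / r * (conj (W k) / r) = δ + b := by
    rw [hb, hδ, ← hr2, ← add_div, ← Finset.sum_neg_distrib, ← Finset.sum_add_distrib,
      Finset.sum_div, Finset.mul_sum]
    exact Finset.sum_congr rfl fun k _ => by field_simp; ring
  have hterm : ∀ j : Fin d → ℕ,
      (((τ / 2) ^ (∑ k, j k) / (∏ k, ((j k)! : ℝ)) : ℝ) : ℂ) *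
        ∏ k, ((Real.sqrt (weight τ (Z k) * weight τ (W k)) : ℝ) : ℂ) *
          hermiteH (j k) (Z k / r) * conj (hermiteH (j k) (W k / r)) =
      (∏ k, ((Real.sqrt (weight τ (Z k) * weight τ (W k)) : ℝ) : ℂ)) *
        ((τ : ℂ) ^ (∑ k, j k) * ∏ k, (hermiteH (j k) (Z k / r) *
          hermiteH (j k) (conj (W k) / r) / (2 ^ (j k) * ((j k)! : ℂ)))) := fun j => by
    have hc : ∀ k, conj (hermiteH (j k) (W k / r)) = hermiteH (j k) (conj (W k) / r) := fun k => by
      rw [conj_hermiteH, map_div₀, hr, Complex.conj_ofReal]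
    simp only [hc]
    rw [Finset.prod_div_distrib, Finset.prod_mul_distrib, Finset.prod_mul_distrib,
      Finset.prod_mul_distrib, Finset.prod_mul_distrib, Finset.prod_pow_eq_pow_sum]
    push_cast
    rw [div_pow]
    field_simp
  have hw : ∏ k, ((Real.sqrt (weight τ (Z k) * weight τ (W k)) : ℝ) : ℂ) =
      Complex.exp ((-((∑ k, ((Z k).re ^ 2 + (W k).re ^ 2)) / (2 * (1 + τ))) -
        (∑ k, ((Z k).im ^ 2 + (W k).im ^ 2)) / (2 * (1 - τ)) : ℝ)) := by
    simp only [sqrt_weight_mul]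
    rw [← Complex.ofReal_exp, ← Complex.ofReal_prod, ← Real.exp_sum, Finset.sum_sub_distrib,
      Finset.sum_neg_distrib, Finset.sum_div, Finset.sum_div]
  have hmeh := hasPS_prod_mehlerSeries (fun k => Z k / r) (fun k => conj (W k) / r)
  have hint := hmeh.sum_range_eq_integral hτ0 hτ1 hu hn
  have hker : ∀ θ : ℝ, ((1 - Complex.exp (u + θ * Complex.I)) ^ (-1 / 2 : ℂ)) ^ d *
      ((1 + Complex.exp (u + θ * Complex.I)) ^ (-1 / 2 : ℂ)) ^ d *
        Complex.exp ((2 * (∑ k, Z k / r * (conj (W k) / r)) * Complex.exp (u + θ * Complex.I) -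
          (∑ k, ((Z k / r) ^ 2 + (conj (W k) / r) ^ 2)) * Complex.exp (u + θ * Complex.I) ^ 2) /
          (1 - Complex.exp (u + θ * Complex.I) ^ 2)) * (τ - Complex.exp (u + θ * Complex.I))⁻¹ *
          Complex.exp (u + θ * Complex.I) * Complex.exp (-(n * (u + θ * Complex.I))) =
      Complex.exp (b / 2) * kernelIntegrand d x τ n (b - n * (x : ℂ) ^ 2) δ
        (u + θ * Complex.I) := fun θ => by
    have hσ : ‖Complex.exp (u + θ * Complex.I)‖ < 1 := by rw [norm_exp_line]; linarith
    rw [hsq, hxy, kernelIntegrand]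
    set σ := Complex.exp (u + θ * Complex.I) with hσd
    have n1 := Complex.slitPlane_ne_zero (one_sub_mem_slitPlane hσ)
    have n2 := Complex.slitPlane_ne_zero (one_add_mem_slitPlane hσ)
    -- The Mehler exponent splits into a constant b/2, a Cayley term regular at σ = 1, and δ times
    -- the only part singular there. The main part nx² of b then joins σ^{-n} in the large exponent.
    have e1 : ((δ + b) * σ - b * σ ^ 2) / (1 - σ ^ 2) =
        b / 2 + b * ((σ - 1) / (2 * (1 + σ))) + δ * (σ / (1 - σ ^ 2)) := by
      have : 1 - σ ^ 2 = (1 - σ) * (1 + σ) := by ring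
      rw [this]; field_simp; ring
    have e2 : ∀ q : ℂ, Complex.exp (b / 2 + b * q + δ * (σ / (1 - σ ^ 2))) *
        Complex.exp (-(n * (u + θ * Complex.I))) = Complex.exp (b / 2) *
        (Complex.exp ((b - n * (x : ℂ) ^ 2) * q + δ * (σ / (1 - σ ^ 2))) *
          Complex.exp (n * ((x : ℂ) ^ 2 * q - (u + θ * Complex.I)))) := fun q => by
      rw [← Complex.exp_add, ← Complex.exp_add, ← Complex.exp_add]
      congr 1; ring
    rw [e1]
    linear_combination (((1 - σ) ^ (-1 / 2 : ℂ)) ^ d * ((1 + σ) ^ (-1 / 2 : ℂ)) ^ d *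
      (τ - σ)⁻¹ * σ) * e2 ((σ - 1) / (2 * (1 + σ)))
  rw [planarKernel, ← hr]
  simp only [hterm]
  rw [← Finset.mul_sum, sum_multiIndices d n (fun k j => hermiteH j (Z k / r) *
    hermiteH j (conj (W k) / r) / (2 ^ j * (j ! : ℂ)))]
  change _ * (_ * ∑ m ∈ Finset.range n,
    PowerSeries.coeff m (∏ k, mehlerSeries (Z k / r) (conj (W k) / r)) * (τ : ℂ) ^ m) = _
  rw [hint]
  simp only [hker]
  rw [intervalIntegral.integral_const_mul, hw, Complex.exp_add]
  ring

/-! ### Limits with rate 1/n -/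

/-- `f n = a + O(1/n)`. -/
def HasRate (f : ℕ → ℂ) (a : ℂ) : Prop := (fun n => f n - a) =O[atTop] fun n : ℕ => 1 / (n : ℝ)

theorem isBigO_one_div_nat_one : (fun n : ℕ => 1 / (n : ℝ)) =O[atTop] fun _ => (1 : ℝ) :=
  tendsto_one_div_atTop_nhds_zero_nat.isBigO_one ℝ

namespace HasRate

variable {f g : ℕ → ℂ} {a b : ℂ}

theorem isBigO (h : HasRate f a) : (fun n => f n - a) =O[atTop] fun n : ℕ => 1 / (n : ℝ) := h

theorem const (a : ℂ) : HasRate (fun _ => a) a := by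
  simpa [HasRate] using isBigO_zero _ _

theorem mul (hf : HasRate f a) (hg : HasRate g b) : HasRate (fun n => f n * g n) (a * b) := by
  have h1 : (fun n => (f n - a) * (g n - b)) =O[atTop] fun n : ℕ => 1 / (n : ℝ) := by
    have h2 : (fun n => g n - b) =O[atTop] fun _ => (1 : ℝ) := hg.isBigO.trans isBigO_one_div_nat_one
    simpa using hf.isBigO.mul h2
  have h2 := (h1.add (hf.const_mul_left b)).add (hg.const_mul_left a)
  refine h2.congr_left fun n => ?_
  ring

/-- Factors that are functions of y = 1/n acquire the rate from differentiability at y = 0. -/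
theorem of_differentiableAt {F : ℝ → ℂ} (hF : DifferentiableAt ℝ F 0) :
    HasRate (fun n => F (1 / n)) (F 0) := by
  have := hF.isBigO_sub.comp_tendsto tendsto_one_div_atTop_nhds_zero_nat
  simpa [HasRate, Function.comp_def] using this

/-- Written as exp(n log(1 - k/n)), with the second order Taylor error of the logarithm; both
exponents are nonpositive, so exp is 1-Lipschitz between them. -/
theorem one_sub_div_pow {k : ℝ} (hk : 0 < k) :
    HasRate (fun n => ((1 - k / n : ℝ) : ℂ) ^ n) (Complex.exp (-k)) := by
  refine IsBigO.of_bound (2 * k ^ 2) ?_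
  have ev : ∀ᶠ n : ℕ in atTop, k / n ≤ 1 / 2 :=
    (tendsto_const_div_atTop_nhds_zero_nat k).eventually_le_const (by positivity)
  filter_upwards [ev, eventually_gt_atTop 0] with n h1 hn
  have hn' : (0 : ℝ) < n := by exact_mod_cast hn
  have h0 : 0 < k / n := by positivity
  have hpos : 0 < 1 - k / n := by linarith
  have hlog := Real.abs_log_sub_add_sum_range_le (x := k / n) (by
    rw [abs_of_pos h0]; linarith) 1
  simp only [Finset.sum_range_one, Nat.cast_zero, zero_add, pow_one, div_one, abs_of_pos h0] at hlog
  have e1 : ((1 - k / n : ℝ) : ℂ) ^ n = Complex.exp ((n * Real.log (1 - k / n) : ℝ) : ℂ) := by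
    rw [← Complex.ofReal_exp, mul_comm, Real.exp_mul, Real.exp_log hpos, Real.rpow_natCast]
    push_cast; rfl
  have hlog0 : Real.log (1 - k / n) ≤ 0 := Real.log_nonpos hpos.le (by linarith)
  have h2 := norm_exp_sub_exp_le (p := ((n * Real.log (1 - k / n) : ℝ) : ℂ)) (q := ((-k : ℝ) : ℂ))
    (R := 0) (by rw [Complex.ofReal_re]; exact mul_nonpos_of_nonneg_of_nonpos hn'.le hlog0)
    (by rw [Complex.ofReal_re]; linarith)
  rw [Real.exp_zero, one_mul, ← Complex.ofReal_sub, Complex.norm_real, Real.norm_eq_abs] at h2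
  rw [e1, ← Complex.ofReal_neg]
  refine h2.trans ?_
  have e2 : n * Real.log (1 - k / n) - -k = n * (k / n + Real.log (1 - k / n)) := by
    field_simp; ring
  rw [e2, abs_mul, abs_of_pos hn', Real.norm_of_nonneg (by positivity)]
  calc n * |k / n + Real.log (1 - k / n)| ≤ n * ((k / n) ^ (1 + 1) / (1 / 2)) := by
        refine mul_le_mul_of_nonneg_left (hlog.trans ?_) hn'.le
        gcongr
        linarith
    _ = _ := by rw [div_pow]; field_simp

end HasRate

/-! ### Parameters of the bulk scaling and assembly of the limit -/

theorem nu_eq {d : ℕ} (X : EuclideanSpace ℝ (Fin d)) (hX : ‖X‖ < 2) :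
    nu X = (Real.sqrt (1 - ‖X‖ ^ 2 / 4) / Real.pi) ^ d := by
  have h4 : ‖X‖ ^ 2 < 4 := by nlinarith [norm_nonneg X]
  have e : (4 - ‖X‖ ^ 2) = 2 ^ 2 * (1 - ‖X‖ ^ 2 / 4) := by ring
  rw [nu, Real.rpow_div_two_eq_sqrt _ (by linarith), Real.rpow_natCast, e,
    Real.sqrt_mul (by positivity), Real.sqrt_sq (by norm_num), div_pow, mul_pow, mul_pow]
  field_simp

theorem pow_rpow_div {d : ℕ} (hd : 0 < d) {v : ℝ} (hv : 0 < v) (a : ℝ) :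
    (v ^ d) ^ (a / (d : ℝ)) = v ^ a := by
  have : (d : ℝ) ≠ 0 := by exact_mod_cast hd.ne'
  rw [← Real.rpow_natCast, ← Real.rpow_mul hv.le, mul_div_cancel₀ _ this]

section Parameters

variable {d : ℕ} (X : EuclideanSpace ℝ (Fin d)) (v : ℝ) (U V : Fin d → ℂ) {n : ℕ}

theorem sum_sq_eq : ∑ k, X k ^ 2 = ‖X‖ ^ 2 := (EuclideanSpace.real_norm_sq_eq X).symm

theorem sum_zoomed_sq (hv : 0 < v) (hn : 0 < n) :
    ∑ k, (((Real.sqrt n : ℂ) * ((X k : ℂ) + U k / ((v * n : ℝ) : ℂ))) ^ 2 +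
      conj ((Real.sqrt n : ℂ) * ((X k : ℂ) + V k / ((v * n : ℝ) : ℂ))) ^ 2) =
      2 * (n * (‖X‖ : ℂ) ^ 2 + (∑ k, (X k : ℂ) * (U k + conj (V k))) / v +
        (∑ k, (U k ^ 2 + conj (V k) ^ 2)) / (2 * v ^ 2) / n) := by
  have hs : (Real.sqrt n : ℂ) ^ 2 = n := by
    rw [← Complex.ofReal_pow, Real.sq_sqrt (Nat.cast_nonneg n)]; simp
  have hv' : (v : ℂ) ≠ 0 := by exact_mod_cast hv.ne'
  have hn' : (n : ℂ) ≠ 0 := by exact_mod_cast hn.ne'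
  have hX : (‖X‖ : ℂ) ^ 2 = ∑ k, (X k : ℂ) ^ 2 := by
    exact_mod_cast (sum_sq_eq X).symm
  rw [hX, Finset.sum_div, Finset.sum_div, Finset.sum_div, Finset.mul_sum, ← Finset.sum_add_distrib,
    ← Finset.sum_add_distrib, Finset.mul_sum]
  refine Finset.sum_congr rfl fun k _ => ?_
  simp only [map_mul, map_add, map_div₀, Complex.conj_ofReal]
  rw [mul_pow, mul_pow, hs]
  push_cast
  field_simp
  ring

theorem sum_zoomed_sub_sq (hv : 0 < v) (hn : 0 < n) :
    ∑ k, ((Real.sqrt n : ℂ) * ((X k : ℂ) + U k / ((v * n : ℝ) : ℂ)) -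
      conj ((Real.sqrt n : ℂ) * ((X k : ℂ) + V k / ((v * n : ℝ) : ℂ)))) ^ 2 =
      (∑ k, (U k - conj (V k)) ^ 2) / v ^ 2 / n := by
  have hs : (Real.sqrt n : ℂ) ^ 2 = n := by
    rw [← Complex.ofReal_pow, Real.sq_sqrt (Nat.cast_nonneg n)]; simp
  have hv' : (v : ℂ) ≠ 0 := by exact_mod_cast hv.ne'
  have hn' : (n : ℂ) ≠ 0 := by exact_mod_cast hn.ne'
  rw [Finset.sum_div, Finset.sum_div]
  refine Finset.sum_congr rfl fun k _ => ?_
  simp only [map_mul, map_add, map_div₀, Complex.conj_ofReal]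
  rw [← mul_sub, mul_pow, hs]
  push_cast
  field_simp
  ring

theorem re_zoomed (k : Fin d) : ((Real.sqrt n : ℂ) * ((X k : ℂ) + U k / ((v * n : ℝ) : ℂ))).re =
    Real.sqrt n * (X k + (U k).re / (v * n)) := by
  rw [Complex.re_ofReal_mul, Complex.add_re, Complex.ofReal_re, Complex.div_ofReal_re]

theorem im_zoomed (k : Fin d) : ((Real.sqrt n : ℂ) * ((X k : ℂ) + U k / ((v * n : ℝ) : ℂ))).im =
    Real.sqrt n * ((U k).im / (v * n)) := by
  rw [Complex.im_ofReal_mul, Complex.add_im, Complex.ofReal_im, Complex.div_ofReal_im, zero_add]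

theorem sum_zoomed_re_sq (hv : 0 < v) (hn : 0 < n) :
    ∑ k, (((Real.sqrt n : ℂ) * ((X k : ℂ) + U k / ((v * n : ℝ) : ℂ))).re ^ 2 +
      ((Real.sqrt n : ℂ) * ((X k : ℂ) + V k / ((v * n : ℝ) : ℂ))).re ^ 2) =
      2 * (n * ‖X‖ ^ 2 + (∑ k, X k * ((U k).re + (V k).re)) / v +
        (∑ k, ((U k).re ^ 2 + (V k).re ^ 2)) / (2 * v ^ 2) / n) := by
  have hn' : (0 : ℝ) < n := by exact_mod_cast hn
  rw [← sum_sq_eq X, Finset.sum_div, Finset.sum_div, Finset.sum_div, Finset.mul_sum,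
    ← Finset.sum_add_distrib, ← Finset.sum_add_distrib, Finset.mul_sum]
  refine Finset.sum_congr rfl fun k _ => ?_
  rw [re_zoomed, re_zoomed, mul_pow, mul_pow, Real.sq_sqrt hn'.le]
  field_simp
  ring

theorem sum_zoomed_im_sq (hv : 0 < v) (hn : 0 < n) :
    ∑ k, (((Real.sqrt n : ℂ) * ((X k : ℂ) + U k / ((v * n : ℝ) : ℂ))).im ^ 2 +
      ((Real.sqrt n : ℂ) * ((X k : ℂ) + V k / ((v * n : ℝ) : ℂ))).im ^ 2) =
      (∑ k, (U k).im ^ 2 + ∑ k, (V k).im ^ 2) / v ^ 2 / n := by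
  have hn' : (0 : ℝ) < n := by exact_mod_cast hn
  rw [← Finset.sum_add_distrib, Finset.sum_div, Finset.sum_div]
  refine Finset.sum_congr rfl fun k _ => ?_
  rw [im_zoomed, im_zoomed, mul_pow, mul_pow, Real.sq_sqrt hn'.le]
  field_simp

end Parameters

/-- The exponent in front of the contour integral, as a function of `y = 1 / n`. -/
def outerExponent (x k M : ℝ) (T₁ T₂ T₃ T₄ : ℂ) (y : ℝ) : ℂ :=
  x ^ 2 * k / (2 * (1 - k * y) * (2 - k * y)) + (T₁ + T₂ * y) / (2 * (1 - k * y)) -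
    (T₃ + T₄ * y) / (2 - k * y) - M

theorem differentiableAt_outerExponent (x k M : ℝ) (T₁ T₂ T₃ T₄ : ℂ) :
    DifferentiableAt ℝ (outerExponent x k M T₁ T₂ T₃ T₄) 0 := by
  have h1 : DifferentiableAt ℝ (fun y : ℝ => (y : ℂ)) 0 := Complex.ofRealCLM.differentiableAt
  unfold outerExponent
  refine (((DifferentiableAt.div ?_ ?_ ?_).add (DifferentiableAt.div ?_ ?_ ?_)).sub
    (DifferentiableAt.div ?_ ?_ ?_)).sub (differentiableAt_const _)
  all_goals first
    | fun_prop
    | simp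

/-- The terms of order n cancel: nx²/(2τ) - nx²/(1+τ) = x²k/(2τ(1+τ)), since n(1-τ) = k. -/
theorem outerExponent_eq {x k M : ℝ} {T₁ T₂ T₃ T₄ : ℂ} {n : ℕ} (hn : 0 < n) (hk : 0 < k)
    (hτ : k / n ≤ 1 / 2) :
    -(2 * (n * (x : ℂ) ^ 2 + T₃ + T₄ / n) / (2 * (1 + ((1 - k / n : ℝ) : ℂ)))) -
      2 * M * k / n / (2 * (1 - ((1 - k / n : ℝ) : ℂ))) +
      2 * (n * (x : ℂ) ^ 2 + T₁ + T₂ / n) / (2 * ((1 - k / n : ℝ) : ℂ)) / 2 =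
    outerExponent x k M T₁ T₂ T₃ T₄ (1 / n) := by
  have hn' : (n : ℂ) ≠ 0 := by exact_mod_cast hn.ne'
  have hnR : (0 : ℝ) < n := by exact_mod_cast hn
  have hk' : (k : ℂ) ≠ 0 := by exact_mod_cast hk.ne'
  rw [div_le_iff₀ hnR] at hτ
  have h1 : (n : ℂ) - k ≠ 0 := by
    have : (n : ℝ) - k ≠ 0 := by
      have : 0 < (n : ℝ) - k := by linarith
      exact this.ne'
    exact_mod_cast this
  have h2 : 2 * (n : ℂ) - k ≠ 0 := by
    have : 2 * (n : ℝ) - k ≠ 0 := by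
      have : 0 < 2 * (n : ℝ) - k := by linarith
      exact this.ne'
    exact_mod_cast this
  have e1 : ((1 - k / n : ℝ) : ℂ) = (n - k) / n := by push_cast; field_simp
  have e2 : 1 + ((n : ℂ) - k) / n = (2 * n - k) / n := by field_simp; ring
  have e3 : 1 - ((n : ℂ) - k) / n = k / n := by field_simp; ring
  have e4 : 1 - (k : ℂ) * ((1 / n : ℝ) : ℂ) = (n - k) / n := by push_cast; field_simp
  have e5 : 2 - (k : ℂ) * ((1 / n : ℝ) : ℂ) = (2 * n - k) / n := by push_cast; field_simp
  rw [outerExponent, e4, e5, e1, e2, e3]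
  push_cast
  field_simp
  ring

theorem zoom_eq {d : ℕ} (X : EuclideanSpace ℝ (Fin d)) {v : ℝ} (hv : nu X ^ (1 / (d : ℝ)) = v)
    (n : ℕ) (U : Fin d → ℂ) :
    (fun k => (Real.sqrt n : ℂ) * zoom X n U k) =
      fun k => (Real.sqrt n : ℂ) * ((X k : ℂ) + U k / ((v * n : ℝ) : ℂ)) := by
  ext k; rw [zoom, hv]

/-- The factor in front of the contour integral. -/
theorem prefactor_eq {d n : ℕ} {k : ℝ} (hn : 0 < n) (hk : 0 < k) (hτ : k / n ≤ 1 / 2) (q : ℝ) :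
    1 / (q * (n : ℝ) ^ (2 * d)) * n ^ d *
      (1 / (Real.pi ^ d * (1 - (1 - k / n) ^ 2) ^ ((d : ℝ) / 2))) =
      1 / (q * Real.pi ^ d) * (Real.sqrt (k * (2 - k * (1 / n))) ^ d)⁻¹ *
        (Real.sqrt n ^ d)⁻¹ := by
  have hn' : (0 : ℝ) < n := by exact_mod_cast hn
  have h0 : 0 < k / n := by positivity
  have h1 : 0 < 2 - k / n := by linarith
  have e1 : 1 - (1 - k / n) ^ 2 = k * (2 - k * (1 / n)) / n := by field_simp; ring
  have h2 : 0 ≤ k * (2 - k * (1 / n)) / n := by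
    rw [mul_one_div]; positivity
  have h3 : Real.sqrt (k * (2 - k * (1 / n))) ≠ 0 := by
    rw [mul_one_div]; positivity
  have hs : Real.sqrt n ≠ 0 := (Real.sqrt_pos.2 hn').ne'
  have e2 : (n : ℝ) ^ d = Real.sqrt n ^ d * Real.sqrt n ^ d := by
    rw [← mul_pow, Real.mul_self_sqrt hn'.le]
  rw [e1, Real.rpow_div_two_eq_sqrt _ h2, Real.rpow_natCast, Real.sqrt_div' _ hn'.le, div_pow,
    pow_mul', pow_two, e2]
  field_simp

/-- The limit of the prefactor. -/
theorem limit_prefactor_eq (d : ℕ) {κ v lam : ℝ} (hκ : 0 < κ) (hv : 0 < v)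
    (hlam : Real.sqrt lam = v * Real.pi) :
    1 / ((v ^ d) ^ 2 * Real.pi ^ d) * (Real.sqrt (κ / v ^ 2 * 2) ^ d)⁻¹ *
      ((Real.sqrt 2)⁻¹ ^ d * Real.sqrt lam ^ d) = 1 / (4 * κ) ^ ((d : ℝ) / 2) := by
  have h4 : Real.sqrt (4 * κ) = Real.sqrt (κ / v ^ 2 * 2) * Real.sqrt 2 * v := by
    rw [← Real.sqrt_mul (by positivity)]
    nth_rewrite 2 [← Real.sqrt_sq hv.le]
    rw [← Real.sqrt_mul (by positivity)]
    congr 1; field_simp; ring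
  have h5 : Real.sqrt (κ / v ^ 2 * 2) ≠ 0 := by positivity
  have h6 : Real.sqrt 2 ≠ 0 := by positivity
  rw [Real.rpow_div_two_eq_sqrt _ (by positivity), Real.rpow_natCast, h4, hlam, mul_pow, mul_pow,
    mul_pow, inv_pow]
  field_simp

/-- **Bulk limit at weak non-Hermiticity.** -/
theorem bulk_limit {d : ℕ} (hd : 0 < d) (X : EuclideanSpace ℝ (Fin d)) (hX : ‖X‖ < 2) {κ : ℝ}
    (hκ : 0 < κ) (U V : Fin d → ℂ) :
    (fun n : ℕ => ((1 / (nu X ^ 2 * (n : ℝ) ^ (2 * d)) : ℝ) : ℂ) *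
        scaledKernel d (weakTau X κ n) n (zoom X n U) (zoom X n V) -
      bulkCocycle X U V * deformedSineKernel d κ U V)
      =O[atTop] fun n : ℕ => 1 / (n : ℝ) := by
  have hx4 : ‖X‖ ^ 2 < 4 := by nlinarith [norm_nonneg X]
  set x : ℝ := ‖X‖ with hx
  have hx0 : 0 ≤ x := norm_nonneg X
  set lam : ℝ := 1 - x ^ 2 / 4 with hlam
  have hlam0 : 0 < lam := by rw [hlam]; linarith
  set v : ℝ := Real.sqrt lam / Real.pi with hvd
  have hv : 0 < v := div_pos (Real.sqrt_pos.2 hlam0) Real.pi_pos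
  have hslam : Real.sqrt lam = v * Real.pi := by rw [hvd]; field_simp
  have hlamv : lam = (v * Real.pi) ^ 2 := by rw [← hslam, Real.sq_sqrt hlam0.le]
  have hnu : nu X = v ^ d := nu_eq X hX
  have hnu1 : nu X ^ (1 / (d : ℝ)) = v := by rw [hnu, pow_rpow_div hd hv, Real.rpow_one]
  have hnu2 : nu X ^ (2 / (d : ℝ)) = v ^ 2 := by
    rw [hnu, pow_rpow_div hd hv]; exact_mod_cast Real.rpow_natCast v 2
  have hnu3 : nu X ^ (-1 / (d : ℝ)) = v⁻¹ := by
    rw [hnu, pow_rpow_div hd hv, Real.rpow_neg_one]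
  -- Here v = ν(X)^{1/d}, so that τ = 1 - k/n. With v = √lam/π this makes k·lam = κπ², the argument
  -- of the incomplete Gamma functions.
  set k : ℝ := κ / v ^ 2 with hk
  have hk0 : 0 < k := by positivity
  have hkv : k * v ^ 2 = κ := by rw [hk]; field_simp
  have hA : k * lam = κ * Real.pi ^ 2 := by rw [hlamv, ← hkv]; ring
  have hτn : ∀ n : ℕ, weakTau X κ n = 1 - k / n := fun n => by
    rw [weakTau, hnu2, hk, div_div]
  have hvC : (v : ℂ) ≠ 0 := by exact_mod_cast hv.ne'
  set T₁ : ℂ := (∑ k, (X k : ℂ) * (U k + conj (V k))) / v with hT₁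
  set T₂ : ℂ := (∑ k, (U k ^ 2 + conj (V k) ^ 2)) / (2 * v ^ 2) with hT₂
  set T₃ : ℝ := (∑ k, X k * ((U k).re + (V k).re)) / v with hT₃
  set T₄ : ℝ := (∑ k, ((U k).re ^ 2 + (V k).re ^ 2)) / (2 * v ^ 2) with hT₄
  set M : ℝ := (∑ k, (U k).im ^ 2 + ∑ k, (V k).im ^ 2) / (2 * κ) with hM
  set S : ℂ := ∑ k, (U k - conj (V k)) ^ 2 with hS
  set δ₀ : ℂ := -(S / (2 * v ^ 2)) with hδ₀
  set τ : ℕ → ℂ := fun n => ((1 - k / n : ℝ) : ℂ) with hτ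
  set β : ℕ → ℂ := fun n => (x ^ 2 * k + T₁ + T₂ / n) / τ n with hβ
  set δ : ℕ → ℂ := fun n => δ₀ / n / τ n with hδ
  have ev0 : ∀ᶠ n : ℕ in atTop, k / n ≤ 1 / 2 :=
    (tendsto_const_div_atTop_nhds_zero_nat k).eventually_le_const (by positivity)
  have hτinv : ∀ n : ℕ, k / n ≤ 1 / 2 → ‖(τ n)⁻¹‖ ≤ 2 := fun n h => by
    rw [norm_inv, Complex.norm_real, Real.norm_of_nonneg (by linarith)]
    rw [inv_le_comm₀ (by linarith) two_pos]; linarith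
  set C : ℝ := (x ^ 2 * k + ‖T₁‖ + ‖T₂‖) * 2 + ‖δ₀‖ * 2 + ‖δ₀‖ * k * 2 with hC
  have hC0 : 0 ≤ C := by positivity
  have hadm : ∀ᶠ n : ℕ in atTop, Admissible x C n (β n) (δ n) := by
    filter_upwards [ev0, eventually_gt_atTop 0] with n h1 hn
    have hn1 : (1 : ℝ) ≤ n := by exact_mod_cast hn
    have hn' : (0 : ℝ) < n := by linarith
    have p1 : 0 ≤ ‖δ₀‖ * 2 := by positivity
    have p2 : 0 ≤ ‖δ₀‖ * k * 2 := by positivity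
    have p3 : 0 ≤ x ^ 2 * k + ‖T₁‖ + ‖T₂‖ := by positivity
    refine ⟨?_, fun hx' => ?_, ?_⟩
    · change ‖((x : ℂ) ^ 2 * k + T₁ + T₂ / n) / τ n‖ ≤ C
      rw [div_eq_mul_inv, norm_mul]
      have : ‖(x : ℂ) ^ 2 * k + T₁ + T₂ / n‖ ≤ x ^ 2 * k + ‖T₁‖ + ‖T₂‖ := by
        refine (norm_add_le _ _).trans (add_le_add ((norm_add_le _ _).trans
          (add_le_add (le_of_eq ?_) le_rfl)) ?_)
        · rw [norm_mul, norm_pow, Complex.norm_real, Complex.norm_real,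
            Real.norm_of_nonneg hx0, Real.norm_of_nonneg hk0.le]
        · rw [norm_div, Complex.norm_natCast]; exact div_le_self (norm_nonneg _) hn1
      calc _ ≤ (x ^ 2 * k + ‖T₁‖ + ‖T₂‖) * 2 := by gcongr; exact hτinv n h1
        _ ≤ C := by rw [hC]; linarith
    -- At X = 0 both x²k and T₁ vanish, which leaves ‖β‖ of order 1/n, as the far estimate at the
    -- centre requires.
    · have hX0 : X = 0 := norm_eq_zero.1 hx'
      have hT0 : T₁ = 0 := by rw [hT₁, hX0]; simp
      have : β n = T₂ / n * (τ n)⁻¹ := by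
        change ((x : ℂ) ^ 2 * k + T₁ + T₂ / n) / τ n = _
        rw [hT0, hx']; simp [div_eq_mul_inv]
      rw [this, norm_mul, norm_div, Complex.norm_natCast]
      calc ‖T₂‖ / n * ‖(τ n)⁻¹‖ ≤ ‖T₂‖ / n * 2 := by gcongr; exact hτinv n h1
        _ = ‖T₂‖ * 2 / n := by ring
        _ ≤ C / n := by
          gcongr
          have : 0 ≤ x ^ 2 * k := by positivity
          rw [hC]; linarith [norm_nonneg T₁]
    · change ‖δ₀ / n / τ n‖ ≤ C / n
      rw [div_eq_mul_inv (_ / _), norm_mul, norm_div, Complex.norm_natCast]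
      calc ‖δ₀‖ / n * ‖(τ n)⁻¹‖ ≤ ‖δ₀‖ / n * 2 := by gcongr; exact hτinv n h1
        _ = ‖δ₀‖ * 2 / n := by ring
        _ ≤ C / n := by gcongr; rw [hC]; linarith
  have hδδ : ∀ᶠ n : ℕ in atTop, ‖δ n - δ₀ / n‖ ≤ C / n ^ 2 := by
    filter_upwards [ev0, eventually_gt_atTop 0] with n h1 hn
    have hn' : (0 : ℝ) < n := by exact_mod_cast hn
    have hτ0 : τ n ≠ 0 := by
      have : (1 - k / n : ℝ) ≠ 0 := by
        have : 0 < 1 - k / n := by linarith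
        exact this.ne'
      exact Complex.ofReal_ne_zero.2 this
    have e : δ n - δ₀ / n = δ₀ / n * ((k / n : ℝ) : ℂ) * (τ n)⁻¹ := by
      have : ((k / n : ℝ) : ℂ) = 1 - τ n := by
        change _ = 1 - ((1 - k / n : ℝ) : ℂ)
        push_cast; ring
      rw [this]
      change δ₀ / n / τ n - δ₀ / n = _
      field_simp
    rw [e, norm_mul, norm_mul, norm_div, Complex.norm_natCast, Complex.norm_real,
      Real.norm_of_nonneg (by positivity)]
    have p1 : 0 ≤ ‖δ₀‖ * 2 := by positivity
    have p3 : 0 ≤ x ^ 2 * k + ‖T₁‖ + ‖T₂‖ := by positivity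
    calc ‖δ₀‖ / n * (k / n) * ‖(τ n)⁻¹‖ ≤ ‖δ₀‖ / n * (k / n) * 2 := by gcongr; exact hτinv n h1
      _ = ‖δ₀‖ * k * 2 / n ^ 2 := by ring
      _ ≤ C / n ^ 2 := by gcongr; rw [hC]; linarith
  have hJ : HasRate _ _ := kernelIntegral_asymptotics hd hx0 hX hk0 hC0 hadm hδδ
  have hE : HasRate (fun n => Complex.exp (outerExponent x k M T₁ T₂ T₃ T₄ (1 / n)))
      (Complex.exp (outerExponent x k M T₁ T₂ T₃ T₄ 0)) :=
    HasRate.of_differentiableAt (F := fun y => Complex.exp (outerExponent x k M T₁ T₂ T₃ T₄ y))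
      (differentiableAt_outerExponent x k M T₁ T₂ T₃ T₄).cexp
  have hR : HasRate (fun n => (((Real.sqrt (k * (2 - k * (1 / n))) ^ d)⁻¹ : ℝ) : ℂ))
      (((Real.sqrt (k * (2 - k * 0)) ^ d)⁻¹ : ℝ) : ℂ) := by
    refine HasRate.of_differentiableAt
      (F := fun y => (((Real.sqrt (k * (2 - k * y)) ^ d)⁻¹ : ℝ) : ℂ)) ?_
    have h2 : 0 < k * (2 - k * 0) := by rw [mul_zero, sub_zero]; positivity
    have h3 : DifferentiableAt ℝ (fun y => Real.sqrt (k * (2 - k * y))) 0 :=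
      DifferentiableAt.sqrt (by fun_prop) h2.ne'
    have h4 : DifferentiableAt ℝ (fun y => (Real.sqrt (k * (2 - k * y)) ^ d)⁻¹) 0 :=
      (h3.pow d).inv (pow_pos (Real.sqrt_pos.2 h2) d).ne'
    exact Complex.ofRealCLM.differentiableAt.comp (0 : ℝ) h4
  have hall := ((((HasRate.const ((1 / ((v ^ d) ^ 2 * Real.pi ^ d) : ℝ) : ℂ)).mul hR).mul hE).mul
    (HasRate.one_sub_div_pow hk0)).mul hJ
  have ev1 := exp_neg_div_lt hk0 (le_refl (10 * k))
  have hlimit : ((1 / ((v ^ d) ^ 2 * Real.pi ^ d) : ℝ) : ℂ) *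
      (((Real.sqrt (k * (2 - k * 0)) ^ d)⁻¹ : ℝ) : ℂ) *
      Complex.exp (outerExponent x k M T₁ T₂ T₃ T₄ 0) * Complex.exp (-k) *
      (((2 : ℂ) ^ (-1 / 2 : ℂ)) ^ d * (((Real.sqrt lam ^ d * Real.exp (k * lam) : ℝ) : ℂ) *
        ∑' j : ℕ, (δ₀ * (lam : ℝ) / 2) ^ j / (j ! : ℂ) * (incGamma (2 * j + d) (k * lam) : ℂ))) =
      bulkCocycle X U V * deformedSineKernel d κ U V := by
    have s1 : (2 : ℂ) ^ (-1 / 2 : ℂ) = (((Real.sqrt 2)⁻¹ : ℝ) : ℂ) := by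
      rw [Real.sqrt_eq_rpow, ← Real.rpow_neg two_pos.le, Complex.ofReal_cpow two_pos.le]
      congr 1; push_cast; ring
    have s2 : δ₀ * (lam : ℝ) / 2 = -(S * (Real.pi : ℂ) ^ 2 / 4) := by
      rw [hδ₀, hlamv]; push_cast; field_simp; ring
    have s3 : T₁ - T₃ = Complex.I * ((v⁻¹ * ∑ k, X k * (U k - V k).im : ℝ) : ℂ) := by
      rw [hT₁, hT₃]
      push_cast
      rw [← sub_div, ← Finset.sum_sub_distrib, div_eq_inv_mul, mul_left_comm, Finset.mul_sum _ _ Complex.I]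
      congr 1
      refine Finset.sum_congr rfl fun j _ => ?_
      have e1 := Complex.re_add_im (U j)
      have e2 : conj (V j) = ((V j).re : ℂ) - (V j).im * Complex.I := by
        apply Complex.ext <;> simp
      rw [e2]
      nth_rewrite 1 [← e1]
      rw [Complex.sub_im]
      push_cast; ring
    -- The three exponentials come from the outer factor, from τ^n and from the model integral.
    -- Their κ-dependent constants cancel because x²k/4 - k + k·lam = 0; what remains is the cocycle
    -- and the Gaussian factor.
    have s4 : Complex.exp (outerExponent x k M T₁ T₂ T₃ T₄ 0) * Complex.exp (-k) *
        ((Real.exp (k * lam) : ℝ) : ℂ) = bulkCocycle X U V * ((Real.exp (-M) : ℝ) : ℂ) := by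
      rw [bulkCocycle, hnu3, Complex.ofReal_exp, Complex.ofReal_exp, ← Complex.exp_add,
        ← Complex.exp_add, ← Complex.exp_add]
      congr 1
      have : Complex.I * ((v⁻¹ * (1 / 2) * ∑ k, X k * (U k - V k).im : ℝ) : ℂ) =
          (T₁ - T₃) / 2 := by
        rw [s3]; push_cast; ring
      rw [this, outerExponent, hlam]
      push_cast
      ring
    have s5 := congrArg (fun t : ℝ => (t : ℂ)) (limit_prefactor_eq d hκ hv hslam)
    beta_reduce at s5
    have hM' : -((∑ k, (U k).im ^ 2 + ∑ k, (V k).im ^ 2) / (2 * κ)) = -M := rfl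
    rw [deformedSineKernel_eq_tsum hd hκ.le, hM', ← hS, s1, s2, hA, div_eq_mul_one_div
      (Real.exp (-M)), Complex.ofReal_mul (Real.exp (-M)), ← s5, ← hk]
    rw [hA] at s4
    push_cast at s4 ⊢
    rw [mul_zero, sub_zero]
    set E₁ := ∑' j : ℕ, (-(S * (Real.pi : ℂ) ^ 2 / 4)) ^ j / (j ! : ℂ) *
      (incGamma (2 * j + d) (κ * Real.pi ^ 2) : ℂ)
    linear_combination (1 / (((v : ℂ) ^ d) ^ 2 * (Real.pi : ℂ) ^ d) *
      ((Real.sqrt (k * 2) : ℂ) ^ d)⁻¹ * ((Real.sqrt 2 : ℂ)⁻¹ ^ d * (Real.sqrt lam : ℂ) ^ d) *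
        E₁) * s4
  rw [← hlimit]
  refine hall.isBigO.congr' ?_ EventuallyEq.rfl
  filter_upwards [ev0, ev1, eventually_gt_atTop 0] with n h1 h2 hn
  have hn' : (0 : ℝ) < n := by exact_mod_cast hn
  have hkn : 0 < k / n := by positivity
  have hτ0 : 0 < 1 - k / n := by linarith
  congr 1
  rw [scaledKernel, hτn, zoom_eq X hnu1, zoom_eq X hnu1,
    planarKernel_eq hτ0 (by linarith) hn h2 x, sum_zoomed_sq X v U V hv hn,
    sum_zoomed_sub_sq X v U V hv hn, sum_zoomed_re_sq X v U V hv hn,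
    sum_zoomed_im_sq X v U V hv hn, ← hx, ← hT₁, ← hT₂, ← hT₃, ← hT₄, ← hS]
  have hτC : τ n ≠ 0 := by
    have : (1 - k / n : ℝ) ≠ 0 := hτ0.ne'
    exact Complex.ofReal_ne_zero.2 this
  have hnC : (n : ℂ) ≠ 0 := by exact_mod_cast hn.ne'
  have b1 : 2 * (n * (x : ℂ) ^ 2 + T₁ + T₂ / n) / (2 * ((1 - k / n : ℝ) : ℂ)) - n * (x : ℂ) ^ 2 =
      β n := by
    change 2 * (n * (x : ℂ) ^ 2 + T₁ + T₂ / n) / (2 * τ n) - n * (x : ℂ) ^ 2 = β n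
    have hk' : (k : ℂ) = n * (1 - τ n) := by
      change _ = (n : ℂ) * (1 - ((1 - k / n : ℝ) : ℂ))
      push_cast; field_simp; ring
    change _ = ((x : ℂ) ^ 2 * k + T₁ + T₂ / n) / τ n
    rw [hk']
    field_simp
    ring
  have b2 : -(S / v ^ 2 / n) / (2 * ((1 - k / n : ℝ) : ℂ)) = δ n := by
    change -(S / v ^ 2 / n) / (2 * τ n) = δ n
    change _ = -(S / (2 * v ^ 2)) / n / τ n
    field_simp
  have b3 := outerExponent_eq (x := x) (M := M) (T₁ := T₁) (T₂ := T₂) (T₃ := T₃) (T₄ := T₄)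
    hn hk0 h1
  have b4 : (((-(2 * (n * x ^ 2 + T₃ + T₄ / n) / (2 * (1 + (1 - k / n)))) -
      (∑ k, (U k).im ^ 2 + ∑ k, (V k).im ^ 2) / v ^ 2 / n / (2 * (1 - (1 - k / n))) : ℝ) : ℝ) : ℂ) =
      -(2 * (n * (x : ℂ) ^ 2 + T₃ + T₄ / n) / (2 * (1 + ((1 - k / n : ℝ) : ℂ)))) -
        2 * M * k / n / (2 * (1 - ((1 - k / n : ℝ) : ℂ))) := by
    have : (∑ k, (U k).im ^ 2 + ∑ k, (V k).im ^ 2) / v ^ 2 = 2 * M * k := by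
      rw [hM, ← hkv]; field_simp
    rw [this]; push_cast; ring
  rw [b1, b2, b4, b3]
  have b5 := congrArg (fun t : ℝ => (t : ℂ)) (prefactor_eq (d := d) hn hk0 h1 ((v ^ d) ^ 2))
  beta_reduce at b5
  rw [hnu]
  have b6 : (n : ℂ) ^ d = ((n ^ d : ℝ) : ℂ) := by push_cast; ring
  rw [Complex.ofReal_mul, Complex.ofReal_mul, Complex.ofReal_mul, Complex.ofReal_mul] at b5
  rw [← Complex.ofReal_neg, b6]
  generalize (∫ θ : ℝ in -Real.pi..Real.pi, kernelIntegrand d x (1 - k / n) n (β n) (δ n)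
    (((-(10 * k / n) : ℝ) : ℂ) + θ * Complex.I)) = I
  linear_combination -(Complex.exp (outerExponent x k M T₁ T₂ T₃ T₄ (1 / n)) *
    ((1 - k / n : ℝ) : ℂ) ^ n * ((2 * (Real.pi : ℂ))⁻¹ * I)) * b5

end WeakNonHermitian

end

open WeakNonHermitian in
theorem mainTheorem8 (d : ℕ) (hd : 0 < d) :
    -- bulk limit at weak non-Hermiticity, with rate, and its prefactor is a cocycle
    (∀ X : EuclideanSpace ℝ (Fin d), ‖X‖ < 2 →
      (∀ κ : ℝ, 0 < κ → ∀ U V : Fin d → ℂ,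
        (fun n : ℕ =>
            ((1 / (nu X ^ 2 * (n : ℝ) ^ (2 * d)) : ℝ) : ℂ) *
                scaledKernel d (weakTau X κ n) n (zoom X n U) (zoom X n V) -
              bulkCocycle X U V * deformedSineKernel d κ U V)
          =O[atTop] fun n : ℕ => 1 / (n : ℝ)) ∧
      IsCocycle (bulkCocycle X)) ∧
    -- interpolation: the limit `κ ↓ 0` on `ℝ^d`
    (∀ x y : Fin d → ℝ,
      Tendsto
        (fun κ : ℝ => (((Real.pi * κ) ^ ((d : ℝ) / 2) : ℝ) : ℂ) *
          deformedSineKernel d κ (fun k => (x k : ℂ)) (fun k => (y k : ℂ)))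
        (𝓝[>] 0) (𝓝 (realSineKernel d x y))) ∧
    -- interpolation: the limit `κ → ∞` on the scale `√κ` of `ℂ^d`
    (∀ u v : Fin d → ℂ,
      Tendsto
        (fun κ : ℝ => ((κ ^ d : ℝ) : ℂ) *
          deformedSineKernel d κ
            (fun k => (Real.sqrt κ : ℂ) * u k) (fun k => (Real.sqrt κ : ℂ) * v k))
        atTop (𝓝 (ginibreCocycle d u v * ginibreKernel d u v))) ∧
    IsCocycle (ginibreCocycle d) :=
  ⟨fun X hX => ⟨fun _ hκ U V => bulk_limit hd X hX hκ U V, isCocycle_bulkCocycle X⟩,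
    fun x y => tendsto_deformedSineKernel_zero hd x y,
    fun u v => tendsto_deformedSineKernel_atTop hd u v, isCocycle_ginibreCocycle d⟩
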